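/- **Conventions.** All graphs are finite and simple. A *plane graph* is a graph drawn in the plane: vertices are distinct points, edges are simple polygonal arcs joining their end vertices and passing through no other vertex, and distinct edges meet at most in a common end vertex. Its *faces* are the connected components of the complement of the drawing. An orientation of a plane graph is *Pfaffian* if for every bounded face $F$ the number of clockwise oriented edges on the boundary of $F$ is odd; here an oriented edge bordering $F$ is clockwise oriented if $F$ lies to its right (so an edge with $F$ on both sides counts once). Let $G_1,\dots,G_k$ be simple plane graphs, with $V(G_i)$ labelled $1,\dots,|V(G_i)|$ and vertices identified with their labels, such that in each $G_i$ no connected component is enclosed by a cycle of another component (e.g. every $G_i$ is connected), and let $\mathcal O_i$ be a Pfaffian orientation of $G_i$. Let $P=G_1\square\cdots\square G_k$ be the Cartesian product, with vertex weights $x(v)$ and edge weights $a_{v,v'}=a_{v',v}$ in a commutative ring. A *$G_i$-edge* of $P$ joins two vertices that differ exactly in the $i$-th coordinate. The oriented Cartesian product $(P,\mathcal O)$ is oriented as follows: if $u_i\to u_i'$ in $\mathcal O_i$, then $(u_1,\dots,u_i,\dots,u_k)\to(u_1,\dots,u_i',\dots,u_k)$ if $u_{i+1}+\dots+u_k+(k-i)$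 is even, and the reverse orientation is taken otherwise. The generalised adjacency matrix $\mathcal K_P$ of $(P,\mathcal O)$ has entries $\mathcal K_P(v,v)=x(v)$, $\mathcal K_P(v,v')=a_{v,v'}$ if $v\to v'$, $\mathcal K_P(v,v')=-a_{v,v'}$ if $v'\to v$, and $0$ otherwise. **The model.** A *directed even loop* in $P$ is $\ell=(w_0,w_1,\dots,w_{2s}=w_0)$ with $s\ge 1$, $w_0,\dots,w_{2s-1}$ distinct and consecutive vertices adjacent ($s=1$: a doubled edge, whose two traversals count as two different edges of $\ell$). Its *$i$-projection* is the directed multigraph on $V(G_i)$ with one edge for each step $w_j\to w_{j+1}$ of $\ell$ along a $G_i$-edge, directed from the $i$-th coordinate of $w_j$ to that of $w_{j+1}$. A *compatible cycle decomposition* $\mathcal D$ of the $i$-projection is a partition of its edges into directed cycles (with distinct vertices) that respect these directions. For a cycle $d\in\mathcal D$ let $\chi(d)$ be the number of vertices of $G_i$ enclosed by the closed curve that $d$ traces in the drawing of $G_i$ (so $\chi(d)=0$ if $d$ has size $2$), and let $$\operatorname{sgn}(\mathcal D)=\prod_{d\in\mathcal D}\begin{cases}(-1)^{\chi(d)}&\text{if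 $d$ has odd size and is directed clockwise,}\\(-1)^{\chi(d)+1}&\text{if $d$ has even size, or has odd size and is directed anticlockwise.}\end{cases}$$ Let $e_i$ be the number of steps of $\ell$ along $G_i$-edges, at vertices $(v_1,\dots,v_k)$ with $v_{i+1}+\dots+v_k+(k-i)$ odd. Given compatible cycle decompositions $\mathcal D_i$ of the $i$-projections, put $$\operatorname{sgn}(\ell)=-\prod_{i=1}^{k-1}(-1)^{e_i}\prod_{j=1}^k\operatorname{sgn}(\mathcal D_j),\qquad w(\ell)=\operatorname{sgn}(\ell)\prod_{j=0}^{2s-1}a_{w_j,w_{j+1}}.$$ A *monopole-dimer configuration* $C$ is a set of pairwise vertex-disjoint directed even loops in $P$, the uncovered vertices being isolated; its weight is $w(C)=\prod_{\ell\in C}w(\ell)\prod_{v\text{ isolated}}x(v)$, and the signed partition function is $\mathcal Z_P=\sum_C w(C)$. **Theorem.** Every directed even loop in $P$ admits compatible cycle decompositions of all its projections, $\operatorname{sgn}(\ell)$ does not depend on which of them are chosen, and (for any choice of them) $$\mathcal Z_P=\det\mathcal K_P .$$ -/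

import Mathlib

open scoped Topology

noncomputable section

/-! ### Polygonal arcs in the plane -/

/-- The subset of the plane covered by the polygonal line with the successive corners `l`. -/
def polylineCarrier : List ℂ → Set ℂ
  | [] => ∅
  | [p] => {p}
  | p :: q :: l => segment ℝ p q ∪ polylineCarrier (q :: l)

/-- The polygonal line with the successive corners `l` is a (simple) arc: its segments are
non-degenerate, consecutive segments share only their common corner, and other segments are
disjoint. -/
def IsPolygonalArc : List ℂ → Prop
  | p :: q :: l =>
      p ≠ q ∧ segment ℝ p q ∩ polylineCarrier (q :: l) = {q} ∧ IsPolygonalArc (q :: l)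
  | _ => True

/-- Travelling along the polygonal line with the successive corners `l`, the points immediately to
the right lie in `S` (tested at the midpoint of every segment; `-I * (q - p)` is the direction
`q - p` turned clockwise by a right angle). -/
def RightSideIn (S : Set ℂ) : List ℂ → Prop
  | p :: q :: l =>
      (∀ᶠ ε : ℝ in 𝓝[>] 0, (p + q) / 2 + (ε : ℂ) * (-Complex.I * (q - p)) ∈ S) ∧
        RightSideIn S (q :: l)
  | _ => True

/-- The points enclosed by `S`: those that lie off `S`, in a bounded connected component of the
complement of `S`. -/
def enclosedBy (S : Set ℂ) : Set ℂ :=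
  {z | z ∉ S ∧ Bornology.IsBounded (connectedComponentIn Sᶜ z)}

/-! ### Plane graphs -/

/-- An embedding of the simple graph `G` in the plane, with edges drawn as polygonal arcs: vertices
are distinct points, the edge `uv` is a simple polygonal arc from `u` to `v` that contains no other
vertex, and two different edges meet at most in a common end vertex. Only the values of `bends` at
adjacent pairs matter. -/
structure PlaneDrawing {V : Type*} (G : SimpleGraph V) where
  /-- the point representing a vertex -/
  pos : V → ℂ
  /-- the interior corners of the arc representing the edge `uv`, listed from `u` to `v` -/
  bends : V → V → List ℂ
  pos_injective : Function.Injective pos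
  bends_reverse : ∀ u v, G.Adj u v → bends v u = (bends u v).reverse
  isPolygonalArc : ∀ u v, G.Adj u v → IsPolygonalArc (pos u :: (bends u v ++ [pos v]))
  vertex_notMem : ∀ u v w, G.Adj u v → w ≠ u → w ≠ v →
    pos w ∉ polylineCarrier (pos u :: (bends u v ++ [pos v]))
  edges_inter : ∀ u v u' v', G.Adj u v → G.Adj u' v' → s(u, v) ≠ s(u', v') →
    polylineCarrier (pos u :: (bends u v ++ [pos v])) ∩
        polylineCarrier (pos u' :: (bends u' v' ++ [pos v'])) ⊆
      {z | ∃ w, w ∈ s(u, v) ∧ w ∈ s(u', v') ∧ z = pos w}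

namespace PlaneDrawing

variable {V : Type*} {G : SimpleGraph V} (D : PlaneDrawing G)

/-- The corners of the arc representing the edge `uv`, listed from `u` to `v`. -/
def corners (u v : V) : List ℂ := D.pos u :: (D.bends u v ++ [D.pos v])

/-- The arc representing the edge `uv`. -/
def arc (u v : V) : Set ℂ := polylineCarrier (D.corners u v)

/-- The subset of the plane covered by the drawn graph. -/
def carrier : Set ℂ := Set.range D.pos ∪ {z | ∃ u v, G.Adj u v ∧ z ∈ D.arc u v}

/-- A face: a connected component of the complement of the drawn graph. -/
def IsFace (F : Set ℂ) : Prop := ∃ z ∈ D.carrierᶜ, F = connectedComponentIn D.carrierᶜ z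

/-- The edge `uv`, traversed from `u` to `v`, has the region `S` immediately to its right. -/
def RightOf (u v : V) (S : Set ℂ) : Prop := RightSideIn S (D.corners u v)

/-- The closed curve traced by a closed walk of the drawn graph. -/
def walkCarrier {u : V} (c : G.Walk u u) : Set ℂ := {z | ∃ d ∈ c.darts, z ∈ D.arc d.fst d.snd}

/-- No connected component of the graph is enclosed by a cycle of another component. This holds in
particular if the graph is connected. -/
def NoNestedComponents : Prop :=
  ∀ (u : V) (c : G.Walk u u), c.IsCycle →
    ∀ v : V, D.pos v ∈ enclosedBy (D.walkCarrier c) → G.Reachable u v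

end PlaneDrawing

/-! ### Orientations -/

/-- An orientation of a simple graph: exactly one direction is chosen for each edge. -/
structure GraphOrientation {V : Type*} (G : SimpleGraph V) where
  /-- `arrow u v` means `u → v` -/
  arrow : V → V → Prop
  adj_of_arrow : ∀ u v, arrow u v → G.Adj u v
  arrow_or_arrow : ∀ u v, G.Adj u v → arrow u v ∨ arrow v u
  asymm : ∀ u v, arrow u v → ¬ arrow v u

/-- An orientation of a plane graph is Pfaffian if every bounded face has an odd number of clockwise
oriented edges on its boundary. An edge `u → v` is clockwise oriented with respect to a bounded face
that it borders if the face lies to its right. -/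
def PlaneDrawing.IsPfaffian {V : Type*} {G : SimpleGraph V} (D : PlaneDrawing G)
    (O : GraphOrientation G) : Prop :=
  ∀ F : Set ℂ, D.IsFace F → Bornology.IsBounded F →
    Odd (Set.ncard {p : V × V | O.arrow p.1 p.2 ∧ D.RightOf p.1 p.2 F})

/-! ### Directed cycles and directed cycle decompositions in a multigraph -/

section Cycles

variable {E W : Type*} [Fintype E] [DecidableEq E]

/-- Let `E` be the edges of a multigraph on `W`, each directed from its tail to its head. A directed
cycle `(e₁, …, eₘ)` is recorded as the cyclic permutation `e₁ ↦ e₂ ↦ ⋯ ↦ eₘ ↦ e₁`, whose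
support is the set of edges of the cycle; its vertices are distinct. -/
def IsDirectedCycle (tail head : E → W) (c : Equiv.Perm E) : Prop :=
  c.IsCycle ∧ (∀ e ∈ c.support, head e = tail (c e)) ∧ Set.InjOn tail (c.support : Set E)

/-- A decomposition of the whole edge set `E` into edge-disjoint directed cycles which respect the
given directions of the edges. -/
structure CycleDecomposition (tail head : E → W) where
  /-- the cycles of the decomposition -/
  cycles : Finset (Equiv.Perm E)
  isDirectedCycle : ∀ c ∈ cycles, IsDirectedCycle tail head c
  edge_disjoint : ∀ c ∈ cycles, ∀ c' ∈ cycles, c ≠ c' → _root_.Disjoint c.support c'.support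
  cover : ∀ e : E, ∃ c ∈ cycles, e ∈ c.support

namespace PlaneDrawing

variable {G : SimpleGraph W} (D : PlaneDrawing G)

/-- The closed curve traced by a directed cycle whose edges are (parallel copies of) edges
of the drawn graph. -/
def cycleCarrier (tail head : E → W) (c : Equiv.Perm E) : Set ℂ :=
  {z | ∃ e ∈ c.support, z ∈ D.arc (tail e) (head e)}

/-- The number of vertices of the drawn graph that are enclosed by a directed cycle. -/
def enclosedCount (tail head : E → W) (c : Equiv.Perm E) : ℕ :=
  Set.ncard {w : W | D.pos w ∈ enclosedBy (D.cycleCarrier tail head c)}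

/-- A directed cycle is directed clockwise: the enclosed region lies to the right of its edges. -/
def IsClockwise (tail head : E → W) (c : Equiv.Perm E) : Prop :=
  ∀ e ∈ c.support, D.RightOf (tail e) (head e) (enclosedBy (D.cycleCarrier tail head c))

open Classical in
/-- The sign of a directed cycle decomposition: every cycle `d` contributes `(-1)^χ(d)` if it has
odd size and is directed clockwise, and `(-1)^(χ(d)+1)` otherwise, where `χ(d)` is the number of
vertices enclosed by `d`. -/
def decompositionSign {tail head : E → W} (𝒟 : CycleDecomposition tail head) : ℤ :=
  ∏ d ∈ 𝒟.cycles,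
    if Odd d.support.card ∧ D.IsClockwise tail head d then
      (-1) ^ D.enclosedCount tail head d
    else (-1) ^ (D.enclosedCount tail head d + 1)

end PlaneDrawing

end Cycles

/-! ### Loop-vertex configurations and the generalised adjacency matrix -/

section Configurations

variable {V : Type*} [Fintype V] [DecidableEq V]

/-- A directed loop `(v₀, v₁, …, v₂ₛ = v₀)` of even length `2s ≥ 2` in `G`, recorded as the cyclic
permutation `vⱼ ↦ vⱼ₊₁`. Loops of length two are the doubled edges. -/
def EvenLoop (G : SimpleGraph V) : Type _ :=
  {σ : Equiv.Perm V // σ.IsCycle ∧ Even σ.support.card ∧ ∀ v ∈ σ.support, G.Adj v (σ v)}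

instance (G : SimpleGraph V) : Fintype (EvenLoop G) :=
  @Fintype.ofFinite _ (inferInstanceAs (Finite {σ : Equiv.Perm V //
    σ.IsCycle ∧ Even σ.support.card ∧ ∀ v ∈ σ.support, G.Adj v (σ v)}))

/-- The vertices covered by a directed loop. -/
def EvenLoop.support {G : SimpleGraph V} (ℓ : EvenLoop G) : Finset V := ℓ.1.support

/-- The vertex following `v` on a directed loop. -/
def EvenLoop.next {G : SimpleGraph V} (ℓ : EvenLoop G) (v : V) : V := ℓ.1 v

/-- A loop-vertex configuration: a set of vertex-disjoint directed even loops (the uncovered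
vertices being its isolated vertices). -/
def LoopConfiguration (G : SimpleGraph V) : Type _ :=
  {C : Finset (EvenLoop G) // ∀ ℓ ∈ C, ∀ ℓ' ∈ C, ℓ ≠ ℓ' → _root_.Disjoint ℓ.support ℓ'.support}

instance (G : SimpleGraph V) : Fintype (LoopConfiguration G) :=
  @Fintype.ofFinite _ (inferInstanceAs (Finite {C : Finset (EvenLoop G) //
    ∀ ℓ ∈ C, ∀ ℓ' ∈ C, ℓ ≠ ℓ' → _root_.Disjoint ℓ.support ℓ'.support}))

open Classical in
/-- The partition function `∑_C ∏_{ℓ ∈ C} w(ℓ) ∏_{v isolated in C} x(v)` for given loop weights `w`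
and vertex weights `x`. -/
def partitionFunction {R : Type*} [CommRing R] (G : SimpleGraph V) (w : EvenLoop G → R)
    (x : V → R) : R :=
  ∑ C : LoopConfiguration G,
    (∏ ℓ ∈ C.1, w ℓ) * ∏ v with ∀ ℓ ∈ C.1, v ∉ ℓ.support, x v

open Classical in
/-- The generalised (signed) adjacency matrix of an oriented graph with vertex weights `x` and edge
weights `a`. -/
def generalisedAdjacency {R : Type*} [CommRing R] {G : SimpleGraph V} (O : GraphOrientation G)
    (x : V → R) (a : Sym2 V → R) : Matrix V V R :=
  Matrix.of fun v v' =>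
    if v = v' then x v
    else if O.arrow v v' then a s(v, v')
    else if O.arrow v' v then - a s(v, v')
    else 0

end Configurations

/-! ### Cartesian products -/

section Product

variable {k : ℕ} {n : Fin k → ℕ}

/-- The Cartesian product of graphs `G i` with vertex sets `Fin (n i)`. -/
def cartesianProduct (G : ∀ i, SimpleGraph (Fin (n i))) : SimpleGraph (∀ i, Fin (n i)) where
  Adj u v := ∃ i, (G i).Adj (u i) (v i) ∧ ∀ j, j ≠ i → u j = v j
  symm := ⟨fun _ _ ⟨i, h, h'⟩ => ⟨i, h.symm, fun j hj => (h' j hj).symm⟩⟩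
  loopless := ⟨fun _ ⟨i, h, _⟩ => (G i).loopless.irrefl _ h⟩

/-- The number `u_{i+1} + ⋯ + u_k + (k - i)`, for the natural labelling of the vertices of each
factor by `1, 2, …` and `i` counted from `1`. The label of `v : Fin m` is `v + 1`, and the index
`i : Fin k` is the `(i + 1)`-st one. -/
def laterSum (i : Fin k) (u : ∀ i, Fin (n i)) : ℕ :=
  (∑ j ∈ Finset.Ioi i, ((u j : ℕ) + 1)) + (k - ((i : ℕ) + 1))

lemma laterSum_congr {i : Fin k} {u v : ∀ i, Fin (n i)} (h : ∀ j, j ≠ i → u j = v j) :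
    laterSum i u = laterSum i v := by
  unfold laterSum
  congr 1
  refine Finset.sum_congr rfl fun j hj => ?_
  rw [h j (Finset.mem_Ioi.1 hj).ne']

/-- The orientation of the oriented Cartesian product. -/
def cartesianOrientation {G : ∀ i, SimpleGraph (Fin (n i))} (O : ∀ i, GraphOrientation (G i)) :
    GraphOrientation (cartesianProduct G) where
  arrow u v := ∃ i, (∀ j, j ≠ i → u j = v j) ∧
    ((Even (laterSum i u) ∧ (O i).arrow (u i) (v i)) ∨
      (¬ Even (laterSum i u) ∧ (O i).arrow (v i) (u i)))
  adj_of_arrow := by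
    rintro u v ⟨i, h, ⟨-, h'⟩ | ⟨-, h'⟩⟩
    · exact ⟨i, (O i).adj_of_arrow _ _ h', h⟩
    · exact ⟨i, ((O i).adj_of_arrow _ _ h').symm, h⟩
  arrow_or_arrow := by
    rintro u v ⟨i, h, h'⟩
    have hs : laterSum i v = laterSum i u := (laterSum_congr h').symm
    have hsymm : ∀ j, j ≠ i → v j = u j := fun j hj => (h' j hj).symm
    by_cases he : Even (laterSum i u) <;> rcases (O i).arrow_or_arrow _ _ h with ha | ha
    · exact Or.inl ⟨i, h', Or.inl ⟨he, ha⟩⟩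
    · exact Or.inr ⟨i, hsymm, Or.inl ⟨hs ▸ he, ha⟩⟩
    · exact Or.inr ⟨i, hsymm, Or.inr ⟨hs ▸ he, ha⟩⟩
    · exact Or.inl ⟨i, h', Or.inr ⟨he, ha⟩⟩
  asymm := by
    rintro u v ⟨i, h, h'⟩ ⟨j, g, g'⟩
    have hne : u i ≠ v i := by
      rcases h' with ⟨-, h'⟩ | ⟨-, h'⟩
      · exact ((O i).adj_of_arrow _ _ h').ne
      · exact ((O i).adj_of_arrow _ _ h').ne'
    obtain rfl : i = j := by
      by_contra hij
      exact hne (g i hij).symm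
    have hs : laterSum i v = laterSum i u := (laterSum_congr h).symm
    rw [hs] at g'
    rcases h' with ⟨he, h'⟩ | ⟨he, h'⟩ <;> rcases g' with ⟨ge, g'⟩ | ⟨ge, g'⟩
    · exact (O i).asymm _ _ h' g'
    · exact ge he
    · exact he ge
    · exact (O i).asymm _ _ h' g'

/-! ### The extended monopole-dimer model -/

variable {G : ∀ i, SimpleGraph (Fin (n i))}

/-- The edges of the `i`-projection of a directed loop `ℓ`: the steps `v → ℓ.next v` of `ℓ` along
`G i`-edges, each recorded by its initial vertex `v`. Different steps give parallel edges if they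
project to the same edge of `G i`; the two steps of a doubled edge are also different. -/
abbrev projectionEdges (ℓ : EvenLoop (cartesianProduct G)) (i : Fin k) : Type :=
  {v : ∀ i, Fin (n i) // v ∈ ℓ.support ∧ v i ≠ ℓ.next v i}

/-- The initial vertex in `G i` of an edge of the `i`-projection. -/
def projectionTail (ℓ : EvenLoop (cartesianProduct G)) (i : Fin k) (e : projectionEdges ℓ i) :
    Fin (n i) := e.1 i

/-- The final vertex in `G i` of an edge of the `i`-projection. -/
def projectionHead (ℓ : EvenLoop (cartesianProduct G)) (i : Fin k) (e : projectionEdges ℓ i) :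
    Fin (n i) := ℓ.next e.1 i

/-- The directed cycle decompositions of the `i`-projection of `ℓ` that are compatible with it. -/
abbrev ProjectionDecomposition (ℓ : EvenLoop (cartesianProduct G)) (i : Fin k) : Type :=
  CycleDecomposition (projectionTail ℓ i) (projectionHead ℓ i)

/-- The number `e_i`: the number of `G i`-edges of `ℓ`, a doubled edge being counted twice, that lie
in copies of `G i` for which `v_{i+1} + ⋯ + v_k + (k - i)` is odd. -/
def flippedCount (ℓ : EvenLoop (cartesianProduct G)) (i : Fin k) : ℕ :=
  Set.ncard {v | v ∈ ℓ.support ∧ v i ≠ ℓ.next v i ∧ Odd (laterSum i v)}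

/-- The sign of a directed even loop in the Cartesian product of plane graphs, computed from given
cycle decompositions of its projections. -/
def loopSign (D : ∀ i, PlaneDrawing (G i)) (ℓ : EvenLoop (cartesianProduct G))
    (𝒟 : ∀ i, ProjectionDecomposition ℓ i) : ℤ :=
  - ((∏ i ∈ Finset.univ.filter (fun i : Fin k => (i : ℕ) + 1 < k), (-1) ^ flippedCount ℓ i) *
      ∏ j : Fin k, (D j).decompositionSign (𝒟 j))

/-- The weight of a directed even loop: its sign times the product of its edge weights (the weight
of a doubled edge being taken twice). -/
def loopWeight {R : Type*} [CommRing R] (D : ∀ i, PlaneDrawing (G i))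
    (a : Sym2 (∀ i, Fin (n i)) → R) (ℓ : EvenLoop (cartesianProduct G))
    (𝒟 : ∀ i, ProjectionDecomposition ℓ i) : R :=
  (loopSign D ℓ 𝒟 : R) * ∏ v ∈ ℓ.support, a s(v, ℓ.next v)

end Product

end

noncomputable section

open Set Filter

/-! ### Connected components of open subsets of the plane -/

/-! Expand the determinant over permutations. The matrix is antisymmetric off the diagonal, so
reversing one odd cycle of length at least three keeps the sign of a permutation and negates its
product of entries: the permutations with such a cycle cancel. The remaining nonzero terms are the
loop configurations. A fixed point gives its vertex weight; an even cycle, an odd permutation, gives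
minus the product of the orientation signs of its steps, times its edge weights
(`det_generalisedAdjacency`). What is left is that the sign of a loop is minus the product of the
orientation signs of its steps (`loopSign_eq`). No decomposition occurs in that product, so
independence of the choices follows too.

The sign of a step along factor `i` is a power of `-1` given by `laterSum`, times the sign of the
projected edge in the factor. The powers of `-1` multiply to the terms with `e_i`. The other signs
can be grouped along the cycles of any decomposition (`decompositionSign_eq`), so it suffices to
know the product of the signs along one directed cycle of a Pfaffian plane graph
(`prod_sign_cycle`). This is Kasteleyn's lemma (`even_clockwise_add`): the number of clockwise edges
of a cycle and the number of enclosed vertices have opposite parities. Summing the clockwise edges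
of the faces inside counts every inner edge once and a cycle edge if it is clockwise; Euler's
formula inside the cycle (`ncard_faces_inside`), which needs the absence of nested components, gives
the parity.

The topology rests on drawing a graph arc by arc. Each side of an arc lies in one component of the
complement (`exists_sides`), so a new arc adds at most one component (`ncard_components_insert`). It
adds none if an end is free, and exactly one if it closes a cycle, because the angle swept out by
the cycle, constant on components, jumps by `2π` across the arc (`sides_ne`). Counting gives Euler's
formula (`ncard_components_add_ncard`) and, for a single cycle, the Jordan curve theorem (`jordan`).

Decompositions exist because the projection of a loop has equal in- and out-degrees: among the
permutations that send each edge to a following one, one with the finest cycles visits no vertex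
twice in a cycle (`nonempty_cycleDecomposition`). -/

/-- The connected components of a subset of the plane. -/
def planeComponents (U : Set ℂ) : Set (Set ℂ) := {F | ∃ z ∈ U, F = connectedComponentIn U z}

namespace planeComponents

variable {U F F' : Set ℂ}

lemma subset (h : F ∈ planeComponents U) : F ⊆ U := by
  obtain ⟨z, -, rfl⟩ := h
  exact connectedComponentIn_subset _ _

lemma isPreconnected (h : F ∈ planeComponents U) : IsPreconnected F := by
  obtain ⟨z, -, rfl⟩ := h
  exact isPreconnected_connectedComponentIn

lemma nonempty (h : F ∈ planeComponents U) : F.Nonempty := by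
  obtain ⟨z, hz, rfl⟩ := h
  exact ⟨z, mem_connectedComponentIn hz⟩

lemma isOpen (hU : IsOpen U) (h : F ∈ planeComponents U) : IsOpen F := by
  obtain ⟨z, -, rfl⟩ := h
  exact hU.connectedComponentIn

lemma eq_connectedComponentIn (h : F ∈ planeComponents U) {z : ℂ} (hz : z ∈ F) :
    F = connectedComponentIn U z := by
  obtain ⟨y, -, rfl⟩ := h
  exact connectedComponentIn_eq hz

lemma eq_of_mem (h : F ∈ planeComponents U) (h' : F' ∈ planeComponents U) {z : ℂ} (hz : z ∈ F)
    (hz' : z ∈ F') : F = F' :=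
  (eq_connectedComponentIn h hz).trans (eq_connectedComponentIn h' hz').symm

lemma subset_of_isPreconnected (h : F ∈ planeComponents U) {T : Set ℂ} (hT : IsPreconnected T)
    (hTU : T ⊆ U) {z : ℂ} (hz : z ∈ T) (hzF : z ∈ F) : T ⊆ F := by
  rw [eq_connectedComponentIn h hzF]
  exact hT.subset_connectedComponentIn hz hTU

lemma mem_of_mem {z : ℂ} (hz : z ∈ U) : connectedComponentIn U z ∈ planeComponents U :=
  ⟨z, hz, rfl⟩

lemma exists_superset {T : Set ℂ} (hT : IsPreconnected T) (hTU : T ⊆ U) (hne : T.Nonempty) :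
    ∃ F ∈ planeComponents U, T ⊆ F := by
  obtain ⟨z, hz⟩ := hne
  exact ⟨_, mem_of_mem (hTU hz), hT.subset_connectedComponentIn hz hTU⟩

lemma eq_singleton (hU : IsPreconnected U) (hne : U.Nonempty) : planeComponents U = {U} := by
  ext F
  constructor
  · rintro ⟨z, hz, rfl⟩
    exact hU.connectedComponentIn hz
  · rintro rfl
    obtain ⟨z, hz⟩ := hne
    exact ⟨z, hz, (hU.connectedComponentIn hz).symm⟩

end planeComponents

/-! ### Segments -/

/-- The affine coordinate `ζ` places `p` at `0` and `q` at `1`, so that the right side of the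
segment becomes the lower half-plane. The local arguments along a segment are made in it. -/
lemma mem_segment_iff_coord {p q : ℂ} (hpq : p ≠ q) (ζ : ℂ) :
    p + (q - p) * ζ ∈ segment ℝ p q ↔ ζ.im = 0 ∧ ζ.re ∈ Icc (0 : ℝ) 1 := by
  have h0 : q - p ≠ 0 := sub_ne_zero.2 hpq.symm
  rw [segment_eq_image']
  constructor
  · rintro ⟨t, ht, h⟩
    have : ζ = t := by
      have : (q - p) * (t : ℂ) = (q - p) * ζ := by
        simpa [mul_comm] using h
      exact (mul_left_cancel₀ h0 this).symm
    subst this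
    simpa using ht
  · rintro ⟨h1, h2⟩
    refine ⟨ζ.re, h2, ?_⟩
    have : ζ = (ζ.re : ℂ) := Complex.ext rfl (by simpa using h1)
    rw [this]
    simp [mul_comm]

lemma isClosed_segment (p q : ℂ) : IsClosed (segment ℝ p q) := by
  rw [segment_eq_image']
  exact (isCompact_Icc.image (by fun_prop)).isClosed

/-- The points immediately to the right of every interior point of the segment from `p` to `q` lie
in `S`. -/
def RightGerm (S : Set ℂ) (p q : ℂ) : Prop :=
  ∀ t ∈ Ioo (0 : ℝ) 1, ∀ᶠ ζ in 𝓝[{ζ : ℂ | ζ.im < 0}] (t : ℂ), p + (q - p) * ζ ∈ S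

instance neBot_lower (t : ℝ) : (𝓝[{ζ : ℂ | ζ.im < 0}] (t : ℂ)).NeBot := by
  rw [← mem_closure_iff_nhdsWithin_neBot]
  rw [Complex.closure_setOfPred_im_lt]
  simp

instance neBot_upper (t : ℝ) : (𝓝[{ζ : ℂ | 0 < ζ.im}] (t : ℂ)).NeBot := by
  rw [← mem_closure_iff_nhdsWithin_neBot]
  rw [Complex.closure_setOfPred_lt_im]
  simp

lemma tendsto_one_sub_upper (t : ℝ) :
    Tendsto (fun ζ : ℂ => 1 - ζ) (𝓝[{ζ : ℂ | 0 < ζ.im}] (t : ℂ))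
      (𝓝[{ζ : ℂ | ζ.im < 0}] ((1 - t : ℝ) : ℂ)) := by
  apply tendsto_nhdsWithin_of_tendsto_nhds_of_eventually_within
  · have : Tendsto (fun ζ : ℂ => 1 - ζ) (𝓝 (t : ℂ)) (𝓝 (1 - t)) := by
      exact (continuous_const.sub continuous_id).tendsto _
    push_cast
    exact this.mono_left nhdsWithin_le_nhds
  · filter_upwards [self_mem_nhdsWithin] with ζ hζ
    simpa using hζ

lemma RightGerm.upper {S : Set ℂ} {p q : ℂ} (h : RightGerm S q p) {t : ℝ} (ht : t ∈ Ioo (0 : ℝ) 1) :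
    ∀ᶠ ζ in 𝓝[{ζ : ℂ | 0 < ζ.im}] (t : ℂ), p + (q - p) * ζ ∈ S := by
  have := (tendsto_one_sub_upper t).eventually (h (1 - t) ⟨by linarith [ht.2], by linarith [ht.1]⟩)
  filter_upwards [this] with ζ hζ
  convert hζ using 1
  ring

lemma RightGerm.midpoint {S : Set ℂ} {p q : ℂ} (h : RightGerm S p q) :
    ∀ᶠ ε : ℝ in 𝓝[>] 0, (p + q) / 2 + (ε : ℂ) * (-Complex.I * (q - p)) ∈ S := by
  have ht : Tendsto (fun ε : ℝ => (1 / 2 : ℂ) - ε * Complex.I) (𝓝[>] 0)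
      (𝓝[{ζ : ℂ | ζ.im < 0}] ((1 / 2 : ℝ) : ℂ)) := by
    apply tendsto_nhdsWithin_of_tendsto_nhds_of_eventually_within
    · have : Tendsto (fun ε : ℝ => (1 / 2 : ℂ) - ε * Complex.I) (𝓝 0)
          (𝓝 ((1 / 2 : ℂ) - (0 : ℝ) * Complex.I)) :=
        (Continuous.tendsto (by fun_prop) _)
      simp only [Complex.ofReal_zero, zero_mul, sub_zero] at this
      push_cast
      exact this.mono_left nhdsWithin_le_nhds
    · filter_upwards [self_mem_nhdsWithin] with ε hε
      simpa using hε
  filter_upwards [ht.eventually (h (1 / 2) ⟨by norm_num, by norm_num⟩)] with ε hε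
  convert hε using 1
  ring

lemma tendsto_coord (p q : ℂ) (t : ℝ) :
    Tendsto (fun ζ : ℂ => p + (q - p) * ζ) (𝓝 (t : ℂ)) (𝓝 (p + (q - p) * t)) :=
  Continuous.tendsto (by fun_prop) _

lemma coord_mem_openSegment (p q : ℂ) {t : ℝ} (ht : t ∈ Ioo (0 : ℝ) 1) :
    p + (q - p) * t ∈ openSegment ℝ p q := by
  rw [openSegment_eq_image']
  exact ⟨t, ht, by simp [mul_comm]⟩

/-- A half-disc below a point of the segment is convex, hence lies in one component of `U`. That
component is locally constant along the open segment, because half-discs at nearby points overlap,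
and the open segment is connected. -/
lemma exists_rightGerm {U : Set ℂ} {p q : ℂ} (hpq : p ≠ q)
    (h : ∀ y ∈ openSegment ℝ p q, ∀ᶠ z in 𝓝 y, z ∉ segment ℝ p q → z ∈ U) :
    ∃ R ∈ planeComponents U, RightGerm R p q := by
  have key : ∀ t ∈ Ioo (0 : ℝ) 1, ∃ R ∈ planeComponents U,
      ∀ᶠ ζ in 𝓝[{ζ : ℂ | ζ.im < 0}] (t : ℂ), p + (q - p) * ζ ∈ R := by
    intro t ht
    have h1 := (tendsto_coord p q t).eventually (h _ (coord_mem_openSegment p q ht))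
    obtain ⟨δ, hδ, hball⟩ := Metric.eventually_nhds_iff_ball.1 h1
    have hconv : Convex ℝ (Metric.ball (t : ℂ) δ ∩ {ζ : ℂ | ζ.im < 0}) :=
      (convex_ball _ _).inter (convex_halfSpace_im_lt 0)
    have hne : (Metric.ball (t : ℂ) δ ∩ {ζ : ℂ | ζ.im < 0}).Nonempty :=
      (neBot_lower t).nonempty_of_mem
        (inter_mem_nhdsWithin_of_ball hδ)
    have hpre : IsPreconnected ((fun ζ : ℂ => p + (q - p) * ζ) ''
        (Metric.ball (t : ℂ) δ ∩ {ζ : ℂ | ζ.im < 0})) :=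
      hconv.isPreconnected.image _ (by fun_prop)
    obtain ⟨R, hR, hsub⟩ := planeComponents.exists_superset (U := U) hpre (by
      rintro _ ⟨ζ, ⟨hζ1, hζ2⟩, rfl⟩
      refine hball ζ hζ1 fun hmem => ?_
      have := ((mem_segment_iff_coord hpq ζ).1 hmem).1
      rw [mem_ofPred_eq] at hζ2
      linarith) (hne.image _)
    refine ⟨R, hR, ?_⟩
    filter_upwards [inter_mem_nhdsWithin_of_ball hδ] with ζ hζ
    exact hsub ⟨ζ, hζ, rfl⟩
  choose! R hR hRg using key
  have hconst : ∀ x ∈ Ioo (0 : ℝ) 1, ∀ y ∈ Ioo (0 : ℝ) 1, R x = R y := by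
    intro x hx y hy
    refine isPreconnected_Ioo.induction₂ (fun x y => R x = R y) ?_ ?_ ?_ hx hy
    · intro t ht
      have h1 := eventually_eventually_nhds.2 (eventually_nhdsWithin_iff.1 (hRg t ht))
      have h2 : ∀ᶠ s : ℝ in 𝓝 t, ∀ᶠ ζ in 𝓝[{ζ : ℂ | ζ.im < 0}] (s : ℂ),
          p + (q - p) * ζ ∈ R t := by
        filter_upwards [(Complex.continuous_ofReal.tendsto t).eventually h1] with s hs
        exact eventually_nhdsWithin_iff.2 hs
      filter_upwards [nhdsWithin_le_nhds h2, self_mem_nhdsWithin] with s hs hs'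
      obtain ⟨ζ, hζ1, hζ2⟩ := (hs.and (hRg s hs')).exists
      exact planeComponents.eq_of_mem (hR t ht) (hR s hs') hζ1 hζ2
    · intro x y z _ _ _ h1 h2
      exact h1.trans h2
    · intro x y _ _ h1
      exact h1.symm
  refine ⟨R (1 / 2), hR _ ⟨by norm_num, by norm_num⟩, fun t ht => ?_⟩
  rw [hconst _ ⟨by norm_num, by norm_num⟩ t ht]
  exact hRg t ht
where
  inter_mem_nhdsWithin_of_ball {t δ : ℝ} (hδ : 0 < δ) :
      Metric.ball (t : ℂ) δ ∩ {ζ : ℂ | ζ.im < 0} ∈ 𝓝[{ζ : ℂ | ζ.im < 0}] (t : ℂ) :=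
    inter_mem (nhdsWithin_le_nhds (Metric.ball_mem_nhds _ hδ)) self_mem_nhdsWithin

/-- In the affine coordinate a nearby point has negative, positive or zero imaginary part; in the
last case it lies on the segment. This later shows that no third component touches an arc. -/
lemma RightGerm.eventually_mem_union {R L : Set ℂ} {p q : ℂ} (hpq : p ≠ q) (hR : RightGerm R p q)
    (hL : RightGerm L q p) {y : ℂ} (hy : y ∈ openSegment ℝ p q) :
    ∀ᶠ z in 𝓝 y, z ∉ segment ℝ p q → z ∈ R ∪ L := by
  have h0 : q - p ≠ 0 := sub_ne_zero.2 hpq.symm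
  rw [openSegment_eq_image'] at hy
  obtain ⟨t, ht, rfl⟩ := hy
  have hT : Tendsto (fun z : ℂ => (z - p) / (q - p)) (𝓝 (p + t • (q - p))) (𝓝 (t : ℂ)) := by
    have : Tendsto (fun z : ℂ => (z - p) / (q - p)) (𝓝 (p + t • (q - p)))
        (𝓝 ((p + t • (q - p) - p) / (q - p))) := Continuous.tendsto (by fun_prop) _
    convert this using 2
    rw [add_sub_cancel_left, Complex.real_smul, mul_div_cancel_right₀ _ h0]
  have h1 := hT.eventually (eventually_nhdsWithin_iff.1 (hR t ht))
  have h2 := hT.eventually (eventually_nhdsWithin_iff.1 (hL.upper ht))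
  have h3 : ∀ᶠ ζ : ℂ in 𝓝 (t : ℂ), ζ.re ∈ Ioo (0 : ℝ) 1 :=
    (Complex.continuous_re.tendsto _).eventually (by
      rw [Complex.ofReal_re]; exact Ioo_mem_nhds ht.1 ht.2)
  filter_upwards [h1, h2, hT.eventually h3] with z hz1 hz2 hz3 hz
  have hzeq : p + (q - p) * ((z - p) / (q - p)) = z := by
    rw [mul_div_cancel₀ _ h0]; ring
  rw [hzeq] at hz1 hz2
  rcases lt_trichotomy ((z - p) / (q - p)).im 0 with h | h | h
  · exact Or.inl (hz1 h)
  · refine absurd ?_ hz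
    rw [← hzeq]
    exact (mem_segment_iff_coord hpq _).2 ⟨h, hz3.1.le, hz3.2.le⟩
  · exact Or.inr (hz2 h)

/-! ### Sectors at a corner -/

/-- The open sector of radius `exp ρ` and opening angle `β`, counterclockwise from the positive
real axis. -/
def openSector (ρ β : ℝ) : Set ℂ := Complex.exp '' {w | w.re < ρ ∧ 0 < w.im ∧ w.im < β}

/-- A sector is the exponential image of a half-strip, with `ρ` the logarithm of its radius:
convexity of the strip gives connectedness, also for opening angles beyond `π`. -/
lemma isPreconnected_openSector (ρ β : ℝ) : IsPreconnected (openSector ρ β) := by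
  refine IsPreconnected.image (Convex.isPreconnected ?_) _ Complex.continuous_exp.continuousOn
  exact (convex_halfSpace_re_lt ρ).inter ((convex_halfSpace_im_gt 0).inter (convex_halfSpace_im_lt β))

lemma log_mem_strip {ρ β t : ℝ} (ht : 0 < t) (htρ : Real.log t < ρ) (hβ : 0 < β) :
    ∀ᶠ ξ : ℂ in 𝓝 (t : ℂ), ξ ≠ 0 ∧ (Complex.log ξ).re < ρ ∧ |(Complex.log ξ).im| < β := by
  have hc : ContinuousAt Complex.log (t : ℂ) := continuousAt_clog (by simp [ht])
  have h1 : ∀ᶠ w : ℂ in 𝓝 (Complex.log (t : ℂ)), w.re < ρ ∧ |w.im| < β := by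
    apply (IsOpen.mem_nhds (s := {w : ℂ | w.re < ρ ∧ |w.im| < β}))
    · exact (isOpen_lt Complex.continuous_re continuous_const).inter
        (isOpen_lt Complex.continuous_im.abs continuous_const)
    · simp only [mem_ofPred_eq, ← Complex.ofReal_log ht.le, Complex.ofReal_re, Complex.ofReal_im,
        abs_zero]
      exact ⟨htρ, hβ⟩
  filter_upwards [hc.eventually h1, (isOpen_ne.mem_nhds (by simpa using ht.ne') : ∀ᶠ ξ : ℂ in 𝓝 (t : ℂ), ξ ≠ 0)] with ξ h2 h3
  exact ⟨h3, h2⟩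

lemma eventually_mem_openSector {ρ β t : ℝ} (ht : 0 < t) (htρ : Real.log t < ρ) (hβ : 0 < β) :
    ∀ᶠ ξ in 𝓝[{ξ : ℂ | 0 < ξ.im}] (t : ℂ), ξ ∈ openSector ρ β := by
  filter_upwards [nhdsWithin_le_nhds (log_mem_strip ht htρ hβ), self_mem_nhdsWithin] with ξ h1 h2
  refine ⟨Complex.log ξ, ⟨h1.2.1, ?_, (abs_lt.1 h1.2.2).2⟩, Complex.exp_log h1.1⟩
  rw [Complex.log_im]
  refine lt_of_le_of_ne (Complex.arg_nonneg_iff.2 h2.le) fun h => ?_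
  have := (Complex.arg_eq_zero_iff.1 h.symm).2
  linarith

/-- Just to the right of the second bounding ray, travelled outwards, the argument is slightly below
`w₀.im`. -/
lemma eventually_exp_mul_mem_openSector {ρ t : ℝ} {w₀ : ℂ} (ht : 0 < t)
    (htρ : Real.log t < ρ - w₀.re) (hβ : 0 < w₀.im) :
    ∀ᶠ ξ in 𝓝[{ξ : ℂ | ξ.im < 0}] (t : ℂ), Complex.exp w₀ * ξ ∈ openSector ρ w₀.im := by
  filter_upwards [nhdsWithin_le_nhds (log_mem_strip ht htρ hβ), self_mem_nhdsWithin] with ξ h1 h2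
  refine ⟨w₀ + Complex.log ξ, ⟨?_, ?_, ?_⟩, by rw [Complex.exp_add, Complex.exp_log h1.1]⟩
  · rw [Complex.add_re]; linarith [h1.2.1]
  · rw [Complex.add_im]; linarith [(abs_lt.1 h1.2.2).1]
  · rw [Complex.add_im, Complex.log_im]
    have := Complex.arg_neg_iff.2 h2
    linarith

lemma exists_log_im_mem_Ico {ξ : ℂ} (hξ : ξ ≠ 0) :
    ∃ w : ℂ, Complex.exp w = ξ ∧ 0 ≤ w.im ∧ w.im < 2 * Real.pi := by
  by_cases h : 0 ≤ ξ.arg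
  · exact ⟨Complex.log ξ, Complex.exp_log hξ, by rwa [Complex.log_im], by
      rw [Complex.log_im]; linarith [Complex.arg_le_pi ξ, Real.pi_pos]⟩
  · refine ⟨Complex.log ξ + 2 * Real.pi * Complex.I, ?_, ?_, ?_⟩
    · rw [Complex.exp_add, Complex.exp_log hξ, Complex.exp_two_pi_mul_I, mul_one]
    · simp [Complex.log_im]; linarith [Complex.neg_pi_lt_arg ξ]
    · have h1 := not_le.1 h
      simp only [Complex.add_im, Complex.log_im, Complex.mul_im, Complex.mul_re, Complex.re_ofNat,
        Complex.ofReal_re, Complex.im_ofNat, Complex.ofReal_im, Complex.I_im, Complex.I_re]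
      linarith

lemma exp_re_lt_of_norm_lt {ξ w : ℂ} {ρ : ℝ} (hw : Complex.exp w = ξ) (h : ‖ξ‖ < Real.exp ρ) :
    w.re < ρ := by
  rw [← hw, Complex.norm_exp] at h
  exact Real.exp_lt_exp.1 h

/-- Near its apex, a two-sided corner is the union of two open sectors and two rays. -/
lemma mem_openSector_or {ξ w₀ : ℂ} {ρ : ℝ} (hξ0 : ξ ≠ 0) (hξρ : ‖ξ‖ < Real.exp ρ)
    (h1 : ¬ ∃ s : ℝ, 0 < s ∧ ξ = s) (h2 : ¬ ∃ s : ℝ, 0 < s ∧ ξ = Complex.exp w₀ * s) :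
    ξ ∈ openSector ρ w₀.im ∨
      ∃ η ∈ openSector (ρ - w₀.re) (2 * Real.pi - w₀.im), ξ = Complex.exp w₀ * η := by
  obtain ⟨w, hw, hw1, hw2⟩ := exists_log_im_mem_Ico hξ0
  have hre := exp_re_lt_of_norm_lt hw hξρ
  have key : ∀ v u : ℂ, v.im = u.im → Complex.exp v = Complex.exp u * Real.exp (v.re - u.re) := by
    intro v u h
    rw [Complex.ofReal_exp, ← Complex.exp_add]
    congr 1
    apply Complex.ext <;> simp [h]
  rcases lt_trichotomy w.im w₀.im with h | h | h
  · left
    refine ⟨w, ⟨hre, lt_of_le_of_ne hw1 fun h0 => h1 ?_, h⟩, hw⟩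
    refine ⟨Real.exp w.re, Real.exp_pos _, ?_⟩
    rw [← hw, key w 0 (by simp [← h0])]
    simp
  · exact absurd ⟨Real.exp (w.re - w₀.re), Real.exp_pos _, by rw [← hw, key w w₀ h]⟩ h2
  · right
    refine ⟨_, ⟨w - w₀, ⟨by simpa using hre, by simpa using h, by simpa using hw2⟩, rfl⟩, ?_⟩
    rw [← Complex.exp_add, add_sub_cancel, hw]

end

/-! ### Gluing the sides of segments at corners and free ends -/

noncomputable section

open Set Filter

/-- A component that contains the points immediately to the right of `q → p` in the direction of
the corner `q` contains the sector at `q` that starts at the ray towards `p`. -/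
lemma RightGerm.exists_mem_sector {R : Set ℂ} {q a : ℂ} {ρ β : ℝ} (hR : RightGerm R (q + a) q)
    (hβ : 0 < β) : ∃ ξ ∈ openSector ρ β, q + a * ξ ∈ R := by
  obtain ⟨t, ht0, ht1, htρ⟩ : ∃ t : ℝ, 0 < t ∧ t < 1 ∧ Real.log t < ρ := by
    refine ⟨Real.exp (min (ρ - 1) (-1)), Real.exp_pos _, ?_, ?_⟩
    · rw [Real.exp_lt_one_iff]
      exact lt_of_le_of_lt (min_le_right _ _) (by norm_num)
    · rw [Real.log_exp]
      exact lt_of_le_of_lt (min_le_left _ _) (by linarith)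
  have h1 := hR.upper ⟨ht0, ht1⟩
  obtain ⟨ξ, h2, h3⟩ := (h1.and (eventually_mem_openSector ht0 htρ hβ)).exists
  refine ⟨ξ, h3, ?_⟩
  simpa using h2

lemma RightGerm.exists_mem_sector' {R : Set ℂ} {q a w₀ : ℂ} {ρ : ℝ}
    (hR : RightGerm R q (q + a * Complex.exp w₀)) (hβ : 0 < w₀.im) :
    ∃ ξ ∈ openSector ρ w₀.im, q + a * ξ ∈ R := by
  obtain ⟨t, ht0, ht1, htρ⟩ : ∃ t : ℝ, 0 < t ∧ t < 1 ∧ Real.log t < ρ - w₀.re := by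
    refine ⟨Real.exp (min (ρ - w₀.re - 1) (-1)), Real.exp_pos _, ?_, ?_⟩
    · rw [Real.exp_lt_one_iff]
      exact lt_of_le_of_lt (min_le_right _ _) (by norm_num)
    · rw [Real.log_exp]
      exact lt_of_le_of_lt (min_le_left _ _) (by linarith)
  obtain ⟨ξ, h2, h3⟩ :=
    ((hR t ⟨ht0, ht1⟩).and (eventually_exp_mul_mem_openSector ht0 htρ hβ)).exists
  refine ⟨_, h3, ?_⟩
  convert h2 using 1
  ring

lemma isPreconnected_image_openSector (q a : ℂ) (ρ β : ℝ) :
    IsPreconnected ((fun ξ => q + a * ξ) '' openSector ρ β) :=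
  (isPreconnected_openSector ρ β).image _ (by fun_prop)

/-- If a sector lies in `U`, then the components of `U` to the right of its first bounding ray
(travelled inwards) and of its second bounding ray (travelled outwards) coincide. -/
lemma sector_component {U R R' : Set ℂ} {q a w₀ : ℂ} {ρ : ℝ} (hw₀ : 0 < w₀.im)
    (hU : ∀ ξ ∈ openSector ρ w₀.im, q + a * ξ ∈ U)
    (hR : R ∈ planeComponents U) (hR' : R' ∈ planeComponents U)
    (hg : RightGerm R (q + a) q) (hg' : RightGerm R' q (q + a * Complex.exp w₀)) :
    R = R' ∧ ∀ ξ ∈ openSector ρ w₀.im, q + a * ξ ∈ R := by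
  obtain ⟨ξ, hξ, hξR⟩ := hg.exists_mem_sector (ρ := ρ) hw₀
  obtain ⟨ξ', hξ', hξR'⟩ := hg'.exists_mem_sector' (ρ := ρ) hw₀
  have hpre := isPreconnected_image_openSector q a ρ w₀.im
  have hsub : (fun ξ => q + a * ξ) '' openSector ρ w₀.im ⊆ U := by
    rintro _ ⟨η, hη, rfl⟩
    exact hU η hη
  have hall := planeComponents.subset_of_isPreconnected hR hpre hsub ⟨ξ, hξ, rfl⟩ hξR
  exact ⟨planeComponents.eq_of_mem hR hR' (hall ⟨ξ', hξ', rfl⟩) hξR',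
    fun η hη => hall ⟨η, hη, rfl⟩⟩

/-- Points of the bounding rays have argument `0` or `w₀.im` modulo `2π`, while the sector has
arguments strictly between `0` and `w₀.im ≤ 2π`. -/
lemma openSector_mem_ne {q a w₀ ξ : ℂ} {ρ : ℝ} (ha : a ≠ 0) (hw₀ : w₀.im ≤ 2 * Real.pi)
    (hξ : ξ ∈ openSector ρ w₀.im) :
    q + a * ξ ∉ segment ℝ (q + a) q ∧ q + a * ξ ∉ segment ℝ q (q + a * Complex.exp w₀) := by
  obtain ⟨w, ⟨hw1, hw2, hw3⟩, rfl⟩ := hξ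
  have hint : ∀ n : ℤ, ∀ x : ℝ, x = n * (2 * Real.pi) → 0 < x → x < 2 * Real.pi → False := by
    intro n x hx h1 h2
    have hpi := Real.pi_pos
    have h3 : (0 : ℝ) < n := by
      by_contra h
      nlinarith [not_lt.1 h]
    have h4 : (n : ℝ) < 1 := by
      by_contra h
      nlinarith [not_lt.1 h]
    have h5 : (0 : ℤ) < n := by exact_mod_cast h3
    have h6 : n < (1 : ℤ) := by exact_mod_cast h4
    omega
  constructor
  · rw [segment_symm, segment_eq_image']
    rintro ⟨t, ht, h⟩
    have h1 : Complex.exp w = t := by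
      have : a * t = a * Complex.exp w := by simpa [mul_comm] using h
      exact (mul_left_cancel₀ ha this).symm
    have ht0 : 0 < t := by
      refine lt_of_le_of_ne ht.1 fun h0 => ?_
      rw [← h0] at h1
      simp at h1
    rw [← Real.exp_log ht0, Complex.ofReal_exp, Complex.exp_eq_exp_iff_exists_int] at h1
    obtain ⟨n, hn⟩ := h1
    have := congrArg Complex.im hn
    simp at this
    exact hint n _ this hw2 (hw3.trans_le hw₀)
  · rw [segment_eq_image']
    rintro ⟨t, ht, h⟩
    have h1 : Complex.exp w = t * Complex.exp w₀ := by
      have : a * (t * Complex.exp w₀) = a * Complex.exp w := by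
        simp only [add_sub_cancel_left, Complex.real_smul, add_right_inj] at h
        rw [← h]; ring
      exact (mul_left_cancel₀ ha this).symm
    have ht0 : 0 < t := by
      refine lt_of_le_of_ne ht.1 fun h0 => ?_
      rw [← h0] at h1
      simp at h1
    rw [← Real.exp_log ht0, Complex.ofReal_exp, ← Complex.exp_add,
      Complex.exp_eq_exp_iff_exists_int] at h1
    obtain ⟨n, hn⟩ := h1
    have := congrArg Complex.im hn
    simp at this
    refine hint (-n) (w₀.im - w.im) ?_ (by linarith) (by linarith)
    push_cast
    linarith

lemma norm_lt_exp_of_mem_openSector {ξ : ℂ} {ρ β : ℝ} (hξ : ξ ∈ openSector ρ β) :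
    ‖ξ‖ < Real.exp ρ := by
  obtain ⟨w, ⟨hw1, -, -⟩, rfl⟩ := hξ
  rw [Complex.norm_exp]
  exact Real.exp_lt_exp.2 hw1

lemma exists_log_ratio {a b : ℂ} (ha : a ≠ 0) (hb : b ≠ 0) (h : ¬ ∃ s : ℝ, 0 < s ∧ b = a * s) :
    ∃ w₀ : ℂ, b = a * Complex.exp w₀ ∧ 0 < w₀.im ∧ w₀.im < 2 * Real.pi := by
  obtain ⟨w, hw, hw1, hw2⟩ := exists_log_im_mem_Ico (div_ne_zero hb ha)
  refine ⟨w, by rw [hw, mul_div_cancel₀ _ ha], lt_of_le_of_ne hw1 fun h0 => h ?_, hw2⟩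
  refine ⟨Real.exp w.re, Real.exp_pos _, ?_⟩
  have : w = (w.re : ℂ) := Complex.ext rfl (by simp [← h0])
  rw [Complex.ofReal_exp, ← this, hw, mul_div_cancel₀ _ ha]

/-- At a corner the components on either side of the two segments agree, and they cover a
neighbourhood of the corner, apart from the segments. -/
lemma corner_component {U R R' L L' : Set ℂ} {p q r : ℂ} (hpq : p ≠ q) (hqr : q ≠ r)
    (hseg : segment ℝ p q ∩ segment ℝ q r ⊆ {q})
    (hU : ∀ᶠ z in 𝓝 q, z ∉ segment ℝ p q → z ∉ segment ℝ q r → z ∈ U)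
    (hR : R ∈ planeComponents U) (hR' : R' ∈ planeComponents U)
    (hL : L ∈ planeComponents U) (hL' : L' ∈ planeComponents U)
    (hgR : RightGerm R p q) (hgR' : RightGerm R' q r)
    (hgL : RightGerm L q p) (hgL' : RightGerm L' r q) :
    R = R' ∧ L = L' ∧
      ∀ᶠ z in 𝓝 q, z ∉ segment ℝ p q → z ∉ segment ℝ q r → z ∈ R ∪ L := by
  have ha : p - q ≠ 0 := sub_ne_zero.2 hpq
  have hb : r - q ≠ 0 := sub_ne_zero.2 hqr.symm
  -- Segments leaving `q` in the same direction would share the point at `t = min 1 s`, against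
  -- `hseg`. So the angle at the corner, counterclockwise from `p` to `r`, is strictly between `0`
  -- and `2π`.
  obtain ⟨w₀, hw, hw1, hw2⟩ := exists_log_ratio ha hb (by
    rintro ⟨s, hs, h⟩
    set t := min 1 s with ht
    have ht0 : 0 < t := lt_min one_pos hs
    have hmem1 : q + (p - q) * t ∈ segment ℝ p q := by
      rw [segment_symm, mem_segment_iff_coord hpq.symm]
      simp [ht, hs.le]
    have hmem2 : q + (p - q) * t ∈ segment ℝ q r := by
      have : q + (p - q) * t = q + (r - q) * ((t / s : ℝ) : ℂ) := by
        have hs' : (s : ℂ) ≠ 0 := by exact_mod_cast hs.ne'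
        rw [h]; push_cast; field_simp
      rw [this, mem_segment_iff_coord hqr]
      refine ⟨Complex.ofReal_im _, ?_⟩
      rw [Complex.ofReal_re]
      exact ⟨by positivity, (div_le_one hs).2 (min_le_right _ _)⟩
    have := hseg ⟨hmem1, hmem2⟩
    have : (p - q) * (t : ℂ) = 0 := by simpa using this
    rcases mul_eq_zero.1 this with h | h
    · exact ha h
    · exact ht0.ne' (by exact_mod_cast h))
  set a := p - q with ha_def
  have hp : p = q + a := by rw [ha_def]; ring
  have hr : r = q + a * Complex.exp w₀ := by rw [← hw]; ring
  obtain ⟨δ, hδ, hball⟩ := Metric.eventually_nhds_iff_ball.1 hU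
  have hna : 0 < ‖a‖ := norm_pos_iff.2 ha
  -- In the unit `a` the segments have lengths `1` and `exp w₀.re`. The first two bounds keep the
  -- disc of radius `exp ρ` from passing their far ends; the third keeps it in the neighbourhood
  -- given by `hU`.
  obtain ⟨ρ, hρ0, hρw, hρδ⟩ : ∃ ρ : ℝ, ρ ≤ 0 ∧ ρ ≤ w₀.re ∧ Real.exp ρ * ‖a‖ ≤ δ := by
    refine ⟨min (min 0 w₀.re) (Real.log (δ / ‖a‖)), (min_le_left _ _).trans (min_le_left _ _),
      (min_le_left _ _).trans (min_le_right _ _), ?_⟩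
    rw [← le_div_iff₀ hna, ← Real.le_log_iff_exp_le (by positivity)]
    exact min_le_right _ _
  have hnear : ∀ ξ : ℂ, ‖ξ‖ < Real.exp ρ → q + a * ξ ∈ Metric.ball q δ := by
    intro ξ hξ
    rw [mem_ball_iff_norm, add_sub_cancel_left, norm_mul, mul_comm]
    exact lt_of_lt_of_le (mul_lt_mul_of_pos_right hξ hna) hρδ
  have hA := sector_component (U := U) (q := q) (a := a) (ρ := ρ) hw1 (by
    intro ξ hξ
    obtain ⟨h1, h2⟩ := openSector_mem_ne (q := q) ha hw2.le hξ
    refine hball _ (hnear ξ (norm_lt_exp_of_mem_openSector hξ)) ?_ ?_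
    · rwa [hp]
    · rwa [hr]) hR hR' (by rwa [← hp]) (by rwa [← hr])
  -- the complementary sector, seen from the ray towards `r`
  set b := r - q with hb_def
  set w₁ : ℂ := 2 * Real.pi * Complex.I - w₀ with hw₁
  have hw₁im : w₁.im = 2 * Real.pi - w₀.im := by simp [hw₁]
  have hexp : Complex.exp w₀ * Complex.exp w₁ = 1 := by
    rw [← Complex.exp_add, hw₁, add_sub_cancel, Complex.exp_two_pi_mul_I]
  have hr' : r = q + b := by rw [hb_def]; ring
  have hp' : p = q + b * Complex.exp w₁ := by rw [hw, mul_assoc, hexp, mul_one, hp]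
  have hB := sector_component (U := U) (q := q) (a := b) (w₀ := w₁) (ρ := ρ - w₀.re)
    (by rw [hw₁im]; linarith) (by
    intro ξ hξ
    obtain ⟨h1, h2⟩ := openSector_mem_ne (q := q) hb (by rw [hw₁im]; linarith) hξ
    have hξn : ‖Complex.exp w₀ * ξ‖ < Real.exp ρ := by
      have := norm_lt_exp_of_mem_openSector hξ
      rw [norm_mul, Complex.norm_exp]
      calc _ < Real.exp w₀.re * Real.exp (ρ - w₀.re) := by gcongr
        _ = _ := by rw [← Real.exp_add]; congr 1; ring
    have := hnear _ hξn
    rw [← mul_assoc, ← hw] at this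
    refine hball _ this ?_ ?_
    · rw [segment_symm, hp']; exact h2
    · rw [segment_symm, hr']; exact h1) hL' hL (by rwa [← hr']) (by rwa [← hp'])
  refine ⟨hA.1, hB.1.symm, ?_⟩
  have hev : ∀ᶠ z in 𝓝 q, ‖(z - q) / a‖ < Real.exp ρ := by
    have : Tendsto (fun z : ℂ => ‖(z - q) / a‖) (𝓝 q) (𝓝 ‖(q - q) / a‖) :=
      Continuous.tendsto (by fun_prop) _
    refine this.eventually (gt_mem_nhds ?_)
    simp [Real.exp_pos]
  filter_upwards [hev] with z hz h1 h2
  have hzeq : z = q + a * ((z - q) / a) := by rw [mul_div_cancel₀ _ ha]; ring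
  set ξ := (z - q) / a with hξ
  have hξ0 : ξ ≠ 0 := by
    intro h0
    rw [h0, mul_zero, add_zero] at hzeq
    exact h1 (by rw [hzeq]; exact right_mem_segment _ _ _)
  rcases mem_openSector_or (w₀ := w₀) (ρ := ρ) hξ0 hz (by
      rintro ⟨s, hs, hs'⟩
      apply h1
      rw [segment_symm, hzeq, ha_def, mem_segment_iff_coord hpq.symm, hs']
      rw [hs', Complex.norm_real, Real.norm_of_nonneg hs.le] at hz
      refine ⟨Complex.ofReal_im _, ?_⟩
      rw [Complex.ofReal_re]
      exact ⟨hs.le, hz.le.trans (by simpa using hρ0)⟩) (by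
      rintro ⟨s, hs, hs'⟩
      apply h2
      rw [hzeq, hs', ← mul_assoc, ← hw, hb_def, mem_segment_iff_coord hqr]
      rw [hs', norm_mul, Complex.norm_exp, Complex.norm_real, Real.norm_of_nonneg hs.le] at hz
      refine ⟨Complex.ofReal_im _, ?_⟩
      rw [Complex.ofReal_re]
      refine ⟨hs.le, ?_⟩
      by_contra hlt
      have h3 : Real.exp w₀.re * 1 < Real.exp w₀.re * s := by
        gcongr
        exact not_le.1 hlt
      have h4 : Real.exp ρ ≤ Real.exp w₀.re := Real.exp_le_exp.2 hρw
      linarith) with h | ⟨η, hη, hη'⟩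
  · left
    rw [hzeq]
    exact hA.2 _ h
  · right
    rw [← hw₁im] at hη
    have := hB.2 _ hη
    rw [hzeq, hη', ← mul_assoc, ← hw, ← hB.1]
    exact this

/-- At a free end of a segment, both sides belong to the same component. -/
lemma tip_component {U R L : Set ℂ} {p q : ℂ} (hpq : p ≠ q)
    (hU : ∀ᶠ z in 𝓝 q, z ∉ segment ℝ p q → z ∈ U)
    (hR : R ∈ planeComponents U) (hL : L ∈ planeComponents U)
    (hgR : RightGerm R p q) (hgL : RightGerm L q p) : R = L := by
  have ha : p - q ≠ 0 := sub_ne_zero.2 hpq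
  set a := p - q with ha_def
  have hp : p = q + a := by rw [ha_def]; ring
  -- A sector of opening angle `2π` starts and ends at the same ray: it is a slit disc around the
  -- free end and joins the two sides of the segment.
  set w₀ : ℂ := 2 * Real.pi * Complex.I with hw₀
  have hw₀im : w₀.im = 2 * Real.pi := by simp [hw₀]
  have hp' : p = q + a * Complex.exp w₀ := by rw [hw₀, Complex.exp_two_pi_mul_I, mul_one, hp]
  obtain ⟨δ, hδ, hball⟩ := Metric.eventually_nhds_iff_ball.1 hU
  have hna : 0 < ‖a‖ := norm_pos_iff.2 ha
  refine (sector_component (U := U) (q := q) (a := a) (w₀ := w₀)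
    (ρ := min 0 (Real.log (δ / ‖a‖))) (by rw [hw₀im]; exact Real.two_pi_pos) ?_ hR hL
    (by rwa [← hp]) (by rwa [← hp'])).1
  intro ξ hξ
  obtain ⟨h1, -⟩ := openSector_mem_ne (q := q) ha hw₀im.le hξ
  refine hball _ ?_ (by rwa [hp])
  have := norm_lt_exp_of_mem_openSector hξ
  rw [mem_ball_iff_norm, add_sub_cancel_left, norm_mul, mul_comm]
  calc _ < Real.exp (min 0 (Real.log (δ / ‖a‖))) * ‖a‖ := by gcongr
    _ ≤ (δ / ‖a‖) * ‖a‖ := by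
      gcongr
      rw [← Real.le_log_iff_exp_le (by positivity)]
      exact min_le_right _ _
    _ = δ := by field_simp

end

noncomputable section

open Set Filter

/-! ### Polygonal arcs -/

lemma polylineCarrier_cons_cons (p q : ℂ) (l : List ℂ) :
    polylineCarrier (p :: q :: l) = segment ℝ p q ∪ polylineCarrier (q :: l) := rfl

lemma isCompact_polylineCarrier : ∀ l : List ℂ, IsCompact (polylineCarrier l)
  | [] => isCompact_empty
  | [p] => isCompact_singleton
  | p :: q :: l => by
      rw [polylineCarrier_cons_cons]
      refine IsCompact.union ?_ (isCompact_polylineCarrier (q :: l))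
      rw [segment_eq_image']
      exact isCompact_Icc.image (by fun_prop)

lemma isClosed_polylineCarrier (l : List ℂ) : IsClosed (polylineCarrier l) :=
  (isCompact_polylineCarrier l).isClosed

lemma mem_polylineCarrier_of_mem : ∀ {l : List ℂ} {p : ℂ}, p ∈ l → p ∈ polylineCarrier l
  | [_], _, h => by simpa [polylineCarrier] using h
  | a :: b :: l, p, h => by
      rw [polylineCarrier_cons_cons]
      rcases List.mem_cons.1 h with rfl | h
      · exact Or.inl (left_mem_segment _ _ _)
      · exact Or.inr (mem_polylineCarrier_of_mem h)

lemma polylineCarrier_append_cons : ∀ (l : List ℂ) (p : ℂ) (l' : List ℂ),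
    polylineCarrier (l ++ p :: l') = polylineCarrier (l ++ [p]) ∪ polylineCarrier (p :: l')
  | [], p, l' => by
      rw [List.nil_append, List.nil_append, eq_comm, union_eq_right]
      rintro z rfl
      exact mem_polylineCarrier_of_mem List.mem_cons_self
  | [a], p, l' => by
      simp only [List.singleton_append, polylineCarrier_cons_cons, polylineCarrier]
      rw [union_assoc]
      congr 1
      rw [eq_comm, union_eq_right]
      rintro z rfl
      exact mem_polylineCarrier_of_mem List.mem_cons_self
  | a :: b :: l, p, l' => by
      simp only [List.cons_append, polylineCarrier_cons_cons]
      rw [← List.cons_append, polylineCarrier_append_cons (b :: l) p l', union_assoc]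
      rfl

lemma polylineCarrier_reverse : ∀ l : List ℂ, polylineCarrier l.reverse = polylineCarrier l
  | [] => rfl
  | [_] => rfl
  | p :: q :: l => by
      rw [List.reverse_cons, List.reverse_cons, List.append_assoc, List.singleton_append,
        polylineCarrier_append_cons, ← List.reverse_cons, polylineCarrier_reverse (q :: l),
        polylineCarrier_cons_cons, union_comm]
      congr 1
      change segment ℝ q p ∪ {p} = _
      rw [segment_symm]
      refine union_eq_left.2 ?_
      rintro z rfl
      exact left_mem_segment _ _ _

/-- `S` contains the points immediately to the right of the polygonal line `l`. -/
def RightAlong (S : Set ℂ) : List ℂ → Prop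
  | p :: q :: l => RightGerm S p q ∧ RightAlong S (q :: l)
  | _ => True

/-- `S` contains the points immediately to the left of the polygonal line `l`. -/
def LeftAlong (S : Set ℂ) : List ℂ → Prop
  | p :: q :: l => RightGerm S q p ∧ LeftAlong S (q :: l)
  | _ => True

lemma RightAlong.rightSideIn {S : Set ℂ} : ∀ {l : List ℂ}, RightAlong S l → RightSideIn S l
  | [], _ => trivial
  | [_], _ => trivial
  | _ :: _ :: _, h => ⟨h.1.midpoint, h.2.rightSideIn⟩

lemma rightAlong_append_cons {S : Set ℂ} : ∀ {l : List ℂ} {p : ℂ} {l' : List ℂ},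
    RightAlong S (l ++ [p]) → RightAlong S (p :: l') → RightAlong S (l ++ p :: l')
  | [], _, _, _, h' => h'
  | [_], _, _, h, h' => ⟨h.1, h'⟩
  | _ :: _ :: _, _, _, h, h' => ⟨h.1, rightAlong_append_cons (l := _ :: _) h.2 h'⟩

lemma LeftAlong.reverse {S : Set ℂ} : ∀ {l : List ℂ}, LeftAlong S l → RightAlong S l.reverse
  | [], _ => trivial
  | [_], _ => trivial
  | p :: q :: l, h => by
      rw [List.reverse_cons, List.reverse_cons, List.append_assoc, List.singleton_append]
      refine rightAlong_append_cons ?_ ⟨h.1, trivial⟩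
      rw [← List.reverse_cons]
      exact h.2.reverse

/-- The two sides of a polygonal arc whose interior points have neighbourhoods that lie in `U`,
apart from the arc. -/
lemma IsPolygonalArc.exists_sides {U : Set ℂ} : ∀ (l : List ℂ) (p q : ℂ),
    IsPolygonalArc (p :: q :: l) →
    (∀ y ∈ polylineCarrier (p :: q :: l), y ≠ p → y ≠ (q :: l).getLast (List.cons_ne_nil _ _) →
      ∀ᶠ z in 𝓝 y, z ∉ polylineCarrier (p :: q :: l) → z ∈ U) →
    ∃ R ∈ planeComponents U, ∃ L ∈ planeComponents U,
      RightAlong R (p :: q :: l) ∧ LeftAlong L (p :: q :: l) ∧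
      ∀ y ∈ polylineCarrier (p :: q :: l), y ≠ p → y ≠ (q :: l).getLast (List.cons_ne_nil _ _) →
        ∀ᶠ z in 𝓝 y, z ∉ polylineCarrier (p :: q :: l) → z ∈ R ∪ L := by
  intro l
  -- The sides of the line from `q` onwards are known by induction; those of the first segment are
  -- identified with them at the corner `q`.
  induction l with
  | nil =>
    intro p q harc hU
    obtain ⟨hpq, -, -⟩ := harc
    have hcar : polylineCarrier [p, q] = segment ℝ p q := by
      rw [polylineCarrier_cons_cons]
      refine union_eq_left.2 ?_
      rintro z rfl
      exact right_mem_segment _ _ _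
    rw [hcar] at hU ⊢
    simp only [List.getLast_singleton] at hU ⊢
    have hopen : ∀ y ∈ openSegment ℝ p q, ∀ᶠ z in 𝓝 y, z ∉ segment ℝ p q → z ∈ U := by
      intro y hy
      refine hU y (openSegment_subset_segment _ _ _ hy) ?_ ?_
      · rintro rfl; exact hpq (left_mem_openSegment_iff.1 hy)
      · rintro rfl; exact hpq (right_mem_openSegment_iff.1 hy)
    obtain ⟨R, hR, hgR⟩ := exists_rightGerm hpq hopen
    obtain ⟨L, hL, hgL⟩ := exists_rightGerm hpq.symm (by
      rwa [openSegment_symm, segment_symm] )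
    refine ⟨R, hR, L, hL, ⟨hgR, trivial⟩, ⟨hgL, trivial⟩, fun y hy hy1 hy2 => ?_⟩
    exact hgR.eventually_mem_union hpq hgL (mem_openSegment_of_ne_left_right hy1.symm hy2.symm hy)
  | cons r l ih =>
    intro p q harc hU
    obtain ⟨hpq, hinter, harc'⟩ := harc
    obtain ⟨hqr, hinter', harc''⟩ := id harc'
    set T := polylineCarrier (q :: r :: l) with hT
    set e := (r :: l).getLast (List.cons_ne_nil _ _) with he
    have hlast : (q :: r :: l).getLast (List.cons_ne_nil _ _) = e := List.getLast_cons _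
    rw [hlast] at hU ⊢
    have hcar : polylineCarrier (p :: q :: r :: l) = segment ℝ p q ∪ T := rfl
    rw [hcar] at hU ⊢
    have hTclosed : IsClosed T := isClosed_polylineCarrier _
    have hqT : q ∈ T := mem_polylineCarrier_of_mem List.mem_cons_self
    have hpT : p ∉ T := fun h => hpq (by
      have : p ∈ segment ℝ p q ∩ T := ⟨left_mem_segment _ _ _, h⟩
      rw [hinter] at this
      exact this)
    have hemem : e ∈ polylineCarrier (r :: l) := mem_polylineCarrier_of_mem (List.getLast_mem _)
    have heT : e ∈ T := Or.inr hemem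
    have hqr' : q ∉ polylineCarrier (r :: l) := fun h => hqr (by
      have : q ∈ segment ℝ q r ∩ polylineCarrier (r :: l) := ⟨left_mem_segment _ _ _, h⟩
      rw [hinter'] at this
      exact this)
    have hqe : q ≠ e := by rintro h; exact hqr' (h ▸ hemem)
    have hsegT : ∀ y ∈ segment ℝ p q, y ≠ q → y ∉ T := by
      intro y hy hyq hyT
      have : y ∈ segment ℝ p q ∩ T := ⟨hy, hyT⟩
      rw [hinter] at this
      exact hyq this
    -- the first segment
    have hopen : ∀ y ∈ openSegment ℝ p q, ∀ᶠ z in 𝓝 y, z ∉ segment ℝ p q → z ∈ U := by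
      intro y hy
      have hys := openSegment_subset_segment _ _ _ hy
      have hyp : y ≠ p := by rintro rfl; exact hpq (left_mem_openSegment_iff.1 hy)
      have hyq : y ≠ q := by rintro rfl; exact hpq (right_mem_openSegment_iff.1 hy)
      have hyT := hsegT y hys hyq
      filter_upwards [hU y (Or.inl hys) hyp (fun h => hyT (h ▸ heT)),
        hTclosed.isOpen_compl.mem_nhds hyT] with z hz1 hz2 hz3
      exact hz1 (fun h => h.elim hz3 hz2)
    obtain ⟨R₁, hR₁, hgR₁⟩ := exists_rightGerm hpq hopen
    obtain ⟨L₁, hL₁, hgL₁⟩ := exists_rightGerm hpq.symm (by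
      rwa [openSegment_symm, segment_symm] )
    -- the remaining segments
    obtain ⟨R, hR, L, hL, hgR, hgL, hcov⟩ := ih q r harc' (by
      intro y hy hyq hye
      have hys : y ∉ segment ℝ p q := fun h => hsegT y h hyq hy
      filter_upwards [hU y (Or.inr hy) (fun h => hpT (h ▸ hy)) hye,
        (isClosed_segment p q).isOpen_compl.mem_nhds hys] with z hz1 hz2 hz3
      exact hz1 (fun h => h.elim hz2 hz3))
    -- the corner
    have hnear : ∀ᶠ z in 𝓝 q, z ∉ polylineCarrier (r :: l) :=
      (isClosed_polylineCarrier _).isOpen_compl.mem_nhds hqr'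
    obtain ⟨rfl, rfl, hcorner⟩ := corner_component hpq hqr (fun z hz => by
        rw [← hinter]; exact ⟨hz.1, Or.inl hz.2⟩) (by
      filter_upwards [hU q (Or.inr hqT) hpq.symm hqe, hnear] with z hz1 hz2 hz3 hz4
      exact hz1 (fun h => h.elim hz3 fun h => h.elim hz4 hz2))
      hR₁ hR hL₁ hL hgR₁ hgR.1 hgL₁ hgL.1
    refine ⟨R₁, hR, L₁, hL, ⟨hgR₁, hgR⟩, ⟨hgL₁, hgL⟩, fun y hy hyp hye => ?_⟩
    by_cases hyq : y = q
    · subst hyq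
      filter_upwards [hcorner] with z hz1 hz2
      exact hz1 (fun h => hz2 (Or.inl h)) (fun h => hz2 (Or.inr (Or.inl h)))
    · rcases hy with hy | hy
      · filter_upwards [hgR₁.eventually_mem_union hpq hgL₁
          (mem_openSegment_of_ne_left_right (Ne.symm hyp) (Ne.symm hyq) hy)] with z hz1 hz2
        exact hz1 (fun h => hz2 (Or.inl h))
      · filter_upwards [hcov y hy hyq hye] with z hz1 hz2
        exact hz1 (fun h => hz2 (Or.inr h))

/-- Near its initial point, a polygonal arc coincides with its first segment. -/
lemma IsPolygonalArc.eventually_notMem {p q : ℂ} {l : List ℂ} (h : IsPolygonalArc (p :: q :: l)) :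
    ∀ᶠ z in 𝓝 p, z ∉ polylineCarrier (q :: l) := by
  refine (isClosed_polylineCarrier _).isOpen_compl.mem_nhds fun hp => h.1 ?_
  have : p ∈ segment ℝ p q ∩ polylineCarrier (q :: l) := ⟨left_mem_segment _ _ _, hp⟩
  rw [h.2.1] at this
  exact this

/-- If the initial point of a polygonal arc is a free end, both sides of the arc belong to the same
component. -/
lemma IsPolygonalArc.tip {U R L : Set ℂ} {p q : ℂ} {l : List ℂ}
    (h : IsPolygonalArc (p :: q :: l))
    (hU : ∀ᶠ z in 𝓝 p, z ∉ polylineCarrier (p :: q :: l) → z ∈ U)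
    (hR : R ∈ planeComponents U) (hL : L ∈ planeComponents U)
    (hgR : RightAlong R (p :: q :: l)) (hgL : LeftAlong L (p :: q :: l)) : R = L := by
  refine (tip_component h.1.symm ?_ hL hR hgL.1 hgR.1).symm
  filter_upwards [hU, h.eventually_notMem] with z hz1 hz2 hz3
  refine hz1 fun h => h.elim (fun h => hz3 (by rwa [segment_symm])) hz2

/-! ### Interior of a polygonal arc -/

lemma isPreconnected_diff_endpoint {p q : ℂ} :
    IsPreconnected (segment ℝ p q \ {p}) := by
  by_cases hpq : p = q
  · subst hpq
    simp [isPreconnected_empty]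
  have : segment ℝ p q \ {p} = (fun t : ℝ => p + t • (q - p)) '' Ioc (0 : ℝ) 1 := by
    rw [segment_eq_image']
    have h0 : q - p ≠ 0 := sub_ne_zero.2 (Ne.symm hpq)
    ext z
    constructor
    · rintro ⟨⟨t, ht, rfl⟩, hz⟩
      refine ⟨t, ⟨lt_of_le_of_ne ht.1 fun h => hz ?_, ht.2⟩, rfl⟩
      simp [← h]
    · rintro ⟨t, ht, rfl⟩
      refine ⟨⟨t, ⟨ht.1.le, ht.2⟩, rfl⟩, fun h => ?_⟩
      have : (t : ℂ) * (q - p) = 0 := by simpa using h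
      rcases mul_eq_zero.1 this with h | h
      · exact ht.1.ne' (by exact_mod_cast h)
      · exact h0 h
  rw [this]
  exact isPreconnected_Ioc.image _ (by fun_prop)

/-- The last point is off the first segment, so the induction glues a whole segment to the rest at
`q`. -/
lemma IsPolygonalArc.isPreconnected_diff_last : ∀ (l : List ℂ) (p : ℂ), IsPolygonalArc (p :: l) →
    IsPreconnected (polylineCarrier (p :: l) \ {(p :: l).getLast (List.cons_ne_nil _ _)})
  | [], p, _ => by simp [polylineCarrier, isPreconnected_empty]
  | [q], p, _ => by
      have : polylineCarrier [p, q] \ {q} = segment ℝ q p \ {q} := by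
        rw [polylineCarrier_cons_cons, segment_symm]
        simp [polylineCarrier]
      simp only [List.getLast_cons_cons, List.getLast_singleton]
      rw [this]
      exact isPreconnected_diff_endpoint
  | q :: r :: l, p, h => by
      have ih := IsPolygonalArc.isPreconnected_diff_last (r :: l) q h.2.2
      rw [List.getLast_cons_cons]
      set e := (q :: r :: l).getLast (List.cons_ne_nil _ _) with he
      have heq : e ∈ polylineCarrier (r :: l) := by
        rw [he, List.getLast_cons_cons]
        exact mem_polylineCarrier_of_mem (List.getLast_mem _)
      have hqe : q ≠ e := by
        intro h'
        have : q ∈ segment ℝ q r ∩ polylineCarrier (r :: l) :=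
          ⟨left_mem_segment _ _ _, h' ▸ heq⟩
        rw [h.2.2.2.1] at this
        exact h.2.2.1 this
      have hes : e ∉ segment ℝ p q := fun h' => hqe (by
        have : e ∈ segment ℝ p q ∩ polylineCarrier (q :: r :: l) := ⟨h', Or.inr heq⟩
        rw [h.2.1] at this
        exact this.symm)
      rw [polylineCarrier_cons_cons p q, union_sdiff_distrib, sdiff_singleton_eq_self hes]
      exact IsPreconnected.union q (right_mem_segment _ _ _)
        ⟨mem_polylineCarrier_of_mem List.mem_cons_self, hqe⟩ (convex_segment p q).isPreconnected ih

lemma IsPolygonalArc.isPreconnected_interior (l : List ℂ) (p q : ℂ)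
    (h : IsPolygonalArc (p :: q :: l)) :
    IsPreconnected (polylineCarrier (p :: q :: l) \
      {p, (q :: l).getLast (List.cons_ne_nil _ _)}) := by
  have hp : p ∉ polylineCarrier (q :: l) := fun hp => h.1 (by
    have : p ∈ segment ℝ p q ∩ polylineCarrier (q :: l) := ⟨left_mem_segment _ _ _, hp⟩
    rw [h.2.1] at this
    exact this)
  cases l with
  | nil =>
    have : polylineCarrier [p, q] \ {p, [q].getLast (List.cons_ne_nil _ _)} =
        openSegment ℝ p q := by
      simp only [List.getLast_singleton]
      ext z
      constructor
      · rintro ⟨hz, hz'⟩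
        simp only [mem_insert_iff, mem_singleton_iff, not_or] at hz'
        refine mem_openSegment_of_ne_left_right (Ne.symm hz'.1) (Ne.symm hz'.2) ?_
        exact hz.elim id fun h => absurd h hz'.2
      · intro hz
        refine ⟨Or.inl (openSegment_subset_segment _ _ _ hz), ?_⟩
        rintro (rfl | rfl)
        · exact h.1 (left_mem_openSegment_iff.1 hz)
        · exact h.1 (right_mem_openSegment_iff.1 hz)
    rw [this]
    exact (convex_openSegment p q).isPreconnected
  | cons r l =>
    have ih := IsPolygonalArc.isPreconnected_diff_last (r :: l) q h.2.2
    set e := (q :: r :: l).getLast (List.cons_ne_nil _ _) with he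
    have heq : e ∈ polylineCarrier (r :: l) := by
      rw [he, List.getLast_cons_cons]
      exact mem_polylineCarrier_of_mem (List.getLast_mem _)
    have hqe : q ≠ e := by
      intro h'
      have : q ∈ segment ℝ q r ∩ polylineCarrier (r :: l) :=
        ⟨left_mem_segment _ _ _, h' ▸ heq⟩
      rw [h.2.2.2.1] at this
      exact h.2.2.1 this
    have hes : e ∉ segment ℝ p q := fun h' => hqe (by
      have : e ∈ segment ℝ p q ∩ polylineCarrier (q :: r :: l) := ⟨h', Or.inr heq⟩
      rw [h.2.1] at this
      exact this.symm)
    have : polylineCarrier (p :: q :: r :: l) \ {p, e} =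
        (segment ℝ p q \ {p}) ∪ (polylineCarrier (q :: r :: l) \ {e}) := by
      rw [polylineCarrier_cons_cons p q, union_sdiff_distrib]
      congr 1
      · ext z
        simp only [Set.mem_sdiff, mem_insert_iff, mem_singleton_iff, not_or]
        exact ⟨fun h => ⟨h.1, h.2.1⟩, fun h => ⟨h.1, h.2, fun hz => hes (hz ▸ h.1)⟩⟩
      · ext z
        simp only [Set.mem_sdiff, mem_insert_iff, mem_singleton_iff, not_or]
        exact ⟨fun h => ⟨h.1, h.2.2⟩, fun h => ⟨h.1, fun hz => hp (hz ▸ h.1), h.2⟩⟩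
    rw [this]
    exact IsPreconnected.union q ⟨right_mem_segment _ _ _, h.1.symm⟩
      ⟨mem_polylineCarrier_of_mem List.mem_cons_self, hqe⟩ isPreconnected_diff_endpoint ih

end

noncomputable section

open Set Filter

/-! ### The angle swept out by a polygonal line -/

/-- The angle swept out by the polygonal line `l`, seen from `z`. -/
def sweptAngle (z : ℂ) : List ℂ → ℝ
  | p :: q :: l => Complex.arg ((q - z) / (p - z)) + sweptAngle z (q :: l)
  | _ => 0

/-- The quotient is a non-positive real only if `z` lies between `p` and `q`. Off the segment the
principal argument is therefore continuous in `z`. -/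
lemma div_mem_slitPlane {p q z : ℂ} (hz : z ∉ segment ℝ p q) :
    (q - z) / (p - z) ∈ Complex.slitPlane := by
  have hp : p - z ≠ 0 := fun h => hz (by
    rw [← sub_eq_zero.1 h]; exact left_mem_segment _ _ _)
  rw [Complex.mem_slitPlane_iff]
  by_contra hcon
  push Not at hcon
  obtain ⟨h1, h2⟩ := hcon
  set w := (q - z) / (p - z) with hw
  have hwr : w = (w.re : ℂ) := Complex.ext rfl (by simpa using h2)
  have hq : q - z = w.re * (p - z) := by
    rw [← hwr, hw, div_mul_cancel₀ _ hp]
  apply hz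
  set r := w.re
  refine ⟨-r / (1 - r), 1 / (1 - r), div_nonneg (by linarith) (by linarith),
    div_nonneg zero_le_one (by linarith), ?_, ?_⟩
  · rw [← add_div, div_eq_one_iff_eq (by linarith)]; ring
  · have h3 : (1 - r : ℂ) ≠ 0 := by
      have : (1 - r : ℝ) ≠ 0 := by linarith
      exact_mod_cast this
    rw [Complex.real_smul, Complex.real_smul]
    push_cast
    have : q = z + r * (p - z) := by rw [← hq]; ring
    rw [this]
    field_simp
    ring

lemma continuousAt_arg_div {p q z : ℂ} (hz : z ∉ segment ℝ p q) :
    ContinuousAt (fun z : ℂ => Complex.arg ((q - z) / (p - z))) z := by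
  have hp : p - z ≠ 0 := fun h => hz (by
    rw [← sub_eq_zero.1 h]; exact left_mem_segment _ _ _)
  refine ContinuousAt.comp (g := Complex.arg) (f := fun z : ℂ => (q - z) / (p - z))
    (Complex.continuousAt_arg (div_mem_slitPlane hz)) ?_
  exact ContinuousAt.div (by fun_prop) (by fun_prop) hp

lemma continuousAt_sweptAngle : ∀ {l : List ℂ} {z : ℂ}, z ∉ polylineCarrier l →
    ContinuousAt (fun z => sweptAngle z l) z
  | [], _, _ => continuousAt_const
  | [_], _, _ => continuousAt_const
  | _ :: _ :: _, _, h => (continuousAt_arg_div fun h' => h (Or.inl h')).add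
      (continuousAt_sweptAngle fun h' => h (Or.inr h'))

/-- Modulo `2π` the arguments telescope. Along a closed curve the swept angle is thus `2π` times an
integer, which plays the part of the winding number. -/
lemma coe_sweptAngle : ∀ (l : List ℂ) (p z : ℂ), z ∉ polylineCarrier (p :: l) →
    (sweptAngle z (p :: l) : Real.Angle) =
      ((Complex.arg ((p :: l).getLast (List.cons_ne_nil _ _) - z) : ℝ) : Real.Angle) -
        ((Complex.arg (p - z) : ℝ) : Real.Angle)
  | [], p, z, _ => by simp [sweptAngle]
  | q :: l, p, z, h => by
      have hq : z ∉ polylineCarrier (q :: l) := fun h' => h (Or.inr h')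
      have hp0 : p - z ≠ 0 := fun h0 => h (by
        rw [← sub_eq_zero.1 h0]; exact mem_polylineCarrier_of_mem List.mem_cons_self)
      have hq0 : q - z ≠ 0 := fun h0 => hq (by
        rw [← sub_eq_zero.1 h0]; exact mem_polylineCarrier_of_mem List.mem_cons_self)
      rw [List.getLast_cons_cons]
      simp only [sweptAngle, Real.Angle.coe_add]
      rw [coe_sweptAngle l q z hq, Complex.arg_div_coe_angle hq0 hp0]
      abel

/-- The values lie in `2πℤ`, whose points are at least `2π` apart, so `f` is locally constant on
`F`. -/
lemma eq_of_continuousOn_of_coe_eq {F : Set ℂ} (hF : IsPreconnected F) {f : ℂ → ℝ}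
    (hf : ContinuousOn f F) (h : ∀ z ∈ F, (f z : Real.Angle) = 0) {x y : ℂ} (hx : x ∈ F)
    (hy : y ∈ F) : f x = f y := by
  have hint : ∀ z ∈ F, ∃ n : ℤ, f z = n * (2 * Real.pi) := by
    intro z hz
    have := h z hz
    rw [← Real.Angle.coe_zero, Real.Angle.angle_eq_iff_two_pi_dvd_sub] at this
    obtain ⟨n, hn⟩ := this
    exact ⟨n, by linarith⟩
  refine hF.induction₂ (fun x y => f x = f y) ?_ (fun _ _ _ _ _ _ h1 h2 => h1.trans h2)
    (fun _ _ _ _ h => h.symm) hx hy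
  intro x hx
  filter_upwards [(hf x hx).eventually (Metric.ball_mem_nhds (f x) Real.two_pi_pos),
    self_mem_nhdsWithin] with y hy hyF
  obtain ⟨m, hm⟩ := hint x hx
  obtain ⟨n, hn⟩ := hint y hyF
  rw [Real.dist_eq, hm, hn, ← sub_mul, abs_mul, abs_of_pos Real.two_pi_pos] at hy
  have h1 : |(n : ℝ) - m| < 1 := by
    by_contra hcon
    nlinarith [not_lt.1 hcon, Real.two_pi_pos]
  have h2 : |n - m| < 1 := by exact_mod_cast h1
  rw [Int.abs_lt_one_iff, sub_eq_zero] at h2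
  rw [hm, hn, h2]

/-- The angle seen from `z` jumps by `2π` when `z` crosses the segment from right to left. -/
lemma tendsto_arg_right {p q : ℂ} (hpq : p ≠ q) :
    Tendsto (fun ε : ℝ => Complex.arg ((q - ((p + q) / 2 + (ε : ℂ) * (-Complex.I * (q - p)))) /
      (p - ((p + q) / 2 + (ε : ℂ) * (-Complex.I * (q - p)))))) (𝓝[>] 0) (𝓝 (-Real.pi)) := by
  have h0 : q - p ≠ 0 := sub_ne_zero.2 hpq.symm
  have hden : ∀ ε : ℝ, (-1 / 2 + ε * Complex.I : ℂ) ≠ 0 := by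
    intro ε h
    have := congrArg Complex.re h
    simp at this
  have heq : ∀ ε : ℝ, (q - ((p + q) / 2 + (ε : ℂ) * (-Complex.I * (q - p)))) /
      (p - ((p + q) / 2 + (ε : ℂ) * (-Complex.I * (q - p)))) =
      (1 / 2 + ε * Complex.I) / (-1 / 2 + ε * Complex.I) := by
    intro ε
    rw [← mul_div_mul_left (1 / 2 + (ε : ℂ) * Complex.I) _ h0]
    congr 1 <;> ring
  simp only [heq]
  -- The quotient does not depend on the segment. It tends to `-1` from below the real axis, where
  -- the principal argument tends to `-π`.
  have hT : Tendsto (fun ε : ℝ => (1 / 2 + ε * Complex.I : ℂ) / (-1 / 2 + ε * Complex.I))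
      (𝓝[>] 0) (𝓝[{z : ℂ | z.im < 0}] (-1)) := by
    apply tendsto_nhdsWithin_of_tendsto_nhds_of_eventually_within
    · have : Tendsto (fun ε : ℝ => (1 / 2 + ε * Complex.I : ℂ) / (-1 / 2 + ε * Complex.I)) (𝓝 0)
          (𝓝 ((1 / 2 + (0 : ℝ) * Complex.I : ℂ) / (-1 / 2 + (0 : ℝ) * Complex.I))) :=
        ContinuousAt.div (by fun_prop) (by fun_prop) (hden 0)
      have h1 : (1 / 2 + (0 : ℝ) * Complex.I : ℂ) / (-1 / 2 + (0 : ℝ) * Complex.I) = -1 := by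
        norm_num
      rw [h1] at this
      exact this.mono_left nhdsWithin_le_nhds
    · filter_upwards [self_mem_nhdsWithin] with ε hε
      have hε' : (0 : ℝ) < ε := hε
      have hN : 0 < Complex.normSq (-1 / 2 + ε * Complex.I) := Complex.normSq_pos.2 (hden ε)
      change Complex.im _ < 0
      rw [Complex.div_im]
      simp only [Complex.add_im, Complex.add_re, Complex.mul_im, Complex.mul_re, Complex.ofReal_re,
        Complex.ofReal_im, Complex.I_re, Complex.I_im]
      norm_num
      rw [← sub_neg, ← sub_div] 
      refine div_neg_of_neg_of_pos ?_ (by rwa [neg_div] at hN)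
      linarith
  have := (Complex.tendsto_arg_nhdsWithin_im_neg_of_re_neg_of_im_zero (z := -1) (by simp)
    (by simp)).comp hT
  exact this

lemma tendsto_arg_left {p q : ℂ} (hpq : p ≠ q) :
    Tendsto (fun ε : ℝ => Complex.arg ((q - ((q + p) / 2 + (ε : ℂ) * (-Complex.I * (p - q)))) /
      (p - ((q + p) / 2 + (ε : ℂ) * (-Complex.I * (p - q)))))) (𝓝[>] 0) (𝓝 Real.pi) := by
  have h := tendsto_arg_right hpq.symm
  have := h.neg
  rw [neg_neg] at this
  refine this.congr' ?_
  filter_upwards [h.eventually (gt_mem_nhds (neg_lt_zero.2 Real.pi_pos))] with ε hε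
  -- Exchanging `p` and `q` inverts the quotient and negates its argument; the exceptional argument
  -- `π` is excluded, as the argument is negative near the limit.
  rw [eq_comm, ← inv_div (p - _) (q - _), Complex.arg_inv, if_neg (by linarith [Real.pi_pos])]

/-- `g` stands for the angle swept out by the rest of the curve. It is continuous at the midpoint,
so only the angle of this segment jumps, from `-π` on the right to `π` on the left. -/
lemma jump_eq_two_pi {p q : ℂ} (hpq : p ≠ q) {g : ℂ → ℝ} (hg : ContinuousAt g ((p + q) / 2))
    {R L : Set ℂ} {a b : ℝ} (hR : RightGerm R p q) (hL : RightGerm L q p)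
    (ha : ∀ z ∈ R, Complex.arg ((q - z) / (p - z)) + g z = a)
    (hb : ∀ z ∈ L, Complex.arg ((q - z) / (p - z)) + g z = b) : b - a = 2 * Real.pi := by
  have hlim : ∀ v : ℂ, Tendsto (fun ε : ℝ => g ((p + q) / 2 + (ε : ℂ) * v)) (𝓝[>] 0)
      (𝓝 (g ((p + q) / 2))) := by
    intro v
    refine hg.tendsto.comp ?_
    have : Tendsto (fun ε : ℝ => (p + q) / 2 + (ε : ℂ) * v) (𝓝 0)
        (𝓝 ((p + q) / 2 + ((0 : ℝ) : ℂ) * v)) := Continuous.tendsto (by fun_prop) _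
    rw [Complex.ofReal_zero, zero_mul, add_zero] at this
    exact this.mono_left nhdsWithin_le_nhds
  have h1 : a = -Real.pi + g ((p + q) / 2) := by
    refine tendsto_nhds_unique ?_ ((tendsto_arg_right hpq).add (hlim (-Complex.I * (q - p))))
    refine tendsto_const_nhds.congr' ?_
    filter_upwards [hR.midpoint] with ε hε
    exact (ha _ hε).symm
  have h2 : b = Real.pi + g ((p + q) / 2) := by
    have h3 := hlim (-Complex.I * (p - q))
    rw [add_comm p q] at h3 ⊢
    refine tendsto_nhds_unique ?_ ((tendsto_arg_left hpq).add h3)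
    refine tendsto_const_nhds.congr' ?_
    filter_upwards [hL.midpoint] with ε hε
    exact (hb _ hε).symm
  rw [h1, h2]; ring

/-! ### Removing an arc from an open set -/

/-- Removing from an open set `U` a closed set `A` both of whose sides are `R` and `L` replaces the
component that contains `A ∩ U` by `R` and `L`. -/
lemma planeComponents_diff {U A F₀ R L : Set ℂ} (hU : IsOpen U) (hA : IsClosed A)
    (hne : (A ∩ U).Nonempty) (hF₀ : F₀ ∈ planeComponents U) (hAF₀ : A ∩ U ⊆ F₀)
    (hR : R ∈ planeComponents (U \ A)) (hL : L ∈ planeComponents (U \ A))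
    (hcov : ∀ y ∈ A ∩ U, ∀ᶠ z in 𝓝 y, z ∉ A → z ∈ R ∪ L)
    (hRF : (R ∩ F₀).Nonempty) (hLF : (L ∩ F₀).Nonempty) :
    planeComponents (U \ A) = insert R (insert L (planeComponents U \ {F₀})) := by
  have hU' : IsOpen (U \ A) := hU.sdiff hA
  ext F
  simp only [mem_insert_iff, Set.mem_sdiff, mem_singleton_iff]
  constructor
  · intro hF
    by_cases hFR : F = R
    · exact Or.inl hFR
    by_cases hFL : F = L
    · exact Or.inr (Or.inl hFL)
    refine Or.inr (Or.inr ?_)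
    obtain ⟨z, hz⟩ := planeComponents.nonempty hF
    have hzU := planeComponents.subset hF hz
    by_cases hzF₀ : z ∈ F₀
    · exfalso
      have hFF₀ : F ⊆ F₀ := planeComponents.subset_of_isPreconnected hF₀
        (planeComponents.isPreconnected hF) ((planeComponents.subset hF).trans sdiff_subset) hz hzF₀
      -- A component `F` inside `F₀` other than `R` and `L` is relatively closed in `F₀`, since near
      -- `A` only `R` and `L` occur. It would be all of the connected `F₀`, which however meets `A`.
      have hsub : F₀ ⊆ F ∪ interior Fᶜ := by
        intro y hy
        by_cases hyF : y ∈ F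
        · exact Or.inl hyF
        right
        rw [mem_interior_iff_mem_nhds]
        by_cases hyA : y ∈ A
        · filter_upwards [hcov y ⟨hyA, planeComponents.subset hF₀ hy⟩] with w hw hwF
          rcases hw (planeComponents.subset hF hwF).2 with h | h
          · exact hFR (planeComponents.eq_of_mem hF hR hwF h)
          · exact hFL (planeComponents.eq_of_mem hF hL hwF h)
        · have hyU : y ∈ U \ A := ⟨planeComponents.subset hF₀ hy, hyA⟩
          have hG := planeComponents.mem_of_mem hyU
          filter_upwards [(planeComponents.isOpen hU' hG).mem_nhds (mem_connectedComponentIn hyU)]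
            with w hw hwF
          exact hyF (planeComponents.eq_of_mem hF hG hwF hw ▸ mem_connectedComponentIn hyU)
      have := (planeComponents.isPreconnected hF₀).subset_left_of_subset_union
        (planeComponents.isOpen hU' hF) isOpen_interior
        (disjoint_compl_right.mono_right interior_subset) hsub ⟨z, hzF₀, hz⟩
      obtain ⟨y, hy⟩ := hne
      exact (planeComponents.subset hF (this (hAF₀ hy))).2 hy.1
    · have hG := planeComponents.mem_of_mem hzU.1
      have hzG := mem_connectedComponentIn hzU.1
      set G := connectedComponentIn U z
      have hGF₀ : G ≠ F₀ := fun h => hzF₀ (h ▸ hzG)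
      have hGA : G ⊆ U \ A := fun y hy => ⟨planeComponents.subset hG hy, fun hyA =>
        hGF₀ (planeComponents.eq_of_mem hG hF₀ hy (hAF₀ ⟨hyA, planeComponents.subset hG hy⟩))⟩
      have h1 : G ⊆ F := planeComponents.subset_of_isPreconnected hF
        (planeComponents.isPreconnected hG) hGA hzG hz
      have h2 : F ⊆ G := planeComponents.subset_of_isPreconnected hG
        (planeComponents.isPreconnected hF) ((planeComponents.subset hF).trans sdiff_subset) hz hzG
      rw [subset_antisymm h2 h1]
      exact ⟨hG, hGF₀⟩
  · rintro (rfl | rfl | ⟨hF, hne'⟩)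
    · exact hR
    · exact hL
    · have hFA : F ⊆ U \ A := fun y hy => ⟨planeComponents.subset hF hy, fun hyA =>
        hne' (planeComponents.eq_of_mem hF hF₀ hy (hAF₀ ⟨hyA, planeComponents.subset hF hy⟩))⟩
      obtain ⟨z, hz⟩ := planeComponents.nonempty hF
      have hG := planeComponents.mem_of_mem (hFA hz)
      have hzG := mem_connectedComponentIn (hFA hz)
      have h1 := planeComponents.subset_of_isPreconnected hG
        (planeComponents.isPreconnected hF) hFA hz hzG
      have h2 := planeComponents.subset_of_isPreconnected hF
        (planeComponents.isPreconnected hG) ((planeComponents.subset hG).trans sdiff_subset) hzG hz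
      rw [subset_antisymm h1 h2]
      exact hG

lemma ncard_planeComponents_diff {U A F₀ R L : Set ℂ} (hU : IsOpen U) (hA : IsClosed A)
    (hfin : (planeComponents U).Finite)
    (hne : (A ∩ U).Nonempty) (hF₀ : F₀ ∈ planeComponents U) (hAF₀ : A ∩ U ⊆ F₀)
    (hR : R ∈ planeComponents (U \ A)) (hL : L ∈ planeComponents (U \ A))
    (hcov : ∀ y ∈ A ∩ U, ∀ᶠ z in 𝓝 y, z ∉ A → z ∈ R ∪ L)
    (hRF : (R ∩ F₀).Nonempty) (hLF : (L ∩ F₀).Nonempty) :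
    (planeComponents (U \ A)).Finite ∧
    (R = L → (planeComponents (U \ A)).ncard = (planeComponents U).ncard) ∧
    (R ≠ L → (planeComponents (U \ A)).ncard = (planeComponents U).ncard + 1) := by
  have h := planeComponents_diff hU hA hne hF₀ hAF₀ hR hL hcov hRF hLF
  have key : ∀ S ∈ planeComponents (U \ A), (S ∩ F₀).Nonempty → S ∉ planeComponents U \ {F₀} := by
    rintro S hS ⟨z, hzS, hzF⟩ ⟨hSU, hne'⟩
    exact hne' (planeComponents.eq_of_mem hSU hF₀ hzS hzF)
  have hfin' : (planeComponents U \ {F₀}).Finite := hfin.subset sdiff_subset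
  have hcard : (planeComponents U \ {F₀}).ncard + 1 = (planeComponents U).ncard :=
    ncard_sdiff_singleton_add_one hF₀ hfin
  refine ⟨?_, ?_, ?_⟩
  · rw [h]
    exact (hfin'.insert _).insert _
  · rintro rfl
    rw [h, insert_eq_of_mem (mem_insert _ _), ncard_insert_of_notMem (key _ hR hRF) hfin', hcard]
  · intro hRL
    rw [h, ncard_insert_of_notMem _ (hfin'.insert _), ncard_insert_of_notMem (key _ hL hLF) hfin',
      hcard]
    rw [mem_insert_iff, not_or]
    exact ⟨hRL, key _ hR hRF⟩

end

noncomputable section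

open Set Filter

/-! ### Arcs of plane drawings -/

namespace PlaneDrawing

variable {V : Type*} {G : SimpleGraph V} (D : PlaneDrawing G)

/-- The arc representing the edge `uv`, without its end points. -/
def openArc (u v : V) : Set ℂ := D.arc u v \ {D.pos u, D.pos v}

/-- The union of the arcs representing the edges in `T`. -/
def arcsOn (T : Set (Sym2 V)) : Set ℂ := {z | ∃ u v, s(u, v) ∈ T ∧ z ∈ D.arc u v}

variable {D} {u v : V} {T T' : Set (Sym2 V)}

lemma corners_reverse (h : G.Adj u v) : (D.corners u v).reverse = D.corners v u := by
  simp [corners, D.bends_reverse u v h]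

lemma exists_corners_eq (u v : V) : ∃ q l, D.corners u v = D.pos u :: q :: l ∧
    (q :: l).getLast (List.cons_ne_nil _ _) = D.pos v := by
  unfold corners
  cases D.bends u v with
  | nil => exact ⟨_, [], rfl, rfl⟩
  | cons q l => exact ⟨q, l ++ [D.pos v], rfl, by simp⟩

lemma arc_symm (h : G.Adj u v) : D.arc u v = D.arc v u := by
  rw [arc, arc, ← corners_reverse h, polylineCarrier_reverse]

lemma openArc_symm (h : G.Adj u v) : D.openArc u v = D.openArc v u := by
  rw [openArc, openArc, arc_symm h, pair_comm]

lemma isPolygonalArc_corners (h : G.Adj u v) : IsPolygonalArc (D.corners u v) :=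
  D.isPolygonalArc u v h

lemma pos_left_mem_arc (u v : V) : D.pos u ∈ D.arc u v :=
  mem_polylineCarrier_of_mem List.mem_cons_self

lemma isClosed_arc (u v : V) : IsClosed (D.arc u v) := isClosed_polylineCarrier _

lemma isPreconnected_openArc (h : G.Adj u v) : IsPreconnected (D.openArc u v) := by
  obtain ⟨q, l, hc, hl⟩ := D.exists_corners_eq u v
  have harc := D.isPolygonalArc_corners h
  rw [openArc, arc, hc, ← hl]
  rw [hc] at harc
  exact harc.isPreconnected_interior

/-- The midpoint of the first segment of an arc. -/
lemma midpoint_mem_openArc {q : ℂ} {l : List ℂ} (h : G.Adj u v)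
    (hc : D.corners u v = D.pos u :: q :: l)
    (hl : (q :: l).getLast (List.cons_ne_nil _ _) = D.pos v) :
    (D.pos u + q) / 2 ∈ D.openArc u v ∧ (D.pos u + q) / 2 ∉ polylineCarrier (q :: l) := by
  have harc := D.isPolygonalArc_corners h
  rw [hc] at harc
  have hpq := harc.1
  have hmid : (D.pos u + q) / 2 = D.pos u + (q - D.pos u) * ((1 / 2 : ℝ) : ℂ) := by
    push_cast; ring
  have hmem : (D.pos u + q) / 2 ∈ openSegment ℝ (D.pos u) q := by
    rw [hmid]; exact coord_mem_openSegment _ _ ⟨by norm_num, by norm_num⟩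
  have hne1 : (D.pos u + q) / 2 ≠ D.pos u := fun h => hpq (by
    rw [h] at hmem; exact left_mem_openSegment_iff.1 hmem)
  have hne2 : (D.pos u + q) / 2 ≠ q := fun h => hpq (by
    rw [h] at hmem; exact right_mem_openSegment_iff.1 hmem)
  have hs := openSegment_subset_segment _ _ _ hmem
  have hnot : (D.pos u + q) / 2 ∉ polylineCarrier (q :: l) := fun h => hne2 (by
    have : (D.pos u + q) / 2 ∈ segment ℝ (D.pos u) q ∩ polylineCarrier (q :: l) := ⟨hs, h⟩
    rw [harc.2.1] at this
    exact this)
  refine ⟨⟨?_, ?_⟩, hnot⟩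
  · rw [arc, hc]; exact Or.inl hs
  · rintro (h | h)
    · exact hne1 h
    · refine hnot ?_
      rw [h, ← hl]
      exact mem_polylineCarrier_of_mem (List.getLast_mem _)

lemma openArc_nonempty (h : G.Adj u v) : (D.openArc u v).Nonempty := by
  obtain ⟨q, l, hc, hl⟩ := D.exists_corners_eq u v
  exact ⟨_, (midpoint_mem_openArc h hc hl).1⟩

lemma pos_notMem_openArc (h : G.Adj u v) (w : V) : D.pos w ∉ D.openArc u v := by
  rintro ⟨hw, hne⟩
  have h1 : w ≠ u := by rintro rfl; exact hne (Or.inl rfl)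
  have h2 : w ≠ v := by rintro rfl; exact hne (Or.inr rfl)
  exact D.vertex_notMem u v w h h1 h2 hw

lemma openArc_disjoint_arc {u' v' : V} (h : G.Adj u v) (h' : G.Adj u' v')
    (hne : s(u, v) ≠ s(u', v')) : Disjoint (D.openArc u v) (D.arc u' v') := by
  rw [Set.disjoint_left]
  intro z hz hz'
  obtain ⟨w, -, -, rfl⟩ := D.edges_inter u v u' v' h h' hne ⟨hz.1, hz'⟩
  exact pos_notMem_openArc h w hz

lemma openArc_disjoint_arcsOn (hT : T ⊆ G.edgeSet) (h : G.Adj u v) (hne : s(u, v) ∉ T) :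
    Disjoint (D.openArc u v) (D.arcsOn T) := by
  rw [Set.disjoint_left]
  rintro z hz ⟨u', v', huv, hz'⟩
  exact Set.disjoint_left.1 (openArc_disjoint_arc h (hT huv) fun h => hne (h ▸ huv)) hz hz'

lemma arc_subset_arcsOn (h : s(u, v) ∈ T) : D.arc u v ⊆ D.arcsOn T := fun _ hz => ⟨u, v, h, hz⟩

lemma arcsOn_mono (h : T ⊆ T') : D.arcsOn T ⊆ D.arcsOn T' :=
  fun _ ⟨u, v, huv, hz⟩ => ⟨u, v, h huv, hz⟩

lemma arcsOn_empty : D.arcsOn ∅ = ∅ := by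
  ext z; simp [arcsOn]

lemma arcsOn_insert (h : G.Adj u v) :
    D.arcsOn (insert s(u, v) T) = D.arc u v ∪ D.arcsOn T := by
  ext z
  constructor
  · rintro ⟨u', v', huv, hz⟩
    rcases huv with huv | huv
    · rcases Sym2.eq_iff.1 huv with ⟨rfl, rfl⟩ | ⟨rfl, rfl⟩
      · exact Or.inl hz
      · exact Or.inl (by rwa [arc_symm h])
    · exact Or.inr ⟨u', v', huv, hz⟩
  · rintro (hz | ⟨u', v', huv, hz⟩)
    · exact ⟨u, v, Or.inl rfl, hz⟩
    · exact ⟨u', v', Or.inr huv, hz⟩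

lemma isCompact_arcsOn [Finite V] (T : Set (Sym2 V)) : IsCompact (D.arcsOn T) := by
  have : D.arcsOn T = ⋃ p ∈ {p : V × V | s(p.1, p.2) ∈ T}, D.arc p.1 p.2 := by
    ext z; simp [arcsOn]
  rw [this]
  exact (Set.toFinite _).isCompact_biUnion fun p _ => isCompact_polylineCarrier _

lemma isClosed_arcsOn [Finite V] (T : Set (Sym2 V)) : IsClosed (D.arcsOn T) :=
  (isCompact_arcsOn T).isClosed

lemma pos_mem_arcsOn_iff (hT : T ⊆ G.edgeSet) {w : V} :
    D.pos w ∈ D.arcsOn T ↔ ∃ e ∈ T, w ∈ e := by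
  constructor
  · rintro ⟨u, v, huv, hw⟩
    refine ⟨_, huv, ?_⟩
    by_contra hcon
    rw [Sym2.mem_iff, not_or] at hcon
    exact D.vertex_notMem u v w (hT huv) hcon.1 hcon.2 hw
  · rintro ⟨e, he, hw⟩
    obtain ⟨v, rfl⟩ := hw
    exact ⟨_, _, he, pos_left_mem_arc _ _⟩

lemma carrier_eq : D.carrier = range D.pos ∪ D.arcsOn G.edgeSet := rfl

/-! ### The two sides of an arc -/

lemma exists_sides (h : G.Adj u v) {U : Set ℂ}
    (hU : ∀ y ∈ D.openArc u v, ∀ᶠ z in 𝓝 y, z ∉ D.arc u v → z ∈ U) :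
    ∃ R ∈ planeComponents U, ∃ L ∈ planeComponents U,
      RightAlong R (D.corners u v) ∧ LeftAlong L (D.corners u v) ∧
      ∀ y ∈ D.openArc u v, ∀ᶠ z in 𝓝 y, z ∉ D.arc u v → z ∈ R ∪ L := by
  obtain ⟨q, l, hc, hl⟩ := D.exists_corners_eq u v
  have harc := D.isPolygonalArc_corners h
  unfold openArc arc at *
  rw [hc] at harc hU ⊢
  rw [← hl] at hU ⊢
  obtain ⟨R, hR, L, hL, hgR, hgL, hcov⟩ := harc.exists_sides l _ _ (fun y hy h1 h2 =>
    hU y ⟨hy, by simp [h1, h2]⟩)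
  refine ⟨R, hR, L, hL, hgR, hgL, fun y hy => hcov y hy.1 ?_ ?_⟩
  · rintro rfl; exact hy.2 (Or.inl rfl)
  · intro h; exact hy.2 (Or.inr h)

lemma tendsto_beside (z v : ℂ) :
    Tendsto (fun ε : ℝ => z + (ε : ℂ) * v) (𝓝[>] 0) (𝓝 z) := by
  have : Tendsto (fun ε : ℝ => z + (ε : ℂ) * v) (𝓝 0) (𝓝 (z + ((0 : ℝ) : ℂ) * v)) :=
    Continuous.tendsto (by fun_prop) _
  rw [Complex.ofReal_zero, zero_mul, add_zero] at this
  exact this.mono_left nhdsWithin_le_nhds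

lemma RightOf.inter_nonempty (h : G.Adj u v) {S W : Set ℂ} (hS : D.RightOf u v S)
    (hW : IsOpen W) (hsub : D.openArc u v ⊆ W) : (S ∩ W).Nonempty := by
  obtain ⟨q, l, hc, hl⟩ := D.exists_corners_eq u v
  have hm := hsub (midpoint_mem_openArc h hc hl).1
  rw [RightOf, hc] at hS
  obtain ⟨ε, h1, h2⟩ := (hS.1.and ((tendsto_beside _ _).eventually (hW.mem_nhds hm))).exists
  exact ⟨_, h1, h2⟩

lemma RightOf.inter {S S' : Set ℂ} (hS : D.RightOf u v S) (hS' : D.RightOf u v S') :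
    (S ∩ S').Nonempty := by
  obtain ⟨q, l, hc, hl⟩ := D.exists_corners_eq u v
  rw [RightOf, hc] at hS hS'
  obtain ⟨ε, h1, h2⟩ := (hS.1.and hS'.1).exists
  exact ⟨_, h1, h2⟩

lemma RightSideIn.mono {S S' : Set ℂ} (hSS' : S ⊆ S') : ∀ {l : List ℂ},
    RightSideIn S l → RightSideIn S' l
  | [], _ => trivial
  | [_], _ => trivial
  | _ :: _ :: _, h => ⟨h.1.mono fun _ hz => hSS' hz, RightSideIn.mono hSS' h.2⟩

lemma RightOf.mono {S S' : Set ℂ} (hS : D.RightOf u v S) (hSS' : S ⊆ S') : D.RightOf u v S' :=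
  RightSideIn.mono hSS' hS

lemma rightOf_of_rightAlong {S : Set ℂ} (h : RightAlong S (D.corners u v)) : D.RightOf u v S :=
  h.rightSideIn

lemma rightOf_of_leftAlong {S : Set ℂ} (h : G.Adj u v) (h' : LeftAlong S (D.corners u v)) :
    D.RightOf v u S := by
  have := h'.reverse
  rw [corners_reverse h] at this
  exact this.rightSideIn

/-- If the edge `uv` is part of a closed walk, then the angle swept out by that walk jumps by `2π`
across the edge. -/
lemma sweep_jump (h : G.Adj u v) {g : ℂ → ℝ} (hg : ∀ z ∈ D.openArc u v, ContinuousAt g z)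
    {R L : Set ℂ} {a b : ℝ} (hR : RightAlong R (D.corners u v)) (hL : LeftAlong L (D.corners u v))
    (ha : ∀ z ∈ R, sweptAngle z (D.corners u v) + g z = a)
    (hb : ∀ z ∈ L, sweptAngle z (D.corners u v) + g z = b) : b - a = 2 * Real.pi := by
  obtain ⟨q, l, hc, hl⟩ := D.exists_corners_eq u v
  obtain ⟨hm1, hm2⟩ := midpoint_mem_openArc h hc hl
  have harc := D.isPolygonalArc_corners h
  rw [hc] at harc hR hL
  simp only [hc, sweptAngle, add_assoc] at ha hb
  exact jump_eq_two_pi harc.1 ((continuousAt_sweptAngle hm2).add (hg _ hm1)) hR.1 hL.1 ha hb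

lemma coe_sweptAngle_corners {z : ℂ} (hz : z ∉ D.arc u v) :
    (sweptAngle z (D.corners u v) : Real.Angle) =
      ((Complex.arg (D.pos v - z) : ℝ) : Real.Angle) -
        ((Complex.arg (D.pos u - z) : ℝ) : Real.Angle) := by
  obtain ⟨q, l, hc, hl⟩ := D.exists_corners_eq u v
  rw [arc, hc] at hz
  rw [hc, coe_sweptAngle _ _ _ hz, List.getLast_cons_cons, hl]

/-- `g` is the angle swept out along a walk in `T` from `u` to `v`. Together with an edge from `v`
to `u` the walk closes up, and the total angle becomes a multiple of `2π`. -/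
lemma exists_sweep (h : (SimpleGraph.fromEdgeSet T).Reachable u v) :
    ∃ g : ℂ → ℝ, ∀ z ∉ D.arcsOn T, ContinuousAt g z ∧
      (g z : Real.Angle) = ((Complex.arg (D.pos v - z) : ℝ) : Real.Angle) -
        ((Complex.arg (D.pos u - z) : ℝ) : Real.Angle) := by
  obtain ⟨p⟩ := h
  induction p with
  | nil => exact ⟨fun _ => 0, fun z _ => ⟨continuousAt_const, by simp⟩⟩
  | @cons u w v huw p ih =>
    obtain ⟨g, hg⟩ := ih
    rw [SimpleGraph.fromEdgeSet_adj] at huw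
    refine ⟨fun z => sweptAngle z (D.corners u w) + g z, fun z hz => ?_⟩
    have hz' : z ∉ D.arc u w := fun h => hz (arc_subset_arcsOn huw.1 h)
    refine ⟨(continuousAt_sweptAngle hz').add (hg z hz).1, ?_⟩
    rw [Real.Angle.coe_add, coe_sweptAngle_corners hz', (hg z hz).2]
    abel

/-- The two sides of an edge that lies on a cycle belong to different components. -/
lemma sides_ne (hT : T ⊆ G.edgeSet) (h : G.Adj u v) (hne : s(u, v) ∉ T)
    (hr : (SimpleGraph.fromEdgeSet T).Reachable v u) {U R L : Set ℂ}
    (hUT : Disjoint U (D.arcsOn T)) (hUa : Disjoint U (D.arc u v))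
    (hR : R ∈ planeComponents U)
    (hgR : RightAlong R (D.corners u v)) (hgL : LeftAlong L (D.corners u v)) : R ≠ L := by
  rintro rfl
  obtain ⟨g, hg⟩ := D.exists_sweep hr
  have hRU := planeComponents.subset hR
  have hRT : ∀ z ∈ R, z ∉ D.arcsOn T := fun z hz => Set.disjoint_left.1 hUT (hRU hz)
  have hRa : ∀ z ∈ R, z ∉ D.arc u v := fun z hz => Set.disjoint_left.1 hUa (hRU hz)
  obtain ⟨z₀, hz₀⟩ := planeComponents.nonempty hR
  -- The edge followed by the return path in `T` is a closed curve, so its swept angle is constant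
  -- on `R`. With `R` on both sides, the jump of `2π` across the edge would be `0`.
  have hconst : ∀ z ∈ R, sweptAngle z (D.corners u v) + g z =
      sweptAngle z₀ (D.corners u v) + g z₀ := fun z hz =>
    eq_of_continuousOn_of_coe_eq (f := fun z => sweptAngle z (D.corners u v) + g z)
      (planeComponents.isPreconnected hR)
      (fun z hz => ((continuousAt_sweptAngle (hRa z hz)).add (hg z (hRT z hz)).1).continuousWithinAt)
      (fun z hz => by
        rw [Real.Angle.coe_add, coe_sweptAngle_corners (hRa z hz), (hg z (hRT z hz)).2]; abel)
      hz hz₀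
  have := sweep_jump h (fun z hz => (hg z (Set.disjoint_left.1
    (openArc_disjoint_arcsOn hT h hne) hz)).1) hgR hgL hconst hconst
  rw [sub_self] at this
  exact Real.two_pi_pos.ne this

end PlaneDrawing

end

noncomputable section

open Set Filter

namespace PlaneDrawing

variable {V : Type*} {G : SimpleGraph V} {D : PlaneDrawing G} {u v : V} {T : Set (Sym2 V)}

/-! ### Counting components -/

/-- Adding the arc of an edge `uv` to the arcs drawn inside `Ω`: the number of components stays the
same or increases by one, according to whether the two sides of the arc agree. -/
lemma ncard_components_insert [Finite V] {Ω : Set ℂ} (hΩ : IsOpen Ω) (hu : D.pos u ∉ Ω)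
    (hv : D.pos v ∉ Ω) (hT : T ⊆ G.edgeSet) (h : G.Adj u v) (hne : s(u, v) ∉ T) (hsub : D.openArc u v ⊆ Ω)
    (hfin : (planeComponents (Ω \ D.arcsOn T)).Finite) :
    ∃ R ∈ planeComponents (Ω \ D.arcsOn (insert s(u, v) T)),
    ∃ L ∈ planeComponents (Ω \ D.arcsOn (insert s(u, v) T)),
      RightAlong R (D.corners u v) ∧ LeftAlong L (D.corners u v) ∧
      (planeComponents (Ω \ D.arcsOn (insert s(u, v) T))).Finite ∧
      (R = L → (planeComponents (Ω \ D.arcsOn (insert s(u, v) T))).ncard =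
        (planeComponents (Ω \ D.arcsOn T)).ncard) ∧
      (R ≠ L → (planeComponents (Ω \ D.arcsOn (insert s(u, v) T))).ncard =
        (planeComponents (Ω \ D.arcsOn T)).ncard + 1) := by
  have hU : IsOpen (Ω \ D.arcsOn T) := hΩ.sdiff (isClosed_arcsOn T)
  have hdiff : Ω \ D.arcsOn (insert s(u, v) T) = (Ω \ D.arcsOn T) \ D.arc u v := by
    rw [arcsOn_insert h, union_comm, sdiff_sdiff]
  have hoU : D.openArc u v ⊆ Ω \ D.arcsOn T := fun z hz =>
    ⟨hsub hz, Set.disjoint_left.1 (openArc_disjoint_arcsOn hT h hne) hz⟩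
  have hAU : D.arc u v ∩ (Ω \ D.arcsOn T) = D.openArc u v := by
    refine subset_antisymm ?_ fun z hz => ⟨hz.1, hoU hz⟩
    rintro z ⟨hz1, hz2⟩
    refine ⟨hz1, ?_⟩
    rintro (rfl | hz)
    · exact hu hz2.1
    · exact hv (by rw [mem_singleton_iff] at hz; exact hz ▸ hz2.1)
  rw [hdiff]
  obtain ⟨R, hR, L, hL, hgR, hgL, hcov⟩ := exists_sides (D := D) h
    (U := (Ω \ D.arcsOn T) \ D.arc u v) (fun y hy => by
      filter_upwards [hU.mem_nhds (hoU hy)] with z hz hz'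
      exact ⟨hz, hz'⟩)
  -- The open arc is connected, so it runs inside a single old component, the only one that can be
  -- split.
  obtain ⟨F₀, hF₀, hoF₀⟩ := planeComponents.exists_superset (isPreconnected_openArc h) hoU
    (openArc_nonempty h)
  have hF₀o := planeComponents.isOpen hU hF₀
  have := ncard_planeComponents_diff hU (isClosed_arc u v) hfin
    (by rw [hAU]; exact openArc_nonempty h) hF₀ (by rw [hAU]; exact hoF₀) hR hL
    (by rw [hAU]; exact hcov)
    ((rightOf_of_rightAlong hgR).inter_nonempty h hF₀o hoF₀)
    ((rightOf_of_leftAlong h hgL).inter_nonempty h.symm hF₀o (by rwa [openArc_symm h.symm]))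
  exact ⟨R, hR, L, hL, hgR, hgL, this⟩

/-- Adding an edge with a new end vertex does not change the number of components. -/
lemma ncard_components_insert_of_tip [Finite V] {Ω : Set ℂ} (hΩ : IsOpen Ω)
    (hposu : D.pos u ∉ Ω) (hposv : D.pos v ∉ Ω) (hT : T ⊆ G.edgeSet) (h : G.Adj u v) (hsub : D.openArc u v ⊆ Ω)
    (hfin : (planeComponents (Ω \ D.arcsOn T)).Finite)
    (hu : ∀ e ∈ T, u ∉ e) (huΩ : insert (D.pos u) Ω ∈ 𝓝 (D.pos u)) :
    (planeComponents (Ω \ D.arcsOn (insert s(u, v) T))).Finite ∧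
      (planeComponents (Ω \ D.arcsOn (insert s(u, v) T))).ncard =
        (planeComponents (Ω \ D.arcsOn T)).ncard := by
  have hne : s(u, v) ∉ T := fun h => hu _ h (Sym2.mem_mk_left _ _)
  obtain ⟨R, hR, L, hL, hgR, hgL, hfin', heq, -⟩ :=
    ncard_components_insert hΩ hposu hposv hT h hne hsub hfin
  refine ⟨hfin', heq ?_⟩
  obtain ⟨q, l, hc, hl⟩ := D.exists_corners_eq u v
  have harc := isPolygonalArc_corners (D := D) h
  rw [hc] at harc hgR hgL
  refine harc.tip ?_ hR hL hgR hgL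
  have huT : D.pos u ∉ D.arcsOn T := by
    rw [pos_mem_arcsOn_iff hT]
    rintro ⟨e, he, hue⟩
    exact hu e he hue
  filter_upwards [huΩ, (isClosed_arcsOn T).isOpen_compl.mem_nhds huT] with z hz1 hz2 hz3
  rw [← hc] at hz3
  refine ⟨hz1.resolve_left ?_, ?_⟩
  · rintro rfl
    exact hz3 (pos_left_mem_arc _ _)
  · rw [arcsOn_insert h]
    rintro (h | h)
    · exact hz3 h
    · exact hz2 h

/-- Euler's formula for a plane graph that grows inside a connected open set `Ω`, starting from a
connected graph with edge set `T₀` and vertex set `X₀` outside `Ω`. -/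
theorem ncard_components_add_ncard [Finite V] {Ω : Set ℂ} (hΩ : IsOpen Ω) (hΩc : IsConnected Ω)
    {T₀ E : Set (Sym2 V)} {X₀ X₁ : Set V} (hpos : ∀ w ∈ X₁, D.pos w ∉ Ω) (hX : X₀ ⊆ X₁)
    (hT₀ : T₀ ⊆ G.edgeSet) (hE : E ⊆ G.edgeSet) (hdisj : Disjoint T₀ E)
    (hT₀Ω : Disjoint Ω (D.arcsOn T₀)) (hT₀X : ∀ e ∈ T₀, ∀ w ∈ e, w ∈ X₀)
    (hX₀ : ∀ x ∈ X₀, ∀ y ∈ X₀, (SimpleGraph.fromEdgeSet T₀).Reachable x y)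
    (hEX : ∀ e ∈ E, ∀ w ∈ e, w ∈ X₁)
    (hEΩ : ∀ u v, s(u, v) ∈ E → D.openArc u v ⊆ Ω)
    (hX₁ : ∀ x ∈ X₁, ∃ x₀ ∈ X₀, (SimpleGraph.fromEdgeSet (T₀ ∪ E)).Reachable x₀ x)
    (hX₁Ω : ∀ x ∈ X₁, x ∉ X₀ → insert (D.pos x) Ω ∈ 𝓝 (D.pos x)) :
    (planeComponents (Ω \ D.arcsOn E)).Finite ∧
      (planeComponents (Ω \ D.arcsOn E)).ncard + X₁.ncard = 1 + X₀.ncard + E.ncard := by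
  -- The drawing grows edge by edge: `T` holds the edges of `E` drawn so far and `X` the vertices
  -- reached. The constant `1` counts the connected set `Ω` before any of them is drawn.
  let P : Set V → Set (Sym2 V) → Prop := fun X T => X₀ ⊆ X ∧ X ⊆ X₁ ∧ T ⊆ E ∧
    (∀ e ∈ T, ∀ w ∈ e, w ∈ X) ∧
    (∀ x ∈ X, ∀ y ∈ X, (SimpleGraph.fromEdgeSet (T₀ ∪ T)).Reachable x y) ∧
    (planeComponents (Ω \ D.arcsOn T)).Finite ∧
    (planeComponents (Ω \ D.arcsOn T)).ncard + X.ncard = 1 + X₀.ncard + T.ncard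
  have hbase : P X₀ ∅ := by
    refine ⟨Subset.rfl, hX, empty_subset _, by simp, by simpa using hX₀, ?_, ?_⟩
    · rw [arcsOn_empty, sdiff_empty, planeComponents.eq_singleton hΩc.2 hΩc.1]
      exact finite_singleton _
    · rw [arcsOn_empty, sdiff_empty, planeComponents.eq_singleton hΩc.2 hΩc.1]
      simp
  have hstep : ∀ X T u v, P X T → s(u, v) ∈ E → s(u, v) ∉ T → v ∈ X →
      ∃ X', P X' (insert s(u, v) T) := by
    rintro X T u v ⟨hX₀X, hXX₁, hTE, hTX, hreach, hfin, hcard⟩ huv hne hv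
    have hadj : G.Adj u v := hE huv
    have hTG := hTE.trans hE
    have hposu := hpos u (hEX _ huv u (Sym2.mem_mk_left _ _))
    have hposv := hpos v (hXX₁ hv)
    have hins : insert s(u, v) T ⊆ E := insert_subset huv hTE
    have hmono : SimpleGraph.fromEdgeSet (T₀ ∪ T) ≤
        SimpleGraph.fromEdgeSet (T₀ ∪ insert s(u, v) T) :=
      SimpleGraph.fromEdgeSet_mono (union_subset_union_right _ (subset_insert _ _))
    have hcardT : (insert s(u, v) T).ncard = T.ncard + 1 := ncard_insert_of_notMem hne (toFinite T)
    by_cases hu : u ∈ X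
    -- Both ends are already connected through `T₀ ∪ T`, so the edge closes a cycle and separates
    -- its sides: one more component.
    · refine ⟨X, hX₀X, hXX₁, hins, ?_, fun x hx y hy => (hreach x hx y hy).mono hmono, ?_⟩
      · rintro e (rfl | he) w hw
        · rcases Sym2.mem_iff.1 hw with rfl | rfl
          exacts [hu, hv]
        · exact hTX e he w hw
      obtain ⟨R, hR, L, hL, hgR, hgL, hfin', -, hneq⟩ :=
        ncard_components_insert hΩ hposu hposv hTG hadj hne (hEΩ u v huv) hfin
      refine ⟨hfin', ?_⟩
      have hRL : R ≠ L := by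
        refine sides_ne (T := T₀ ∪ T) (union_subset hT₀ hTG) hadj ?_ (hreach v hv u hu) ?_ ?_
          hR hgR hgL
        · rintro (h | h)
          · exact Set.disjoint_left.1 hdisj h huv
          · exact hne h
        · rw [Set.disjoint_left]
          rintro z hz ⟨a, b, hab | hab, hz'⟩
          · exact Set.disjoint_left.1 hT₀Ω hz.1 ⟨a, b, hab, hz'⟩
          · exact hz.2 ⟨a, b, Or.inr hab, hz'⟩
        · rw [Set.disjoint_left]
          exact fun z hz hz' => hz.2 ⟨u, v, Or.inl rfl, hz'⟩
      rw [hneq hRL, hcardT]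
      omega
    -- The end `u` is new, hence a free end of the arc: one more vertex and one more edge, but no
    -- more components.
    · have huT : ∀ e ∈ T, u ∉ e := fun e he hue => hu (hTX e he u hue)
      obtain ⟨hfin', hcard'⟩ := ncard_components_insert_of_tip hΩ hposu hposv hTG hadj (hEΩ u v huv)
        hfin huT (hX₁Ω u (hEX _ huv u (Sym2.mem_mk_left _ _)) fun h => hu (hX₀X h))
      have huv' : (SimpleGraph.fromEdgeSet (T₀ ∪ insert s(u, v) T)).Reachable u v :=
        SimpleGraph.Adj.reachable
          ((SimpleGraph.fromEdgeSet_adj _).2 ⟨Or.inr (Or.inl rfl), hadj.ne⟩)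
      have hall : ∀ x ∈ insert u X,
          (SimpleGraph.fromEdgeSet (T₀ ∪ insert s(u, v) T)).Reachable x v := by
        rintro x (rfl | hx)
        · exact huv'
        · exact (hreach x hx v hv).mono hmono
      refine ⟨insert u X, hX₀X.trans (subset_insert _ _),
        insert_subset (hEX _ huv u (Sym2.mem_mk_left _ _)) hXX₁, hins, ?_,
        fun x hx y hy => (hall x hx).trans (hall y hy).symm, hfin', ?_⟩
      · rintro e (rfl | he) w hw
        · rcases Sym2.mem_iff.1 hw with rfl | rfl
          exacts [Or.inl rfl, Or.inr hv]
        · exact Or.inr (hTX e he w hw)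
      · rw [hcard', hcardT, ncard_insert_of_notMem hu (toFinite X)]
        omega
  -- an edge of `E` leaving `X`
  have hcross : ∀ X T, P X T → ∀ x ∈ X₁, x ∉ X → ∃ a b, s(a, b) ∈ E ∧ a ∉ X ∧ b ∈ X := by
    rintro X T ⟨hX₀X, -⟩ x hx hxX
    obtain ⟨x₀, hx₀, ⟨p⟩⟩ := hX₁ x hx
    obtain ⟨d, -, hd1, hd2⟩ := p.exists_boundary_dart X (hX₀X hx₀) hxX
    have hadj := d.adj
    rw [SimpleGraph.fromEdgeSet_adj] at hadj
    refine ⟨d.snd, d.fst, ?_, hd2, hd1⟩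
    rw [Sym2.eq_swap]
    refine hadj.1.resolve_left fun h => hd2 (hX₀X (hT₀X _ h _ (Sym2.mem_mk_right _ _)))
  -- A maximal `T` leaves no edge of `E` with an end in `X` undrawn. By connectivity `X` is then all
  -- of `X₁`, and `T` all of `E`.
  obtain ⟨T, ⟨⟨X, hP⟩, hmax⟩⟩ := (Set.toFinite {T | ∃ X, P X T}).exists_maximal ⟨∅, X₀, hbase⟩
  have hnew : ∀ u v, s(u, v) ∈ E → v ∈ X → s(u, v) ∈ T := by
    intro u v huv hv
    by_contra hne
    have := hmax (hstep X T u v hP huv hne hv) (subset_insert _ _)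
    exact hne (this (mem_insert _ _))
  have hXX₁ : X = X₁ := by
    refine subset_antisymm hP.2.1 fun x hx => ?_
    by_contra hxX
    obtain ⟨a, b, hab, ha, hb⟩ := hcross X T hP x hx hxX
    exact ha (hP.2.2.2.1 _ (hnew a b hab hb) a (Sym2.mem_mk_left _ _))
  subst hXX₁
  have hTE : T = E := by
    refine subset_antisymm hP.2.2.1 fun e he => ?_
    induction e with
    | h u v => exact hnew u v he (hEX _ he v (Sym2.mem_mk_right _ _))
  subst hTE
  exact hP.2.2.2.2.2

/-! ### Removing points from an open set -/

/-- A small punctured disc around `x` is connected, being a translated exponential image of a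
half-plane, so it lies on one side of any separation of `U \ {x}`; adding `x` to that side would
separate `U`. -/
lemma isPreconnected_diff_singleton {U : Set ℂ} (hU : IsOpen U) (hc : IsPreconnected U) (x : ℂ) :
    IsPreconnected (U \ {x}) := by
  by_cases hx : x ∈ U
  swap
  · rwa [sdiff_singleton_eq_self hx]
  obtain ⟨δ, hδ, hball⟩ := Metric.isOpen_iff.1 hU x hx
  have hpre : IsPreconnected (Metric.ball x δ \ {x}) := by
    have : Metric.ball x δ \ {x} = (fun w => x + Complex.exp w) '' {w | w.re < Real.log δ} := by
      ext z
      constructor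
      · rintro ⟨h1, h2⟩
        have h3 : z - x ≠ 0 := sub_ne_zero.2 h2
        refine ⟨Complex.log (z - x), ?_, by simp [Complex.exp_log h3]⟩
        rw [mem_ofPred_eq, Complex.log_re]
        refine Real.log_lt_log (norm_pos_iff.2 h3) ?_
        rwa [← dist_eq_norm]
      · rintro ⟨w, hw, rfl⟩
        refine ⟨?_, by simp [Complex.exp_ne_zero]⟩
        rw [mem_ball_iff_norm, add_sub_cancel_left, Complex.norm_exp]
        exact (Real.lt_log_iff_exp_lt hδ).1 hw
    rw [this]
    exact (convex_halfSpace_re_lt _).isPreconnected.image _ (by fun_prop)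
  have hne : (Metric.ball x δ \ {x}).Nonempty := by
    refine ⟨x + (δ / 2 : ℝ), ?_, ?_⟩
    · rw [mem_ball_iff_norm, add_sub_cancel_left, Complex.norm_real, Real.norm_of_nonneg (by linarith)]
      linarith
    · intro h
      have : ((δ / 2 : ℝ) : ℂ) = 0 := by simpa using h
      have : δ / 2 = 0 := by exact_mod_cast this
      linarith
  have hopen : IsOpen (U \ {x}) := hU.sdiff isClosed_singleton
  rw [isPreconnected_iff_subset_of_disjoint]
  intro A B hA hB hsub hdisj
  have hpb := hpre
  rw [isPreconnected_iff_subset_of_disjoint] at hpb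
  have hsub' : Metric.ball x δ \ {x} ⊆ U \ {x} := sdiff_subset_sdiff_left hball
  have hdisj' : ∀ z ∈ U \ {x}, z ∈ A → z ∉ B := fun z hz ha hb =>
    (hdisj ▸ (⟨hz, ha, hb⟩ : z ∈ (U \ {x}) ∩ (A ∩ B)) : z ∈ (∅ : Set ℂ))
  -- if the punctured disc lies in `A`, then `A ∪ {x}` is open in `U`
  have key : ∀ A B : Set ℂ, IsOpen A → IsOpen B → U \ {x} ⊆ A ∪ B →
      (∀ z ∈ U \ {x}, z ∈ A → z ∉ B) → Metric.ball x δ \ {x} ⊆ A → U \ {x} ⊆ A := by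
    intro A B hA hB hsub hdisj hbA
    have h1 : U ⊆ (A ∪ Metric.ball x δ) ∪ (B \ Metric.closedBall x (δ / 2)) := by
      intro z hz
      by_cases hzx : z ∈ Metric.ball x δ
      · exact Or.inl (Or.inr hzx)
      · have hzne : z ≠ x := by rintro rfl; exact hzx (Metric.mem_ball_self hδ)
        rcases hsub ⟨hz, hzne⟩ with h | h
        · exact Or.inl (Or.inl h)
        · exact Or.inr ⟨h, fun h' => hzx (Metric.closedBall_subset_ball (by linarith) h')⟩
    have h2 := isPreconnected_iff_subset_of_disjoint.1 hc _ _ (hA.union Metric.isOpen_ball)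
      (hB.sdiff Metric.isClosed_closedBall) h1 (by
        ext z
        simp only [mem_inter_iff, mem_empty_iff_false, iff_false]
        rintro ⟨hz, h3, h4, h5⟩
        have hzne : z ≠ x := by
          rintro rfl; exact h5 (Metric.mem_closedBall_self (by linarith))
        rcases h3 with h3 | h3
        · exact hdisj z ⟨hz, hzne⟩ h3 h4
        · exact hdisj z ⟨hz, hzne⟩ (hbA ⟨h3, hzne⟩) h4)
    rcases h2 with h2 | h2
    · rintro z ⟨hz, hzne⟩
      rcases h2 hz with h | h
      · exact h
      · exact hbA ⟨h, hzne⟩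
    · exact absurd (Metric.mem_closedBall_self (by linarith)) (h2 hx).2
  rcases hpb A B hA hB (hsub'.trans hsub) (by
      rw [eq_empty_iff_forall_notMem]
      rintro z ⟨hz, ha, hb⟩
      exact hdisj' z (hsub' hz) ha hb) with h | h
  · exact Or.inl (key A B hA hB hsub hdisj' h)
  · exact Or.inr (key B A hB hA (by rwa [union_comm]) (fun z hz hb ha => hdisj' z hz ha hb) h)

lemma isPreconnected_diff_finite {U S : Set ℂ} (hU : IsOpen U) (hc : IsPreconnected U)
    (hS : S.Finite) : IsPreconnected (U \ S) := by
  induction S, hS using Set.Finite.induction_on with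
  | empty => simpa using hc
  | @insert a s _ hs ih =>
    have : U \ insert a s = (U \ s) \ {a} := by
      ext z; simp only [Set.mem_sdiff, mem_insert_iff, mem_singleton_iff]; tauto
    rw [this]
    exact isPreconnected_diff_singleton (hU.sdiff hs.isClosed) ih a

lemma diff_finite_nonempty {U S : Set ℂ} (hU : IsOpen U) (hne : U.Nonempty) (hS : S.Finite) :
    (U \ S).Nonempty := by
  obtain ⟨x, hx⟩ := hne
  exact ((infinite_of_mem_nhds x (hU.mem_nhds hx)).sdiff hS).nonempty

end PlaneDrawing

end

noncomputable section

open Set Filter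

/-! ### Bounded and unbounded components -/

lemma isConnected_norm_gt (r : ℝ) (hr : 0 < r) : IsConnected {z : ℂ | r < ‖z‖} := by
  have : {z : ℂ | r < ‖z‖} = Complex.exp '' {w | Real.log r < w.re} := by
    ext z
    constructor
    · intro hz
      have h3 : z ≠ 0 := norm_pos_iff.1 (hr.trans hz)
      refine ⟨Complex.log z, ?_, Complex.exp_log h3⟩
      rw [mem_ofPred_eq, Complex.log_re]
      exact Real.log_lt_log hr hz
    · rintro ⟨w, hw, rfl⟩
      rw [mem_ofPred_eq, Complex.norm_exp]
      exact (Real.log_lt_iff_lt_exp hr).1 hw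
  rw [this]
  refine ⟨⟨_, ⟨((Real.log r + 1 : ℝ) : ℂ), by simp, rfl⟩⟩, ?_⟩
  exact (convex_halfSpace_re_gt _).isPreconnected.image _ (by fun_prop)

/-- The complement of a bounded set has exactly one unbounded component. -/
lemma exists_unbounded_component {K : Set ℂ} (hK : Bornology.IsBounded K) :
    ∃ O ∈ planeComponents Kᶜ, ¬ Bornology.IsBounded O ∧
      ∀ F ∈ planeComponents Kᶜ, F ≠ O → Bornology.IsBounded F := by
  obtain ⟨r, hr, hKr⟩ := hK.exists_pos_norm_le
  have hc := isConnected_norm_gt r hr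
  obtain ⟨O, hO, hsub⟩ := planeComponents.exists_superset (U := Kᶜ) hc.2
    (fun z hz hzK => absurd (hKr z hzK) (not_le.2 hz)) hc.1
  refine ⟨O, hO, fun hb => ?_, fun F hF hFO => ?_⟩
  · obtain ⟨s, hs, hOs⟩ := hb.exists_pos_norm_le
    have hn : ‖((r + s : ℝ) : ℂ)‖ = r + s := by
      rw [Complex.norm_real, Real.norm_of_nonneg (by linarith)]
    have h1 : ((r + s : ℝ) : ℂ) ∈ O := hsub (by rw [mem_ofPred_eq, hn]; linarith)
    have := hOs _ h1
    rw [hn] at this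
    linarith
  · refine (Metric.isBounded_closedBall (x := (0 : ℂ)) (r := r)).subset fun z hz => ?_
    rw [mem_closedBall_zero_iff]
    by_contra hcon
    exact hFO (planeComponents.eq_of_mem hF hO hz (hsub (not_le.1 hcon)))

/-! ### Directed cycles -/

section DirectedCycle

variable {E W : Type*} [Fintype E] [DecidableEq E] {tail head : E → W} {c : Equiv.Perm E}

/-- The edges underlying a directed cycle. -/
def cycleEdges (tail head : E → W) (c : Equiv.Perm E) : Set (Sym2 W) :=
  (fun e => s(tail e, head e)) '' (c.support : Set E)

/-- The vertices of a directed cycle. -/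
def cycleVertices (tail : E → W) (c : Equiv.Perm E) : Set W := tail '' (c.support : Set E)

namespace IsDirectedCycle

lemma isCycleOn (hc : IsDirectedCycle tail head c) : c.IsCycleOn (c.support : Set E) := by
  convert hc.1.isCycleOn using 1
  ext e; simp

lemma head_eq (hc : IsDirectedCycle tail head c) {e : E} (he : e ∈ c.support) :
    head e = tail (c e) := hc.2.1 e he

lemma ncard_cycleVertices (hc : IsDirectedCycle tail head c) :
    (cycleVertices tail c).ncard = c.support.card := by
  rw [cycleVertices, hc.2.2.ncard_image, ncard_coe_finset]

lemma head_mem (hc : IsDirectedCycle tail head c) {e : E} (he : e ∈ c.support) :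
    head e ∈ cycleVertices tail c :=
  ⟨c e, by simpa using he, (hc.head_eq he).symm⟩

lemma mem_cycleVertices_of_mem (hc : IsDirectedCycle tail head c) :
    ∀ s ∈ cycleEdges tail head c, ∀ w ∈ s, w ∈ cycleVertices tail c := by
  rintro _ ⟨e, he, rfl⟩ w hw
  rcases Sym2.mem_iff.1 hw with rfl | rfl
  · exact ⟨e, he, rfl⟩
  · exact hc.head_mem he

/-- In a directed cycle of length at least three, different edges are not parallel. -/
lemma injOn_edges (hc : IsDirectedCycle tail head c) (h3 : 3 ≤ c.support.card) :
    Set.InjOn (fun e => s(tail e, head e)) (c.support : Set E) := by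
  intro e he e' he' h
  rcases Sym2.eq_iff.1 h with ⟨h1, -⟩ | ⟨h1, h2⟩
  · exact hc.2.2 he he' h1
  · exfalso
    have hce : c e ∈ (c.support : Set E) := by simpa using he
    have hce' : c e' ∈ (c.support : Set E) := by simpa using he'
    rw [hc.head_eq he'] at h1
    rw [hc.head_eq he] at h2
    have e1 := hc.2.2 he hce' h1
    have e2 := hc.2.2 hce he' h2
    have h4 : (c ^ 2) e = (c ^ 0) e := by
      rw [pow_two, Equiv.Perm.mul_apply, e2, ← e1, pow_zero, Equiv.Perm.one_apply]
    rw [hc.isCycleOn.pow_apply_eq_pow_apply he, Nat.ModEq, Nat.mod_eq_of_lt (by omega),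
      Nat.mod_eq_of_lt (by omega)] at h4
    omega

lemma ncard_cycleEdges (hc : IsDirectedCycle tail head c) (h3 : 3 ≤ c.support.card) :
    (cycleEdges tail head c).ncard = c.support.card := by
  rw [cycleEdges, (hc.injOn_edges h3).ncard_image, ncard_coe_finset]

lemma two_le_card (hc : IsDirectedCycle tail head c) : 2 ≤ c.support.card :=
  hc.1.two_le_card_support

lemma ncard_cycleEdges_of_two (hc : IsDirectedCycle tail head c) (h2 : c.support.card = 2) :
    (cycleEdges tail head c).ncard = 1 := by
  obtain ⟨e, e', hne, hs⟩ := Finset.card_eq_two.1 h2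
  have he : e ∈ c.support := by simp [hs]
  have he' : e' ∈ c.support := by simp [hs]
  have h1 : c e = e' := by
    have : c e ∈ c.support := by simpa using he
    rw [hs] at this
    have hce : c e ≠ e := Equiv.Perm.mem_support.1 he
    simpa [hce] using this
  have h1' : c e' = e := by
    have : c e' ∈ c.support := by simpa using he'
    rw [hs] at this
    have hce : c e' ≠ e' := Equiv.Perm.mem_support.1 he'
    simpa [hce] using this
  rw [ncard_eq_one]
  refine ⟨s(tail e, head e), ?_⟩
  rw [cycleEdges, hs]
  simp only [Finset.coe_insert, Finset.coe_singleton, image_insert_eq, image_singleton,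
    hc.head_eq he, hc.head_eq he', h1, h1']
  rw [Sym2.eq_swap]
  simp

lemma reachable (hc : IsDirectedCycle tail head c) (hne : ∀ e ∈ c.support, tail e ≠ head e) :
    ∀ x ∈ cycleVertices tail c, ∀ y ∈ cycleVertices tail c,
      (SimpleGraph.fromEdgeSet (cycleEdges tail head c)).Reachable x y := by
  rintro _ ⟨e, he, rfl⟩ _ ⟨e', he', rfl⟩
  obtain ⟨n, -, rfl⟩ := hc.isCycleOn.exists_pow_eq he he'
  clear he'
  induction n with
  | zero => exact SimpleGraph.Reachable.refl _
  | succ n ih =>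
    have hn : (c ^ n) e ∈ c.support := by simpa using he
    refine ih.trans (SimpleGraph.Adj.reachable ?_)
    rw [SimpleGraph.fromEdgeSet_adj, pow_succ', Equiv.Perm.mul_apply, ← hc.head_eq hn]
    exact ⟨⟨_, hn, rfl⟩, hne _ hn⟩

lemma sum_head_sub_tail {A : Type*} [AddCommGroup A] (hc : IsDirectedCycle tail head c)
    (f : W → A) : ∑ e ∈ c.support, (f (head e) - f (tail e)) = 0 := by
  rw [Finset.sum_sub_distrib, sub_eq_zero, Finset.sum_congr rfl fun e he => by rw [hc.head_eq he]]
  exact Finset.sum_equiv c (by simp) (by simp)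

end IsDirectedCycle

/-- The walk through the successive values of a sequence of vertices. -/
lemma exists_walk_of_sequence {G : SimpleGraph W} (f : ℕ → W) (hf : ∀ j, G.Adj (f j) (f (j + 1)))
    (m : ℕ) : ∃ p : G.Walk (f 0) (f m), p.support = (List.range (m + 1)).map f ∧
      p.darts = (List.range m).map fun j => ⟨(f j, f (j + 1)), hf j⟩ := by
  induction m with
  | zero => exact ⟨SimpleGraph.Walk.nil, by simp, by simp⟩
  | succ m ih =>
    obtain ⟨p, hp, hd⟩ := ih
    refine ⟨p.concat (hf m), ?_, ?_⟩
    · rw [SimpleGraph.Walk.support_concat, hp, List.range_succ (n := m + 1)]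
      simp
    · rw [SimpleGraph.Walk.darts_concat, hd, List.range_succ (n := m)]
      simp

/-- A directed cycle of length at least three gives rise to a cycle of the simple graph. -/
lemma IsDirectedCycle.exists_walk {G : SimpleGraph W} (D : PlaneDrawing G)
    (hc : IsDirectedCycle tail head c) (h3 : 3 ≤ c.support.card)
    (hadj : ∀ e ∈ c.support, G.Adj (tail e) (head e)) :
    ∃ u ∈ cycleVertices tail c, ∃ p : G.Walk u u, p.IsCycle ∧
      D.walkCarrier p = D.cycleCarrier tail head c := by
  obtain ⟨e₀, he₀⟩ : c.support.Nonempty := Finset.card_pos.1 (by omega)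
  set n := c.support.card with hn
  set f : ℕ → W := fun j => tail ((c ^ j) e₀) with hf
  have hsupp : ∀ j, (c ^ j) e₀ ∈ c.support := fun j => by simpa using he₀
  have hhead : ∀ j, head ((c ^ j) e₀) = f (j + 1) := fun j => by
    rw [hc.head_eq (hsupp j), hf]
    simp only [pow_succ', Equiv.Perm.mul_apply]
  have hfadj : ∀ j, G.Adj (f j) (f (j + 1)) := fun j => by
    rw [← hhead]; exact hadj _ (hsupp j)
  have hfinj : ∀ i < n, ∀ j < n, f i = f j → i = j := by
    intro i hi j hj hij
    have := hc.2.2 (hsupp i) (hsupp j) hij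
    rw [hc.isCycleOn.pow_apply_eq_pow_apply he₀, Nat.ModEq, Nat.mod_eq_of_lt hi,
      Nat.mod_eq_of_lt hj] at this
    exact this
  have hfn : f n = f 0 := by
    have : (c ^ n) e₀ = (c ^ 0) e₀ := by
      rw [hc.isCycleOn.pow_apply_eq_pow_apply he₀, Nat.ModEq]
      simp [hn]
    rw [hf]; simp only [this]
  obtain ⟨p, hp, hd⟩ := exists_walk_of_sequence f hfadj (n - 1)
  have hn1 : n - 1 + 1 = n := by omega
  have hlast : G.Adj (f (n - 1)) (f 0) := by
    have := hfadj (n - 1)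
    rwa [hn1, hfn] at this
  refine ⟨f (n - 1), ⟨_, hsupp _, rfl⟩, SimpleGraph.Walk.cons hlast p, ?_, ?_⟩
  · rw [SimpleGraph.Walk.cons_isCycle_iff]
    constructor
    · rw [SimpleGraph.Walk.isPath_def, hp, hn1]
      refine List.Nodup.map_on ?_ List.nodup_range
      intro i hi j hj hij
      exact hfinj i (List.mem_range.1 hi) j (List.mem_range.1 hj) hij
    · rw [SimpleGraph.Walk.edges, hd, List.map_map]
      simp only [List.mem_map, List.mem_range, not_exists, not_and]
      intro j hj h
      rcases Sym2.eq_iff.1 h with ⟨h1, -⟩ | ⟨h1, h2⟩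
      · have := hfinj j (by omega) (n - 1) (by omega) h1
        omega
      · have e1 := hfinj j (by omega) 0 (by omega) h1
        have e2 := hfinj (j + 1) (by omega) (n - 1) (by omega) h2
        omega
  · ext z
    simp only [PlaneDrawing.walkCarrier, PlaneDrawing.cycleCarrier, SimpleGraph.Walk.darts_cons, hd,
      List.mem_cons, List.mem_map, List.mem_range, mem_ofPred_eq]
    have harc : ∀ j, D.arc (tail ((c ^ j) e₀)) (head ((c ^ j) e₀)) = D.arc (f j) (f (j + 1)) :=
      fun j => by rw [hhead]
    constructor
    · rintro ⟨d, rfl | ⟨j, hj, rfl⟩, hz⟩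
      · refine ⟨_, hsupp (n - 1), ?_⟩
        rw [harc, hn1, hfn]
        exact hz
      · refine ⟨_, hsupp j, ?_⟩
        rw [harc]
        exact hz
    · rintro ⟨e, he, hz⟩
      obtain ⟨j, hj, rfl⟩ := hc.isCycleOn.exists_pow_eq he₀ he
      rw [harc] at hz
      by_cases hjn : j = n - 1
      · subst hjn
        rw [hn1, hfn] at hz
        exact ⟨⟨(f (n - 1), f 0), hlast⟩, Or.inl rfl, hz⟩
      · exact ⟨_, Or.inr ⟨j, by omega, rfl⟩, hz⟩

end DirectedCycle

/-! ### The Jordan curve theorem for directed cycles -/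

namespace PlaneDrawing

section Jordan

variable {E W : Type*} [Fintype E] [DecidableEq E] {tail head : E → W} {c : Equiv.Perm E}
variable {G : SimpleGraph W} {D : PlaneDrawing G}

lemma cycleEdges_subset (hadj : ∀ e ∈ c.support, G.Adj (tail e) (head e)) :
    cycleEdges tail head c ⊆ G.edgeSet := by
  rintro _ ⟨e, he, rfl⟩
  exact hadj e he

lemma cycleCarrier_eq (hadj : ∀ e ∈ c.support, G.Adj (tail e) (head e)) :
    D.cycleCarrier tail head c = D.arcsOn (cycleEdges tail head c) := by
  ext z
  constructor
  · rintro ⟨e, he, hz⟩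
    exact ⟨_, _, ⟨e, he, rfl⟩, hz⟩
  · rintro ⟨u, v, ⟨e, he, huv⟩, hz⟩
    refine ⟨e, he, ?_⟩
    rcases Sym2.eq_iff.1 huv with ⟨h1, h2⟩ | ⟨h1, h2⟩
    · rwa [h1, h2]
    · rw [arc_symm (hadj e he), h1, h2]
      exact hz

/-- The complement of a directed cycle has two components if the cycle has length at least three,
and is connected if it is a doubled edge. -/
lemma ncard_components_cycle [Finite W] (hc : IsDirectedCycle tail head c)
    (hadj : ∀ e ∈ c.support, G.Adj (tail e) (head e)) :
    (planeComponents (D.cycleCarrier tail head c)ᶜ).Finite ∧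
    (planeComponents (D.cycleCarrier tail head c)ᶜ).ncard + c.support.card =
      2 + (cycleEdges tail head c).ncard := by
  obtain ⟨e₀, he₀⟩ : c.support.Nonempty := Finset.card_pos.1 (by have := hc.two_le_card; omega)
  have hT := cycleEdges_subset hadj
  set X := cycleVertices tail c with hX
  have hXfin : (D.pos '' X).Finite := toFinite _
  have hbase : tail e₀ ∈ X := ⟨e₀, he₀, rfl⟩
  -- Euler's formula starting from one vertex and no edge, in the plane without the vertices of the
  -- cycle, which is connected because only finitely many points are removed.
  have h := ncard_components_add_ncard (D := D) (Ω := (D.pos '' X)ᶜ) hXfin.isClosed.isOpen_compl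
    (hXfin.countable.isConnected_compl_of_one_lt_rank (by simp)) (T₀ := ∅)
    (E := cycleEdges tail head c) (X₀ := {tail e₀}) (X₁ := X)
    (fun w hw h => h ⟨w, hw, rfl⟩) (singleton_subset_iff.2 hbase) (empty_subset _) hT
    (empty_disjoint _) (by rw [arcsOn_empty]; exact disjoint_empty _) (by simp)
    (by rintro x rfl y rfl; exact SimpleGraph.Reachable.refl _) hc.mem_cycleVertices_of_mem
    (by
      rintro u v huv z hz ⟨w, -, rfl⟩
      exact pos_notMem_openArc (hT huv) w hz)
    (by
      intro x hx
      refine ⟨_, rfl, ?_⟩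
      rw [empty_union]
      exact hc.reachable (fun e he => (hadj e he).ne) _ hbase _ hx)
    (by
      intro x hx _
      have : IsClosed (D.pos '' (X \ {x})) := (toFinite _).isClosed
      refine Filter.mem_of_superset (this.isOpen_compl.mem_nhds ?_) ?_
      · rintro ⟨y, hy, hyx⟩
        exact hy.2 (D.pos_injective hyx)
      · intro z hz
        by_cases hzx : z = D.pos x
        · exact Or.inl hzx
        · refine Or.inr ?_
          rintro ⟨y, hy, rfl⟩
          exact hz ⟨y, ⟨hy, fun h => hzx (by rw [mem_singleton_iff] at h; rw [h])⟩, rfl⟩)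
  have hset : (D.pos '' X)ᶜ \ D.arcsOn (cycleEdges tail head c) =
      (D.cycleCarrier tail head c)ᶜ := by
    rw [cycleCarrier_eq hadj]
    ext z
    refine ⟨fun h => h.2, fun h => ⟨?_, h⟩⟩
    rintro ⟨w, ⟨e, he, rfl⟩, rfl⟩
    exact h ⟨_, _, ⟨e, he, rfl⟩, pos_left_mem_arc _ _⟩
  rw [hset, hc.ncard_cycleVertices, ncard_singleton] at h
  exact ⟨h.1, by omega⟩

lemma isBounded_cycleCarrier [Finite W] (hadj : ∀ e ∈ c.support, G.Adj (tail e) (head e)) :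
    Bornology.IsBounded (D.cycleCarrier tail head c) := by
  rw [cycleCarrier_eq hadj]
  exact (isCompact_arcsOn _).isBounded

/-- By Euler's formula the complement of a doubled edge has a single component, which must be the
unbounded one. -/
lemma enclosedBy_eq_empty [Finite W] (hc : IsDirectedCycle tail head c)
    (hadj : ∀ e ∈ c.support, G.Adj (tail e) (head e)) (h2 : c.support.card = 2) :
    enclosedBy (D.cycleCarrier tail head c) = ∅ := by
  obtain ⟨hfin, h⟩ := ncard_components_cycle (D := D) hc hadj
  rw [h2, hc.ncard_cycleEdges_of_two h2] at h
  obtain ⟨O, hO, hOb, -⟩ := exists_unbounded_component (isBounded_cycleCarrier (D := D) hadj)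
  obtain ⟨F, hF⟩ := ncard_eq_one.1 (show (planeComponents (D.cycleCarrier tail head c)ᶜ).ncard = 1 by
    omega)
  rw [eq_empty_iff_forall_notMem]
  rintro z ⟨hz, hzb⟩
  have h1 : O = F := by rw [hF] at hO; exact hO
  have h2 : connectedComponentIn (D.cycleCarrier tail head c)ᶜ z = F := by
    have := planeComponents.mem_of_mem (U := (D.cycleCarrier tail head c)ᶜ) hz
    rw [hF] at this
    exact this
  exact hOb (h1 ▸ h2 ▸ hzb)

/-- The two sides of an edge, in a set from which the arcs of the edges in `T` are removed. -/
lemma exists_sides_of_mem [Finite W] {T : Set (Sym2 W)} (hT : T ⊆ G.edgeSet) {u v : W}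
    (huv : s(u, v) ∈ T) {Ω : Set ℂ} (hΩ : IsOpen Ω) (hsub : D.openArc u v ⊆ Ω) :
    ∃ R ∈ planeComponents (Ω \ D.arcsOn T), ∃ L ∈ planeComponents (Ω \ D.arcsOn T),
      RightAlong R (D.corners u v) ∧ LeftAlong L (D.corners u v) := by
  have hadj : G.Adj u v := hT huv
  have hTi : T = insert s(u, v) (T \ {s(u, v)}) := (insert_sdiff_self_of_mem huv).symm
  obtain ⟨R, hR, L, hL, hgR, hgL, -⟩ := exists_sides (D := D) hadj (U := Ω \ D.arcsOn T) (by
    intro y hy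
    have h1 : y ∉ D.arcsOn (T \ {s(u, v)}) := Set.disjoint_left.1
      (openArc_disjoint_arcsOn (sdiff_subset.trans hT) hadj fun h => h.2 (mem_singleton _)) hy
    filter_upwards [(isClosed_arcsOn _).isOpen_compl.mem_nhds h1, hΩ.mem_nhds (hsub hy)]
      with z hz1 hz2 hz3
    refine ⟨hz2, ?_⟩
    rw [hTi, arcsOn_insert hadj]
    exact fun h => h.elim hz3 hz1)
  exact ⟨R, hR, L, hL, hgR, hgL⟩

/-- A directed cycle of length at least three encloses a component `I` of its complement, which lies
to the right of all its edges or to the left of all its edges, the other side belonging to a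
different component. -/
theorem jordan [Finite W] (hc : IsDirectedCycle tail head c) (h3 : 3 ≤ c.support.card)
    (hadj : ∀ e ∈ c.support, G.Adj (tail e) (head e)) :
    ∃ I ∈ planeComponents (D.cycleCarrier tail head c)ᶜ,
    ∃ O ∈ planeComponents (D.cycleCarrier tail head c)ᶜ, I ≠ O ∧
      Bornology.IsBounded I ∧ enclosedBy (D.cycleCarrier tail head c) = I ∧
      ((∀ e ∈ c.support, D.RightOf (tail e) (head e) I ∧ D.RightOf (head e) (tail e) O) ∨
        (∀ e ∈ c.support, D.RightOf (tail e) (head e) O ∧ D.RightOf (head e) (tail e) I)) := by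
  obtain ⟨hfin, hcard⟩ := ncard_components_cycle (D := D) hc hadj
  rw [hc.ncard_cycleEdges h3] at hcard
  set K := D.cycleCarrier tail head c with hK
  have hcard2 : (planeComponents Kᶜ).ncard = 2 := by omega
  have hKT : K = D.arcsOn (cycleEdges tail head c) := cycleCarrier_eq hadj
  have hT := cycleEdges_subset hadj
  obtain ⟨O, hO, hOb, hOu⟩ := exists_unbounded_component (isBounded_cycleCarrier (D := D) hadj)
  rw [← hK] at hO hOu
  obtain ⟨I, hI, hIne⟩ := exists_ne_of_one_lt_ncard (by omega : 1 < (planeComponents Kᶜ).ncard) O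
  have hall : ∀ F ∈ planeComponents Kᶜ, F = I ∨ F = O := by
    intro F hF
    by_contra hcon
    push Not at hcon
    have h1 : ({F, I, O} : Set (Set ℂ)).ncard ≤ 2 := by
      rw [← hcard2]
      refine ncard_le_ncard ?_ hfin
      rintro S (rfl | rfl | rfl)
      exacts [hF, hI, hO]
    rw [ncard_insert_of_notMem (by simp [hcon.1, hcon.2]), ncard_pair hIne] at h1
    omega
  have hencl : enclosedBy K = I := by
    ext z
    constructor
    · rintro ⟨hz, hzb⟩
      have hz' := mem_connectedComponentIn (F := Kᶜ) hz
      rcases hall _ (planeComponents.mem_of_mem (U := Kᶜ) hz) with h | h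
      · rwa [h] at hz'
      · rw [h] at hzb
        exact absurd hzb hOb
    · intro hz
      refine ⟨planeComponents.subset hI hz, ?_⟩
      rw [← planeComponents.eq_connectedComponentIn hI hz]
      exact hOu I hI hIne
  -- the angle swept out by the whole cycle
  set A : ℂ → ℝ := fun z => ∑ e ∈ c.support, sweptAngle z (D.corners (tail e) (head e)) with hA
  have hnot : ∀ z ∈ Kᶜ, ∀ e ∈ c.support, z ∉ D.arc (tail e) (head e) :=
    fun z hz e he h => hz ⟨e, he, h⟩
  have hconst : ∀ F ∈ planeComponents Kᶜ, ∃ a, ∀ z ∈ F, A z = a := by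
    intro F hF
    obtain ⟨z₀, hz₀⟩ := planeComponents.nonempty hF
    refine ⟨A z₀, fun z hz => eq_of_continuousOn_of_coe_eq (planeComponents.isPreconnected hF)
      (fun z hz => ?_) (fun z hz => ?_) hz hz₀⟩
    · refine ContinuousAt.continuousWithinAt ?_
      exact tendsto_finsetSum _ fun e he => (continuousAt_sweptAngle
        (hnot z (planeComponents.subset hF hz) e he) :
          ContinuousAt (fun z => sweptAngle z (D.corners (tail e) (head e))) z)
    · rw [hA]
      have : ((∑ e ∈ c.support, sweptAngle z (D.corners (tail e) (head e)) : ℝ) : Real.Angle) =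
          ∑ e ∈ c.support, (sweptAngle z (D.corners (tail e) (head e)) : Real.Angle) :=
        map_sum Real.Angle.coeHom _ _
      rw [this, Finset.sum_congr rfl fun e he =>
        coe_sweptAngle_corners (hnot z (planeComponents.subset hF hz) e he)]
      exact hc.sum_head_sub_tail fun w => ((Complex.arg (D.pos w - z) : ℝ) : Real.Angle)
  obtain ⟨a, ha⟩ := hconst I hI
  obtain ⟨b, hb⟩ := hconst O hO
  -- Only the summand of `e` jumps across `e`: in a cycle of length at least three the other edges
  -- are drawn elsewhere, and their angles are continuous on the open arc of `e`.
  have hjump : ∀ e ∈ c.support, ∀ R L : Set ℂ, RightAlong R (D.corners (tail e) (head e)) →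
      LeftAlong L (D.corners (tail e) (head e)) → ∀ x y : ℝ, (∀ z ∈ R, A z = x) →
      (∀ z ∈ L, A z = y) → y - x = 2 * Real.pi := by
    intro e he R L hgR hgL x y hx hy
    have hsum : ∀ z, A z = sweptAngle z (D.corners (tail e) (head e)) +
        ∑ e' ∈ c.support.erase e, sweptAngle z (D.corners (tail e') (head e')) :=
      fun z => (Finset.add_sum_erase _ _ he).symm
    refine sweep_jump (hadj e he) (g := fun z => ∑ e' ∈ c.support.erase e,
      sweptAngle z (D.corners (tail e') (head e'))) ?_ hgR hgL
      (fun z hz => by rw [← hsum]; exact hx z hz) (fun z hz => by rw [← hsum]; exact hy z hz)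
    intro z hz
    refine tendsto_finsetSum _ fun e' he' => (continuousAt_sweptAngle ?_ :
          ContinuousAt (fun z => sweptAngle z (D.corners (tail e') (head e'))) z)
    have he'' := Finset.mem_of_mem_erase he'
    refine Set.disjoint_left.1 (openArc_disjoint_arc (hadj e he) (hadj e' he'') fun h => ?_) hz
    exact (Finset.ne_of_mem_erase he') (hc.injOn_edges h3 he he'' h).symm
  have hside : ∀ e ∈ c.support,
      (RightAlong I (D.corners (tail e) (head e)) ∧ LeftAlong O (D.corners (tail e) (head e)) ∧
        b - a = 2 * Real.pi) ∨
      (RightAlong O (D.corners (tail e) (head e)) ∧ LeftAlong I (D.corners (tail e) (head e)) ∧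
        a - b = 2 * Real.pi) := by
    intro e he
    obtain ⟨R, hR, L, hL, hgR, hgL⟩ := exists_sides_of_mem (D := D) hT
      (⟨e, he, rfl⟩ : s(tail e, head e) ∈ cycleEdges tail head c) isOpen_univ (subset_univ _)
    rw [← compl_eq_univ_sdiff, ← hKT] at hR hL
    have hpi := Real.two_pi_pos
    -- Equal components on the two sides would give a jump of `0`.
    rcases hall R hR with rfl | rfl <;> rcases hall L hL with rfl | rfl
    · have := hjump e he _ _ hgR hgL _ _ ha ha
      linarith
    · exact Or.inl ⟨hgR, hgL, hjump e he _ _ hgR hgL _ _ ha hb⟩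
    · exact Or.inr ⟨hgR, hgL, hjump e he _ _ hgR hgL _ _ hb ha⟩
    · have := hjump e he _ _ hgR hgL _ _ hb hb
      linarith
  refine ⟨I, hI, O, hO, hIne, hOu I hI hIne, hencl, ?_⟩
  obtain ⟨e₀, he₀⟩ : c.support.Nonempty := Finset.card_pos.1 (by omega)
  have hpi := Real.two_pi_pos
  -- The sign of `b - a` tells on which side `I` lies and does not depend on the edge, so `I` is on
  -- the same side of all edges.
  rcases hside e₀ he₀ with ⟨-, -, h0⟩ | ⟨-, -, h0⟩
  · refine Or.inl fun e he => ?_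
    rcases hside e he with ⟨h1, h2, -⟩ | ⟨-, -, h1⟩
    · exact ⟨rightOf_of_rightAlong h1, rightOf_of_leftAlong (hadj e he) h2⟩
    · linarith
  · refine Or.inr fun e he => ?_
    rcases hside e he with ⟨-, -, h1⟩ | ⟨h1, h2, -⟩
    · linarith
    · exact ⟨rightOf_of_rightAlong h1, rightOf_of_leftAlong (hadj e he) h2⟩

end Jordan

end PlaneDrawing

end

/-! ### Faces inside a cycle and Kasteleyn's lemma -/

noncomputable section

open Set Filter

open Classical in
/-- The sign of traversing the edge `uv` from `u` to `v`: positive if it is oriented that way. -/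
def GraphOrientation.sign {V : Type*} {G : SimpleGraph V} (O : GraphOrientation G) (u v : V) : ℤ :=
  if O.arrow u v then 1 else -1

namespace PlaneDrawing

section Interior

variable {W : Type*} {G : SimpleGraph W} {D : PlaneDrawing G} {u v : W}

lemma pos_mem_closure_openArc (h : G.Adj u v) : D.pos u ∈ closure (D.openArc u v) := by
  obtain ⟨q, l, hc, hl⟩ := D.exists_corners_eq u v
  have harc := D.isPolygonalArc_corners h
  rw [hc] at harc
  refine closure_mono ?_ (segment_subset_closure_openSegment (left_mem_segment ℝ (D.pos u) q))
  intro z hz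
  have hz' := openSegment_subset_segment _ _ _ hz
  refine ⟨?_, ?_⟩
  · rw [arc, hc]; exact Or.inl hz'
  · rintro (rfl | hzv)
    · exact harc.1 (left_mem_openSegment_iff.1 hz)
    · have : z ∈ segment ℝ (D.pos u) q ∩ polylineCarrier (q :: l) := ⟨hz', by
        rw [hzv, ← hl]; exact mem_polylineCarrier_of_mem (List.getLast_mem _)⟩
      rw [harc.2.1] at this
      rw [mem_singleton_iff] at this
      subst this
      exact harc.1 (right_mem_openSegment_iff.1 hz)

/-- The edges that are drawn inside `I`. -/
def edgesIn (D : PlaneDrawing G) (I : Set ℂ) : Set (Sym2 W) :=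
  {e | ∃ u v, e = s(u, v) ∧ G.Adj u v ∧ D.openArc u v ⊆ I}

lemma mk_mem_edgesIn {I : Set ℂ} : s(u, v) ∈ D.edgesIn I ↔ G.Adj u v ∧ D.openArc u v ⊆ I := by
  constructor
  · rintro ⟨a, b, hab, hadj, hsub⟩
    rcases Sym2.eq_iff.1 hab with ⟨rfl, rfl⟩ | ⟨rfl, rfl⟩
    · exact ⟨hadj, hsub⟩
    · exact ⟨hadj.symm, by rwa [openArc_symm hadj.symm]⟩
  · rintro ⟨h1, h2⟩
    exact ⟨u, v, rfl, h1, h2⟩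

lemma edgesIn_subset (I : Set ℂ) : D.edgesIn I ⊆ G.edgeSet := by
  rintro _ ⟨u, v, rfl, h, -⟩
  exact h

variable {T : Set (Sym2 W)} {I : Set ℂ}

lemma openArc_subset_component (hT : T ⊆ G.edgeSet) (hI : I ∈ planeComponents (D.arcsOn T)ᶜ)
    (h : G.Adj u v) (hne : s(u, v) ∉ T) (hmeet : (D.openArc u v ∩ I).Nonempty) :
    D.openArc u v ⊆ I := by
  obtain ⟨z, hz, hzI⟩ := hmeet
  exact planeComponents.subset_of_isPreconnected hI (isPreconnected_openArc h)
    (fun y hy => Set.disjoint_left.1 (openArc_disjoint_arcsOn hT h hne) hy) hz hzI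

lemma openArc_subset_component_of_pos [Finite W] (hT : T ⊆ G.edgeSet)
    (hI : I ∈ planeComponents (D.arcsOn T)ᶜ) (h : G.Adj u v) (hu : D.pos u ∈ I) :
    D.openArc u v ⊆ I := by
  have huT := planeComponents.subset hI hu
  have hIo := planeComponents.isOpen (isClosed_arcsOn T).isOpen_compl hI
  refine openArc_subset_component hT hI h (fun hmem => huT (arc_subset_arcsOn hmem
    (pos_left_mem_arc _ _))) ?_
  rw [inter_comm]
  exact mem_closure_iff.1 (pos_mem_closure_openArc h) I hIo hu

/-- The vertex is a limit of points of an open arc inside `I`, so the open component that contains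
the vertex meets `I`. -/
lemma pos_mem_of_mem_edgesIn [Finite W]
    (hI : I ∈ planeComponents (D.arcsOn T)ᶜ) {e : Sym2 W} (he : e ∈ D.edgesIn I) {w : W}
    (hw : w ∈ e) (hwT : D.pos w ∉ D.arcsOn T) : D.pos w ∈ I := by
  obtain ⟨v, rfl⟩ := hw
  obtain ⟨hadj, hsub⟩ := mk_mem_edgesIn.1 he
  have hG := planeComponents.mem_of_mem (U := (D.arcsOn T)ᶜ) hwT
  have hGo := planeComponents.isOpen (isClosed_arcsOn T).isOpen_compl hG
  have hmem := mem_connectedComponentIn (F := (D.arcsOn T)ᶜ) hwT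
  obtain ⟨z, hz1, hz2⟩ := mem_closure_iff.1 (pos_mem_closure_openArc hadj) _ hGo hmem
  rw [planeComponents.eq_of_mem hI hG (hsub hz2) hz1]
  exact hmem

/-- The faces inside a component `I` of the complement of some of the arcs. -/
lemma components_inside [Finite W] (hT : T ⊆ G.edgeSet) (hI : I ∈ planeComponents (D.arcsOn T)ᶜ) :
    planeComponents ((I \ range D.pos) \ D.arcsOn (D.edgesIn I)) =
      {F ∈ planeComponents D.carrierᶜ | F ⊆ I} := by
  have hIT := planeComponents.subset hI
  have hset : (I \ range D.pos) \ D.arcsOn (D.edgesIn I) = I ∩ D.carrierᶜ := by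
    ext z
    rw [carrier_eq]
    constructor
    · rintro ⟨⟨hzI, hzp⟩, hzE⟩
      refine ⟨hzI, ?_⟩
      rintro (h | ⟨u, v, huv, hz⟩)
      · exact hzp h
      · have hzo : z ∈ D.openArc u v := ⟨hz, by
          rintro (rfl | h)
          · exact hzp ⟨_, rfl⟩
          · exact hzp ⟨v, by rw [mem_singleton_iff] at h; rw [h]⟩⟩
        refine hzE ⟨u, v, mk_mem_edgesIn.2 ⟨huv, ?_⟩, hz⟩
        exact openArc_subset_component hT hI huv
          (fun h => hIT hzI (arc_subset_arcsOn h hz)) ⟨z, hzo, hzI⟩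
    · rintro ⟨hzI, hz⟩
      exact ⟨⟨hzI, fun h => hz (Or.inl h)⟩, fun h => hz (Or.inr (arcsOn_mono (edgesIn_subset I) h))⟩
  have hcarr : D.carrierᶜ ⊆ (D.arcsOn T)ᶜ := by
    rw [carrier_eq, compl_subset_compl]
    exact (arcsOn_mono hT).trans subset_union_right
  rw [hset]
  have key : ∀ z ∈ I ∩ D.carrierᶜ,
      connectedComponentIn (I ∩ D.carrierᶜ) z = connectedComponentIn D.carrierᶜ z := by
    intro z hz
    refine subset_antisymm (connectedComponentIn_mono z inter_subset_right) ?_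
    have hmem := mem_connectedComponentIn (F := D.carrierᶜ) hz.2
    have hpre := isPreconnected_connectedComponentIn (x := z) (F := D.carrierᶜ)
    have hsub := connectedComponentIn_subset D.carrierᶜ z
    exact hpre.subset_connectedComponentIn hmem (subset_inter
      (planeComponents.subset_of_isPreconnected hI hpre (hsub.trans hcarr) hmem hz.1) hsub)
  ext F
  constructor
  · rintro ⟨z, hz, rfl⟩
    refine ⟨⟨z, hz.2, key z hz⟩, ?_⟩
    exact (connectedComponentIn_subset _ _).trans inter_subset_left
  · rintro ⟨⟨z, hz, rfl⟩, hFI⟩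
    have hzI := hFI (mem_connectedComponentIn hz)
    exact ⟨z, ⟨hzI, hz⟩, (key z ⟨hzI, hz⟩).symm⟩

end Interior

open Classical in
lemma prod_sign_eq {E W : Type*} {tail head : E → W} {G : SimpleGraph W} (s : Finset E)
    (O : GraphOrientation G) :
    ∏ e ∈ s, O.sign (tail e) (head e) = (-1) ^ {e ∈ s | ¬ O.arrow (tail e) (head e)}.card := by
  unfold GraphOrientation.sign
  refine (Finset.prod_ite _ _).trans ?_
  rw [Finset.prod_const_one, one_mul, Finset.prod_const]

section Kasteleyn

variable {E W : Type*} [Fintype E] [DecidableEq E] {tail head : E → W} {c : Equiv.Perm E}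
variable {G : SimpleGraph W} {D : PlaneDrawing G}

lemma pos_mem_cycleCarrier_iff (hc : IsDirectedCycle tail head c)
    (hadj : ∀ e ∈ c.support, G.Adj (tail e) (head e)) {w : W} :
    D.pos w ∈ D.arcsOn (cycleEdges tail head c) ↔ w ∈ cycleVertices tail c := by
  rw [pos_mem_arcsOn_iff (cycleEdges_subset hadj)]
  constructor
  · rintro ⟨e, he, hw⟩
    exact hc.mem_cycleVertices_of_mem e he w hw
  · rintro ⟨e, he, rfl⟩
    exact ⟨_, ⟨e, he, rfl⟩, Sym2.mem_mk_left _ _⟩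

/-- Euler's formula inside a directed cycle: the numbers of faces, edges and vertices inside. -/
theorem ncard_faces_inside [Finite W] (hD : D.NoNestedComponents)
    (hc : IsDirectedCycle tail head c) (h3 : 3 ≤ c.support.card)
    (hadj : ∀ e ∈ c.support, G.Adj (tail e) (head e)) {I : Set ℂ}
    (hI : I ∈ planeComponents (D.cycleCarrier tail head c)ᶜ)
    (hencl : enclosedBy (D.cycleCarrier tail head c) = I) :
    {F ∈ planeComponents D.carrierᶜ | F ⊆ I}.Finite ∧
    {F ∈ planeComponents D.carrierᶜ | F ⊆ I}.ncard + {w | D.pos w ∈ I}.ncard =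
      1 + (D.edgesIn I).ncard := by
  obtain ⟨u, hu, p, hp, hpc⟩ := hc.exists_walk D h3 hadj
  -- This is where nested components are excluded: Euler's formula needs the enclosed vertices to be
  -- connected to the cycle.
  have hnest : ∀ w, D.pos w ∈ I → G.Reachable u w := fun w hw =>
    hD u p hp w (by rw [hpc, hencl]; exact hw)
  have hT := cycleEdges_subset hadj
  rw [cycleCarrier_eq hadj] at hI
  set T := cycleEdges tail head c with hTdef
  set X := cycleVertices tail c with hX
  have hIT := planeComponents.subset hI
  have hIo := planeComponents.isOpen (isClosed_arcsOn T).isOpen_compl hI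
  have hIX : ∀ w, D.pos w ∈ I → w ∉ X := fun w hw hwX =>
    hIT hw ((pos_mem_cycleCarrier_iff hc hadj).2 hwX)
  have hposfin : (range D.pos).Finite := finite_range _
  have hEX : ∀ e ∈ D.edgesIn I, ∀ w ∈ e, w ∈ X ∪ {w | D.pos w ∈ I} := by
    intro e he w hw
    by_cases hwX : w ∈ X
    · exact Or.inl hwX
    · exact Or.inr (pos_mem_of_mem_edgesIn hI he hw
        (fun h => hwX ((pos_mem_cycleCarrier_iff hc hadj).1 h)))
  -- Up to its first vertex on the cycle, a walk that starts inside uses only edges drawn inside.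
  have hreach : ∀ a b, G.Walk a b → a ∈ X ∪ {w | D.pos w ∈ I} → b ∈ X →
      ∃ x₀ ∈ X, (SimpleGraph.fromEdgeSet (T ∪ D.edgesIn I)).Reachable x₀ a := by
    intro a b q
    induction q with
    | nil => exact fun _ hb => ⟨_, hb, SimpleGraph.Reachable.refl _⟩
    | @cons a a' b haa' q ih =>
      intro ha hb
      rcases ha with ha | ha
      · exact ⟨a, ha, SimpleGraph.Reachable.refl _⟩
      · have hmem : s(a, a') ∈ D.edgesIn I :=
          mk_mem_edgesIn.2 ⟨haa', openArc_subset_component_of_pos hT hI haa' ha⟩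
        obtain ⟨x₀, hx₀, hr⟩ := ih (hEX _ hmem _ (Sym2.mem_mk_right _ _)) hb
        refine ⟨x₀, hx₀, hr.trans (SimpleGraph.Adj.reachable ?_)⟩
        rw [SimpleGraph.fromEdgeSet_adj, Sym2.eq_swap]
        exact ⟨Or.inr hmem, haa'.ne'⟩
  -- The starting graph is the cycle itself and `Ω` is its inside without the vertices of the graph.
  -- The number of vertices of the cycle cancels from the formula.
  have h := ncard_components_add_ncard (D := D) (Ω := I \ range D.pos)
    (hIo.sdiff hposfin.isClosed)
    ⟨diff_finite_nonempty hIo (planeComponents.nonempty hI) hposfin,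
      isPreconnected_diff_finite hIo (planeComponents.isPreconnected hI) hposfin⟩
    (T₀ := T) (E := D.edgesIn I) (X₀ := X) (X₁ := X ∪ {w | D.pos w ∈ I})
    (fun w _ h => h.2 ⟨w, rfl⟩) subset_union_left hT (edgesIn_subset I)
    (by
      rw [Set.disjoint_left]
      intro e he he'
      induction e with
      | h a b =>
        obtain ⟨hab, hsub⟩ := mk_mem_edgesIn.1 he'
        obtain ⟨z, hz⟩ := D.openArc_nonempty hab
        exact hIT (hsub hz) (arc_subset_arcsOn he hz.1))
    (by
      rw [Set.disjoint_left]
      exact fun z hz => hIT hz.1)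
    hc.mem_cycleVertices_of_mem (hc.reachable fun e he => (hadj e he).ne) hEX
    (by
      rintro a b hab z hz
      obtain ⟨hab, hsub⟩ := mk_mem_edgesIn.1 hab
      refine ⟨hsub hz, ?_⟩
      rintro ⟨w, rfl⟩
      exact pos_notMem_openArc hab w hz)
    (by
      rintro x hx
      obtain ⟨q⟩ : G.Reachable x u := by
        rcases hx with hx | hx
        · refine (hc.reachable (fun e he => (hadj e he).ne) x hx u hu).mono ?_
          intro a b hab
          rw [SimpleGraph.fromEdgeSet_adj] at hab
          exact hT hab.1
        · exact (hnest x hx).symm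
      exact hreach x u q hx hu)
    (by
      intro x hx hxX
      have hxI : D.pos x ∈ I := hx.resolve_left hxX
      have : IsClosed (range D.pos \ {D.pos x}) := (hposfin.subset sdiff_subset).isClosed
      filter_upwards [hIo.mem_nhds hxI, this.isOpen_compl.mem_nhds (fun h => h.2 rfl)]
        with z hz1 hz2
      by_cases hzx : z = D.pos x
      · exact Or.inl hzx
      · exact Or.inr ⟨hz1, fun h => hz2 ⟨h, hzx⟩⟩)
  rw [components_inside hT hI, ncard_union_eq (by
    rw [Set.disjoint_left]; exact fun w hw hw' => hIX w hw' hw)] at h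
  exact ⟨h.1, by omega⟩

/-- Kasteleyn's lemma: in a Pfaffian orientation, the number of clockwise edges of a cycle has the
opposite parity to the number of vertices that it encloses. -/
theorem even_clockwise_add [Finite W] (hD : D.NoNestedComponents) {O : GraphOrientation G}
    (hO : D.IsPfaffian O) (hc : IsDirectedCycle tail head c) (h3 : 3 ≤ c.support.card)
    (hadj : ∀ e ∈ c.support, G.Adj (tail e) (head e)) {I : Set ℂ}
    (hI : I ∈ planeComponents (D.cycleCarrier tail head c)ᶜ)
    (hencl : enclosedBy (D.cycleCarrier tail head c) = I) (hIb : Bornology.IsBounded I) :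
    Even ({p : W × W | O.arrow p.1 p.2 ∧ s(p.1, p.2) ∈ cycleEdges tail head c ∧
      D.RightOf p.1 p.2 I}.ncard + {w | D.pos w ∈ I}.ncard + 1) := by
  obtain ⟨hfin, hcard⟩ := ncard_faces_inside hD hc h3 hadj hI hencl
  have hT := cycleEdges_subset hadj
  rw [cycleCarrier_eq hadj] at hI
  set T := cycleEdges tail head c with hTdef
  have hIT := planeComponents.subset hI
  have hIo := planeComponents.isOpen (isClosed_arcsOn T).isOpen_compl hI
  set 𝓕 := {F ∈ planeComponents D.carrierᶜ | F ⊆ I} with h𝓕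
  set N : Set ℂ → Set (W × W) := fun F => {p | O.arrow p.1 p.2 ∧ D.RightOf p.1 p.2 F} with hN
  have hodd : ∀ F ∈ 𝓕, Odd (N F).ncard := by
    rintro F ⟨⟨z, hz, hF⟩, hFI⟩
    exact hO F ⟨z, hz, hF⟩ (hIb.subset hFI)
  have hposfin : (range D.pos).Finite := finite_range _
  -- every edge has a face to its right
  have hright : ∀ u v, G.Adj u v → ∃ F ∈ planeComponents D.carrierᶜ, D.RightOf u v F := by
    intro u v huv
    obtain ⟨R, hR, -, -, hgR, -⟩ := exists_sides_of_mem (D := D) (Ω := (range D.pos)ᶜ) subset_rfl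
      (T := G.edgeSet) huv hposfin.isClosed.isOpen_compl (by
        rintro z hz ⟨w, rfl⟩
        exact pos_notMem_openArc huv w hz)
    refine ⟨R, ?_, rightOf_of_rightAlong hgR⟩
    rw [carrier_eq, compl_union]
    exact hR
  have hcarr : D.carrierᶜ ⊆ (D.arcsOn T)ᶜ := by
    rw [carrier_eq, compl_subset_compl]
    exact (arcsOn_mono hT).trans subset_union_right
  have hsubI : ∀ F ∈ planeComponents D.carrierᶜ, (F ∩ I).Nonempty → F ∈ 𝓕 := by
    rintro F hF ⟨z, hzF, hzI⟩
    exact ⟨hF, planeComponents.subset_of_isPreconnected hI (planeComponents.isPreconnected hF)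
      ((planeComponents.subset hF).trans hcarr) hzF hzI⟩
  -- double counting
  have hunion : (⋃ F ∈ 𝓕, N F) = {p : W × W | O.arrow p.1 p.2 ∧ s(p.1, p.2) ∈ D.edgesIn I} ∪
      {p : W × W | O.arrow p.1 p.2 ∧ s(p.1, p.2) ∈ T ∧ D.RightOf p.1 p.2 I} := by
    ext p
    simp only [mem_iUnion, exists_prop]
    constructor
    · rintro ⟨F, hF, hp, hpF⟩
      have hadjp := O.adj_of_arrow _ _ hp
      by_cases hpT : s(p.1, p.2) ∈ T
      · exact Or.inr ⟨hp, hpT, hpF.mono hF.2⟩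
      · refine Or.inl ⟨hp, mk_mem_edgesIn.2 ⟨hadjp, ?_⟩⟩
        obtain ⟨Q, hQ, hsub⟩ := planeComponents.exists_superset (D.isPreconnected_openArc hadjp)
          (subset_compl_iff_disjoint_right.2 (openArc_disjoint_arcsOn hT hadjp hpT))
          (D.openArc_nonempty hadjp)
        obtain ⟨z, hzF, hz⟩ := hpF.inter_nonempty hadjp
          (planeComponents.isOpen (isClosed_arcsOn T).isOpen_compl hQ) hsub
        rwa [planeComponents.eq_of_mem hI hQ (hF.2 hzF) hz]
    · rintro (⟨hp, hpE⟩ | ⟨hp, -, hpI⟩)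
      · obtain ⟨hadjp, hsub⟩ := mk_mem_edgesIn.1 hpE
        obtain ⟨F, hF, hpF⟩ := hright _ _ hadjp
        exact ⟨F, hsubI F hF (hpF.inter_nonempty hadjp hIo hsub), hp, hpF⟩
      · obtain ⟨F, hF, hpF⟩ := hright _ _ (O.adj_of_arrow _ _ hp)
        exact ⟨F, hsubI F hF (hpF.inter hpI), hp, hpF⟩
  -- An edge carries exactly one arrow, so each inner edge is counted once.
  have hE : {p : W × W | O.arrow p.1 p.2 ∧ s(p.1, p.2) ∈ D.edgesIn I}.ncard =
      (D.edgesIn I).ncard := by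
    refine ncard_congr (fun p _ => s(p.1, p.2)) (fun p hp => hp.2) ?_ ?_
    · rintro ⟨a, b⟩ ⟨a', b'⟩ ⟨h1, -⟩ ⟨h2, -⟩ h
      rcases Sym2.eq_iff.1 h with ⟨h3, h4⟩ | ⟨h3, h4⟩
      · exact Prod.ext h3 h4
      · dsimp only at h1 h2 h3 h4
        subst h3 h4
        exact absurd h2 (O.asymm _ _ h1)
    · intro e he
      induction e with
      | h a b =>
        rcases O.arrow_or_arrow a b (mk_mem_edgesIn.1 he).1 with h | h
        · exact ⟨(a, b), ⟨h, he⟩, rfl⟩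
        · exact ⟨(b, a), ⟨h, by rwa [Sym2.eq_swap]⟩, Sym2.eq_swap⟩
  have hdisjEI : Disjoint {p : W × W | O.arrow p.1 p.2 ∧ s(p.1, p.2) ∈ D.edgesIn I}
      {p : W × W | O.arrow p.1 p.2 ∧ s(p.1, p.2) ∈ T ∧ D.RightOf p.1 p.2 I} := by
    rw [Set.disjoint_left]
    rintro p ⟨-, hp⟩ ⟨-, hpT, -⟩
    obtain ⟨hab, hsub⟩ := mk_mem_edgesIn.1 hp
    obtain ⟨z, hz⟩ := D.openArc_nonempty hab
    exact hIT (hsub hz) (arc_subset_arcsOn hpT hz.1)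
  have hsum : (⋃ F ∈ 𝓕, N F).ncard = ∑ F ∈ hfin.toFinset, (N F).ncard := by
    classical
    have hbi : (⋃ F ∈ 𝓕, N F) =
        ((hfin.toFinset.biUnion fun F => (toFinite (N F)).toFinset : Finset (W × W)) :
          Set (W × W)) := by
      ext p; simp
    rw [hbi, ncard_coe_finset, Finset.card_biUnion]
    · exact Finset.sum_congr rfl fun F _ => (ncard_eq_toFinset_card _ _).symm
    · intro F hF F' hF' hne
      rw [Function.onFun, Finset.disjoint_left]
      intro p hp hp'
      rw [Set.Finite.mem_toFinset] at hp hp'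
      obtain ⟨z, hz, hz'⟩ := hp.2.inter hp'.2
      have h1 := (hfin.mem_toFinset.1 hF).1
      have h2 := (hfin.mem_toFinset.1 hF').1
      exact hne (planeComponents.eq_of_mem h1 h2 hz hz')
  rw [hunion, ncard_union_eq hdisjEI, hE] at hsum
  -- Every face inside contributes an odd number. With `f` faces, `v` vertices and `e` edges inside,
  -- and `m` clockwise edges on the cycle, the double count gives `f ≡ e + m` modulo 2, and Euler's
  -- formula `f + v = 1 + e` makes `m + v + 1` even.
  have hpar : (∑ F ∈ hfin.toFinset, (N F).ncard) % 2 = 𝓕.ncard % 2 := by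
    rw [Finset.sum_nat_mod, Finset.sum_congr rfl (g := fun _ => 1) fun F hF =>
      Nat.odd_iff.1 (hodd F (hfin.mem_toFinset.1 hF)), Finset.sum_const, smul_eq_mul, mul_one,
      ncard_eq_toFinset_card _ hfin]
  rw [Nat.even_iff]
  omega

lemma sign_mul_sign_swap {O : GraphOrientation G} {u v : W} (h : G.Adj u v) :
    O.sign u v * O.sign v u = -1 := by
  unfold GraphOrientation.sign
  rcases O.arrow_or_arrow u v h with h | h
  · rw [if_pos h, if_neg (O.asymm _ _ h)]; rfl
  · rw [if_pos h, if_neg (O.asymm _ _ h)]; rfl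

open Classical in
/-- The product of the orientation signs along a directed cycle of a Pfaffian plane graph. -/
theorem prod_sign_cycle [Finite W] (hD : D.NoNestedComponents) {O : GraphOrientation G}
    (hO : D.IsPfaffian O) (hc : IsDirectedCycle tail head c)
    (hadj : ∀ e ∈ c.support, G.Adj (tail e) (head e)) :
    ∏ e ∈ c.support, O.sign (tail e) (head e) =
      if Odd c.support.card ∧ D.IsClockwise tail head c then
        (-1) ^ D.enclosedCount tail head c
      else (-1) ^ (D.enclosedCount tail head c + 1) := by
  have h2 := hc.two_le_card
  rcases h2.eq_or_lt with h2 | h3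
  -- A doubled edge encloses nothing and is traversed once in each direction, so the product is
  -- `-1`.
  · rw [if_neg (by rw [← h2]; rintro ⟨h, -⟩; exact absurd h (by decide)), enclosedCount,
      enclosedBy_eq_empty hc hadj h2.symm]
    obtain ⟨e, e', hne, hs⟩ := Finset.card_eq_two.1 h2.symm
    have he : e ∈ c.support := by simp [hs]
    have he' : e' ∈ c.support := by simp [hs]
    have h1 : c e = e' := by
      have : c e ∈ c.support := by simpa using he
      rw [hs] at this
      have hce : c e ≠ e := Equiv.Perm.mem_support.1 he
      simpa [hce] using this
    have h1' : c e' = e := by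
      have : c e' ∈ c.support := by simpa using he'
      rw [hs] at this
      have hce : c e' ≠ e' := Equiv.Perm.mem_support.1 he'
      simpa [hce] using this
    rw [hs, Finset.prod_pair hne, hc.head_eq he, hc.head_eq he', h1, h1', sign_mul_sign_swap]
    · simp
    · have := hadj e he
      rwa [hc.head_eq he, h1] at this
  · obtain ⟨I, hI, U, hU, hIU, hIb, hencl, hside⟩ := jordan (D := D) hc h3 hadj
    have heven := even_clockwise_add hD hO hc h3 hadj hI hencl hIb
    have hexcl : ∀ u v, D.RightOf u v I → ¬ D.RightOf u v U := by
      intro u v h1 h2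
      obtain ⟨z, hz, hz'⟩ := h1.inter h2
      exact hIU (planeComponents.eq_of_mem hI hU hz hz')
    have hcount : D.enclosedCount tail head c = {w | D.pos w ∈ I}.ncard := by
      rw [enclosedCount, hencl]
    rw [hcount, prod_sign_eq]
    have hsplit : {e ∈ c.support | O.arrow (tail e) (head e)}.card +
        {e ∈ c.support | ¬ O.arrow (tail e) (head e)}.card = c.support.card :=
      Finset.card_filter_add_card_filter_not _
    obtain ⟨e₀, he₀⟩ : c.support.Nonempty := Finset.card_pos.1 (by omega)
    rcases hside with hside | hside
    -- Traversed clockwise, the cycle has as clockwise edges those oriented along it, `χ + 1` in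
    -- number modulo 2. The product counts the others, hence the role of the parity of the length.
    · have hclock : D.IsClockwise tail head c := fun e he => by
        rw [hencl]; exact (hside e he).1
      have hset : {p : W × W | O.arrow p.1 p.2 ∧ s(p.1, p.2) ∈ cycleEdges tail head c ∧
          D.RightOf p.1 p.2 I} = (fun e => (tail e, head e)) ''
            ({e ∈ c.support | O.arrow (tail e) (head e)} : Finset E) := by
        ext ⟨a, b⟩
        constructor
        · rintro ⟨harr, ⟨e, he, hab⟩, hr⟩
          rcases Sym2.eq_iff.1 hab with ⟨rfl, rfl⟩ | ⟨rfl, rfl⟩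
          · exact ⟨e, by simpa using ⟨by simpa using he, harr⟩, rfl⟩
          · exact absurd (hside e he).2 (hexcl _ _ hr)
        · rintro ⟨e, he, h⟩
          obtain ⟨rfl, rfl⟩ := Prod.ext_iff.1 h
          have he' := Finset.mem_filter.1 he
          exact ⟨he'.2, ⟨e, he'.1, rfl⟩, (hside e he'.1).1⟩
      have hcardset := congrArg ncard hset
      rw [InjOn.ncard_image, ncard_coe_finset] at hcardset
      swap
      · intro e he e' he' h
        exact hc.2.2 (Finset.mem_filter.1 he).1 (Finset.mem_filter.1 he').1 (Prod.ext_iff.1 h).1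
      rw [hcardset] at heven
      by_cases hodd : Odd c.support.card
      · rw [if_pos ⟨hodd, hclock⟩]
        refine neg_one_pow_congr ?_
        rw [Nat.odd_iff] at hodd
        rw [Nat.even_iff] at heven ⊢
        rw [Nat.even_iff]
        omega
      · rw [if_neg (fun h => hodd h.1)]
        refine neg_one_pow_congr ?_
        rw [Nat.odd_iff] at hodd
        rw [Nat.even_iff] at heven ⊢
        rw [Nat.even_iff]
        omega
    -- Traversed anticlockwise, the edges oriented against the traversal are themselves the
    -- clockwise ones, so the parity of the length plays no part.
    · have hclock : ¬ D.IsClockwise tail head c := fun h => by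
        have := h e₀ he₀
        rw [hencl] at this
        exact hexcl _ _ this (hside e₀ he₀).1
      rw [if_neg (fun h => hclock h.2)]
      have hset : {p : W × W | O.arrow p.1 p.2 ∧ s(p.1, p.2) ∈ cycleEdges tail head c ∧
          D.RightOf p.1 p.2 I} = (fun e => (head e, tail e)) ''
            ({e ∈ c.support | ¬ O.arrow (tail e) (head e)} : Finset E) := by
        ext ⟨a, b⟩
        constructor
        · rintro ⟨harr, ⟨e, he, hab⟩, hr⟩
          rcases Sym2.eq_iff.1 hab with ⟨rfl, rfl⟩ | ⟨rfl, rfl⟩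
          · exact absurd (hside e he).1 (hexcl _ _ hr)
          · exact ⟨e, by simpa using ⟨by simpa using he, O.asymm _ _ harr⟩, rfl⟩
        · rintro ⟨e, he, h⟩
          obtain ⟨rfl, rfl⟩ := Prod.ext_iff.1 h
          have he' := Finset.mem_filter.1 he
          exact ⟨(O.arrow_or_arrow _ _ (hadj e he'.1)).resolve_left he'.2,
            ⟨e, he'.1, Sym2.eq_swap⟩, (hside e he'.1).2⟩
      have hcardset := congrArg ncard hset
      rw [InjOn.ncard_image, ncard_coe_finset] at hcardset
      swap
      · intro e he e' he' h
        exact hc.2.2 (Finset.mem_filter.1 he).1 (Finset.mem_filter.1 he').1 (Prod.ext_iff.1 h).2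
      rw [hcardset] at heven
      refine neg_one_pow_congr ?_
      rw [Nat.even_iff] at heven ⊢
      rw [Nat.even_iff]
      omega

end Kasteleyn

end PlaneDrawing

end

noncomputable section

/-! ### Decomposing balanced multigraphs into directed cycles -/

/-- Equal in- and out-degrees allow every edge into `w` to be matched with an edge out of `w` that
follows it. -/
lemma exists_perm_tail_eq_head {E W : Type*} {tail head : E → W}
    (hbal : ∀ w, Nonempty ({e // head e = w} ≃ {e // tail e = w})) :
    ∃ σ : Equiv.Perm E, ∀ e, tail (σ e) = head e := by
  classical
  let g : ∀ w, {e // head e = w} ≃ {e // tail e = w} := fun w => (hbal w).some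
  refine ⟨(Equiv.sigmaFiberEquiv head).symm.trans
    ((Equiv.sigmaCongrRight g).trans (Equiv.sigmaFiberEquiv tail)), fun e => ?_⟩
  exact (g (head e) ⟨e, rfl⟩).2

section Decomposition

variable {E W : Type*} [Fintype E] [DecidableEq E] {tail head : E → W}

/-- Both `a` and `b` lie in one cycle of `σ`, so the swap never leaves a cycle of `σ`: the new
cycles refine the old ones. -/
lemma sameCycle_of_swap_mul {σ : Equiv.Perm E} {a b : E} (hab : σ.SameCycle a b) {x y : E}
    (h : (Equiv.swap a b * σ).SameCycle x y) : σ.SameCycle x y := by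
  obtain ⟨n, rfl⟩ := h.exists_nat_pow_eq
  clear h
  induction n with
  | zero => exact Equiv.Perm.SameCycle.refl _ _
  | succ n ih =>
    rw [pow_succ', Equiv.Perm.mul_apply]
    set z := ((Equiv.swap a b * σ) ^ n) x
    refine ih.trans ?_
    have hz : σ.SameCycle z (σ z) := ⟨1, by simp⟩
    refine hz.trans ?_
    rw [Equiv.Perm.mul_apply]
    by_cases h1 : σ z = a
    · rw [h1, Equiv.swap_apply_left]; exact hab
    · by_cases h2 : σ z = b
      · rw [h2, Equiv.swap_apply_right]; exact hab.symm
      · rw [Equiv.swap_apply_of_ne_of_ne h1 h2]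

/-- For the least `k` with `(σ ^ k) a = b`, the orbit of `a` after the swap returns to `a` at step
`k` instead of reaching `b`: the cycle is cut in two. -/
lemma not_sameCycle_swap_mul {σ : Equiv.Perm E} {a b : E} (hab : σ.SameCycle a b) (hne : a ≠ b) :
    ¬ (Equiv.swap a b * σ).SameCycle a b := by
  classical
  have hex : ∃ n : ℕ, (σ ^ n) a = b := hab.exists_nat_pow_eq
  set k := Nat.find hex with hk
  have hkb : (σ ^ k) a = b := Nat.find_spec hex
  have hmin : ∀ j < k, (σ ^ j) a ≠ b := fun j hj => Nat.find_min hex hj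
  have hk0 : 0 < k := by
    rcases Nat.eq_zero_or_pos k with h | h
    · rw [h] at hkb; exact absurd hkb hne
    · exact h
  have hna : ∀ j, 0 < j → j < k → (σ ^ j) a ≠ a := by
    intro j hj hjk h
    refine hmin (k - j) (by omega) ?_
    have : (σ ^ (k - j)) ((σ ^ j) a) = b := by
      rw [← Equiv.Perm.mul_apply, ← pow_add, Nat.sub_add_cancel hjk.le, hkb]
    rwa [h] at this
  intro h
  obtain ⟨n, hn⟩ := h.exists_nat_pow_eq
  have hinv : ∀ n : ℕ, ∃ j < k, ((Equiv.swap a b * σ) ^ n) a = (σ ^ j) a := by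
    intro n
    induction n with
    | zero => exact ⟨0, hk0, rfl⟩
    | succ n ih =>
      obtain ⟨j, hj, hj'⟩ := ih
      rw [pow_succ', Equiv.Perm.mul_apply, hj', Equiv.Perm.mul_apply, ← Equiv.Perm.mul_apply σ,
        ← pow_succ']
      rcases Nat.lt_or_ge (j + 1) k with h1 | h1
      · exact ⟨j + 1, h1, Equiv.swap_apply_of_ne_of_ne (hna _ (by omega) h1) (hmin _ h1)⟩
      · have : j + 1 = k := by omega
        rw [this, hkb, Equiv.swap_apply_right]
        exact ⟨0, hk0, rfl⟩
  obtain ⟨j, hj, hj'⟩ := hinv n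
  exact hmin j hj (hj'.symm.trans hn)

/-- A loopless multigraph whose in-degrees and out-degrees agree decomposes into directed cycles. -/
theorem nonempty_cycleDecomposition (hloop : ∀ e, tail e ≠ head e)
    (hbal : ∀ w, Nonempty ({e // head e = w} ≃ {e // tail e = w})) :
    Nonempty (CycleDecomposition tail head) := by
  classical
  obtain ⟨σ₀, hσ₀⟩ := exists_perm_tail_eq_head hbal
  -- The number of pairs in a common cycle measures coarseness. At its minimum no cycle visits a
  -- vertex twice, since exchanging the two departing edges `a` and `b` would split the cycle.
  let m : Equiv.Perm E → ℕ := fun σ => (Finset.univ.filter fun p : E × E => σ.SameCycle p.1 p.2).card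
  obtain ⟨σ, hσ, hmin⟩ := Finset.exists_min_image
    (Finset.univ.filter fun σ : Equiv.Perm E => ∀ e, tail (σ e) = head e) m
    ⟨σ₀, by simpa using hσ₀⟩
  replace hσ : ∀ e, tail (σ e) = head e := by simpa using hσ
  have hinj : ∀ a b, σ.SameCycle a b → tail a = tail b → a = b := by
    intro a b hab ht
    by_contra hne
    have hmem : ∀ e, tail ((Equiv.swap a b * σ) e) = head e := by
      intro e
      rw [Equiv.Perm.mul_apply, ← hσ e]
      by_cases h1 : σ e = a
      · rw [h1, Equiv.swap_apply_left, ht]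
      · by_cases h2 : σ e = b
        · rw [h2, Equiv.swap_apply_right, ht]
        · rw [Equiv.swap_apply_of_ne_of_ne h1 h2]
    have hle := hmin (Equiv.swap a b * σ) (by simpa using hmem)
    refine absurd hle (not_le.2 (Finset.card_lt_card ?_))
    rw [Finset.ssubset_iff_of_subset]
    · exact ⟨(a, b), by simpa using hab, by simpa using not_sameCycle_swap_mul hab hne⟩
    · intro p hp
      simp only [Finset.mem_filter, Finset.mem_univ, true_and] at hp ⊢
      exact sameCycle_of_swap_mul hab hp
  refine ⟨⟨σ.cycleFactorsFinset, fun c hc => ?_, fun c hc c' hc' hne => ?_, fun e => ?_⟩⟩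
  · have hc' := Equiv.Perm.mem_cycleFactorsFinset_iff.1 hc
    refine ⟨hc'.1, fun e he => ?_, fun a ha b hb h => ?_⟩
    · rw [hc'.2 e he, hσ]
    · refine hinj a b ?_ h
      have hac := Equiv.Perm.cycle_is_cycleOf ha hc
      rw [hac] at hb
      exact (Equiv.Perm.mem_support_cycleOf_iff.1 hb).1
  · exact (Equiv.Perm.cycleFactorsFinset_pairwise_disjoint σ hc hc' hne).disjoint_support
  · have he : σ e ≠ e := fun h => hloop e (by rw [← hσ e, h])
    refine ⟨σ.cycleOf e, Equiv.Perm.cycleOf_mem_cycleFactorsFinset_iff.2 (by simpa using he), ?_⟩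
    rw [Equiv.Perm.mem_support, Equiv.Perm.cycleOf_apply_self]
    exact he

/-- The sign of a cycle decomposition is the product of the orientation signs of all edges. -/
theorem PlaneDrawing.decompositionSign_eq [Finite W] {G : SimpleGraph W} {D : PlaneDrawing G}
    (hD : D.NoNestedComponents) {O : GraphOrientation G} (hO : D.IsPfaffian O)
    (hadj : ∀ e, G.Adj (tail e) (head e)) (𝒟 : CycleDecomposition tail head) :
    D.decompositionSign 𝒟 = ∏ e : E, O.sign (tail e) (head e) := by
  classical
  have huniv : (Finset.univ : Finset E) = 𝒟.cycles.biUnion fun d => d.support := by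
    ext e
    simpa using 𝒟.cover e
  rw [huniv, Finset.prod_biUnion fun c hc c' hc' hne => 𝒟.edge_disjoint c hc c' hc' hne,
    PlaneDrawing.decompositionSign]
  refine Finset.prod_congr rfl fun d hd => ?_
  rw [D.prod_sign_cycle hD hO (𝒟.isDirectedCycle d hd) fun e _ => hadj e]

end Decomposition

/-! ### Signs of loops in the oriented Cartesian product -/

section Product

variable {k : ℕ} {n : Fin k → ℕ} {G : ∀ i, SimpleGraph (Fin (n i))}

lemma EvenLoop.next_mem {V : Type*} [Fintype V] [DecidableEq V] {H : SimpleGraph V}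
    {ℓ : EvenLoop H} {v : V} : ℓ.next v ∈ ℓ.support ↔ v ∈ ℓ.support :=
  Equiv.Perm.apply_mem_support

lemma EvenLoop.adj {V : Type*} [Fintype V] [DecidableEq V] {H : SimpleGraph V}
    {ℓ : EvenLoop H} {v : V} (hv : v ∈ ℓ.support) : H.Adj v (ℓ.next v) :=
  ℓ.2.2.2 v hv

lemma adj_of_ne {u v : ∀ i, Fin (n i)} (h : (cartesianProduct G).Adj u v) {i : Fin k}
    (hi : u i ≠ v i) : (G i).Adj (u i) (v i) := by
  obtain ⟨j, hj, hne⟩ := h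
  obtain rfl : i = j := by
    by_contra hij
    exact hi (hne i hij)
  exact hj

/-- In-degree minus out-degree of `w` can be summed over all steps of the loop, as steps in other
coordinates contribute `0`; it vanishes because the loop permutes its vertices. -/
theorem nonempty_projectionDecomposition (ℓ : EvenLoop (cartesianProduct G)) (i : Fin k) :
    Nonempty (ProjectionDecomposition ℓ i) := by
  classical
  refine nonempty_cycleDecomposition (fun e => e.2.2) fun w => ?_
  rw [← Fintype.card_eq, Fintype.card_subtype, Fintype.card_subtype]
  have h1 : ((Finset.univ.filter fun e : projectionEdges ℓ i => projectionHead ℓ i e = w).card : ℤ)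
      - (Finset.univ.filter fun e : projectionEdges ℓ i => projectionTail ℓ i e = w).card =
      ∑ v ∈ ℓ.support, ((if ℓ.next v i = w then 1 else 0) - (if v i = w then 1 else 0)) := by
    rw [Finset.card_filter, Finset.card_filter]
    push_cast
    rw [← Finset.sum_sub_distrib]
    have h2 : ∑ v ∈ ℓ.support, (((if ℓ.next v i = w then 1 else 0) - (if v i = w then 1 else 0)) : ℤ)
        = ∑ v ∈ ℓ.support with v i ≠ ℓ.next v i,
          ((if ℓ.next v i = w then 1 else 0) - (if v i = w then 1 else 0)) := by
      rw [Finset.sum_filter_of_ne]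
      intro v _ hv h
      rw [h, sub_self] at hv
      exact hv rfl
    rw [h2]
    exact (Finset.sum_subtype (p := fun v => v ∈ ℓ.support ∧ v i ≠ ℓ.next v i)
      (ℓ.support.filter fun v => v i ≠ ℓ.next v i) (fun v => by simp)
      fun v => (((if ℓ.next v i = w then 1 else 0) - (if v i = w then 1 else 0)) : ℤ)).symm
  have h2 : ∑ v ∈ ℓ.support, (((if ℓ.next v i = w then 1 else 0) - (if v i = w then 1 else 0)) : ℤ)
      = 0 := by
    rw [Finset.sum_sub_distrib, sub_eq_zero]
    exact Finset.sum_equiv ℓ.1 (fun v => EvenLoop.next_mem.symm) fun v _ => rfl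
  omega

/-- The sign of a step in the oriented Cartesian product. -/
lemma sign_cartesianOrientation (O : ∀ i, GraphOrientation (G i)) {u v : ∀ i, Fin (n i)}
    (h : (cartesianProduct G).Adj u v) :
    (cartesianOrientation O).sign u v =
      ∏ i with u i ≠ v i, (-1) ^ laterSum i u * (O i).sign (u i) (v i) := by
  obtain ⟨i, hi, hne⟩ := h
  -- A step changes one coordinate, so the product has a single factor. Its form lets it be
  -- interchanged with the product over the steps of a loop.
  have hset : (Finset.univ.filter fun j => u j ≠ v j) = {i} := by
    ext j
    simp only [Finset.mem_filter, Finset.mem_univ, true_and, Finset.mem_singleton]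
    exact ⟨fun h => by by_contra hj; exact h (hne j hj), fun h => h ▸ hi.ne⟩
  rw [hset, Finset.prod_singleton]
  have harr : (cartesianOrientation O).arrow u v ↔
      (Even (laterSum i u) ∧ (O i).arrow (u i) (v i)) ∨
      (¬ Even (laterSum i u) ∧ (O i).arrow (v i) (u i)) := by
    constructor
    · rintro ⟨j, hj, h'⟩
      obtain rfl : i = j := by
        by_contra hij
        exact hi.ne (hj i hij)
      exact h'
    · exact fun h => ⟨i, hne, h⟩
  classical
  unfold GraphOrientation.sign
  by_cases he : Even (laterSum i u)
  · rw [he.neg_one_pow, one_mul]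
    refine if_congr (harr.trans ⟨?_, fun h => Or.inl ⟨he, h⟩⟩) rfl rfl
    rintro (h | h)
    exacts [h.2, absurd he h.1]
  · rw [(Nat.not_even_iff_odd.1 he).neg_one_pow]
    rcases (O i).arrow_or_arrow _ _ hi with ha | ha
    · rw [if_pos ha, if_neg]
      · rfl
      · rw [harr]
        rintro (h | h)
        exacts [he h.1, (O i).asymm _ _ ha h.2]
    · rw [if_neg ((O i).asymm _ _ ha), if_pos (harr.2 (Or.inr ⟨he, ha⟩))]
      rfl

/-- The sign of a loop, computed from the orientation of the Cartesian product. -/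
theorem loopSign_eq {D : ∀ i, PlaneDrawing (G i)} (hD : ∀ i, (D i).NoNestedComponents)
    {O : ∀ i, GraphOrientation (G i)} (hO : ∀ i, (D i).IsPfaffian (O i))
    (ℓ : EvenLoop (cartesianProduct G)) (𝒟 : ∀ i, ProjectionDecomposition ℓ i) :
    loopSign D ℓ 𝒟 = - ∏ v ∈ ℓ.support, (cartesianOrientation O).sign v (ℓ.next v) := by
  classical
  unfold loopSign
  congr 1
  have hflip : ∏ i ∈ Finset.univ.filter (fun i : Fin k => (i : ℕ) + 1 < k),
      (-1 : ℤ) ^ flippedCount ℓ i =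
      ∏ i : Fin k, ∏ v ∈ ℓ.support with v i ≠ ℓ.next v i, (-1) ^ laterSum i v := by
    have h1 : ∀ i : Fin k, ∏ v ∈ ℓ.support with v i ≠ ℓ.next v i, (-1 : ℤ) ^ laterSum i v =
        (-1) ^ flippedCount ℓ i := by
      intro i
      have hset : {v | v ∈ ℓ.support ∧ v i ≠ ℓ.next v i ∧ Odd (laterSum i v)} =
          (((ℓ.support.filter fun v => v i ≠ ℓ.next v i).filter fun v => Odd (laterSum i v) :
            Finset (∀ i, Fin (n i))) : Set (∀ i, Fin (n i))) := by
        ext v; simp [and_assoc]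
      rw [flippedCount, hset, Set.ncard_coe_finset, ← Finset.prod_const, eq_comm,
        Finset.prod_filter]
      refine Finset.prod_congr rfl fun v _ => ?_
      split_ifs with h
      · exact h.neg_one_pow.symm
      · exact (Nat.not_odd_iff_even.1 h).neg_one_pow.symm
    rw [Finset.prod_congr rfl fun i _ => h1 i]
    refine Finset.prod_filter_of_ne fun i _ hi => ?_
    by_contra hlast
    -- For the last factor `laterSum` is an empty sum plus `k - k = 0`, so nothing is flipped there
    -- and its omission from the sign is harmless.
    have hi' : (i : ℕ) + 1 = k := by have := i.2; omega
    refine hi ?_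
    have hzero : ∀ v : ∀ i, Fin (n i), laterSum i v = 0 := by
      intro v
      have : Finset.Ioi i = ∅ := by
        ext j
        have := j.2
        simp only [Finset.mem_Ioi, Finset.notMem_empty, iff_false, Fin.lt_def]
        omega
      rw [laterSum, this, hi']
      simp
    have : flippedCount ℓ i = 0 := by
      rw [flippedCount, Set.ncard_eq_zero (Set.toFinite _), Set.eq_empty_iff_forall_notMem]
      rintro v ⟨-, -, h⟩
      rw [hzero] at h
      exact absurd h (by decide)
    rw [this, pow_zero]
  have hdec : ∀ i, (D i).decompositionSign (𝒟 i) =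
      ∏ v ∈ ℓ.support with v i ≠ ℓ.next v i, (O i).sign (v i) (ℓ.next v i) := by
    intro i
    refine (PlaneDrawing.decompositionSign_eq (tail := projectionTail ℓ i)
      (head := projectionHead ℓ i) (hD i) (hO i)
      (fun e => adj_of_ne (EvenLoop.adj e.2.1) e.2.2) (𝒟 i)).trans ?_
    exact (Finset.prod_subtype (p := fun v => v ∈ ℓ.support ∧ v i ≠ ℓ.next v i)
      (ℓ.support.filter fun v => v i ≠ ℓ.next v i)
      (fun v => by simp) fun v => (O i).sign (v i) (ℓ.next v i)).symm
  rw [hflip, Finset.prod_congr rfl fun i _ => hdec i, ← Finset.prod_mul_distrib]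
  simp_rw [← Finset.prod_mul_distrib, Finset.prod_filter]
  rw [Finset.prod_comm]
  refine Finset.prod_congr rfl fun v hv => ?_
  rw [sign_cartesianOrientation O (EvenLoop.adj hv), Finset.prod_filter]

end Product

end

noncomputable section

/-! ### The determinant of a generalised adjacency matrix -/

section Entries

variable {V : Type*} [DecidableEq V] {R : Type*} [CommRing R] {H : SimpleGraph V}

lemma generalisedAdjacency_of_adj (O : GraphOrientation H) (x : V → R) (a : Sym2 V → R) {v w : V}
    (h : H.Adj v w) : generalisedAdjacency O x a v w = (O.sign v w : R) * a s(v, w) := by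
  unfold generalisedAdjacency GraphOrientation.sign
  rw [Matrix.of_apply, if_neg h.ne]
  by_cases h1 : O.arrow v w
  · simp [h1]
  · have := (O.arrow_or_arrow v w h).resolve_left h1
    simp [h1, this]

lemma generalisedAdjacency_of_not_adj (O : GraphOrientation H) (x : V → R) (a : Sym2 V → R)
    {v w : V} (hne : v ≠ w) (h : ¬ H.Adj v w) : generalisedAdjacency O x a v w = 0 := by
  unfold generalisedAdjacency
  rw [Matrix.of_apply, if_neg hne, if_neg fun h' => h (O.adj_of_arrow _ _ h'),
    if_neg fun h' => h (O.adj_of_arrow _ _ h').symm]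

lemma generalisedAdjacency_self (O : GraphOrientation H) (x : V → R) (a : Sym2 V → R) (v : V) :
    generalisedAdjacency O x a v v = x v := by
  unfold generalisedAdjacency
  rw [Matrix.of_apply, if_pos rfl]

/-- Antisymmetry fails on the diagonal, which carries the vertex weights, but the cancellation of
odd cycles uses only the other entries. -/
lemma generalisedAdjacency_swap (O : GraphOrientation H) (x : V → R) (a : Sym2 V → R) {v w : V}
    (hne : v ≠ w) : generalisedAdjacency O x a w v = - generalisedAdjacency O x a v w := by
  by_cases h : H.Adj v w
  · rw [generalisedAdjacency_of_adj O x a h, generalisedAdjacency_of_adj O x a h.symm,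
      Sym2.eq_swap]
    unfold GraphOrientation.sign
    rcases O.arrow_or_arrow v w h with h1 | h1
    · simp [h1, O.asymm _ _ h1]
    · simp [h1, O.asymm _ _ h1]
  · rw [generalisedAdjacency_of_not_adj O x a hne h,
      generalisedAdjacency_of_not_adj O x a hne.symm fun h' => h h'.symm, neg_zero]

end Entries

/-! ### Cancelling odd cycles and expanding over configurations -/

section Determinant

variable {V : Type*} [Fintype V] [DecidableEq V] {R : Type*} [CommRing R] {H : SimpleGraph V}

/-- Reversing one cycle of a permutation. -/
lemma Equiv.Perm.reverse_cycle {σ c : Equiv.Perm V} (hc : c ∈ σ.cycleFactorsFinset) :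
    (σ * c⁻¹ * c⁻¹).support = σ.support ∧
    (∀ v, ((σ * c⁻¹ * c⁻¹).cycleOf v).support = (σ.cycleOf v).support) ∧
    (∀ v ∈ c.support, (σ * c⁻¹ * c⁻¹).cycleOf v = c⁻¹) ∧
    (∀ v ∈ c.support, (σ * c⁻¹ * c⁻¹) v = c⁻¹ v) ∧
    (∀ v ∉ c.support, (σ * c⁻¹ * c⁻¹) v = σ v) := by
  have hdisj : (σ * c⁻¹).Disjoint c := Equiv.Perm.disjoint_mul_inv_of_mem_cycleFactorsFinset hc
  have hdisj' : (σ * c⁻¹).Disjoint c⁻¹ := hdisj.inv_right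
  -- The first factor `c⁻¹` deletes the cycle `c` from `σ`, so that `τ` fixes its support; the
  -- second inserts the reversed cycle.
  set τ := σ * c⁻¹ with hτ
  have hσ : σ = τ * c := by rw [hτ, inv_mul_cancel_right]
  have hcyc := (Equiv.Perm.mem_cycleFactorsFinset_iff.1 hc).1
  have hτc : ∀ v ∈ c.support, τ v = v := fun v hv =>
    (hdisj v).resolve_right (Equiv.Perm.mem_support.1 hv)
  refine ⟨?_, fun v => ?_, fun v hv => ?_, fun v hv => ?_, fun v hv => ?_⟩
  · conv_rhs => rw [hσ]
    rw [hdisj'.support_mul, hdisj.support_mul, Equiv.Perm.support_inv]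
  · conv_rhs => rw [hσ]
    rw [hdisj'.cycleOf_mul_distrib, hdisj.cycleOf_mul_distrib]
    by_cases hv : v ∈ c.support
    · rw [(Equiv.Perm.cycleOf_eq_one_iff τ).2 (hτc v hv), one_mul, one_mul, ← Equiv.Perm.cycleOf_inv,
        Equiv.Perm.support_inv]
    · have h1 : c v = v := Equiv.Perm.notMem_support.1 hv
      rw [(Equiv.Perm.cycleOf_eq_one_iff c).2 h1, ← Equiv.Perm.cycleOf_inv,
        (Equiv.Perm.cycleOf_eq_one_iff c).2 h1, inv_one]
  · rw [hdisj'.cycleOf_mul_distrib, (Equiv.Perm.cycleOf_eq_one_iff τ).2 (hτc v hv), one_mul]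
    refine hcyc.inv.cycleOf_eq ?_
    rw [← Equiv.Perm.mem_support, Equiv.Perm.support_inv]
    exact hv
  · rw [Equiv.Perm.mul_apply]
    refine hτc _ ?_
    rw [← Equiv.Perm.support_inv, Equiv.Perm.apply_mem_support, Equiv.Perm.support_inv]
    exact hv
  · have h1 : c v = v := Equiv.Perm.notMem_support.1 hv
    have h2 : c⁻¹ v = v := by rw [Equiv.Perm.inv_eq_iff_eq, h1]
    rw [Equiv.Perm.mul_apply, h2, hτ, Equiv.Perm.mul_apply, h2]

open Equiv.Perm in
/-- The vertices on the cycles of odd length of a permutation. -/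
def oddVertices (σ : Equiv.Perm V) : Finset V :=
  σ.support.filter fun v => Odd (σ.cycleOf v).support.card

open Classical in
/-- Reverse the direction of a chosen odd cycle of the permutation. -/
def reverseOddCycle (σ : Equiv.Perm V) : Equiv.Perm V :=
  if h : (oddVertices σ).Nonempty then
    σ * (σ.cycleOf h.choose)⁻¹ * (σ.cycleOf h.choose)⁻¹
  else σ

/-- Reversal keeps the support of every cycle. As the cycle to be reversed is chosen through the set
`oddVertices`, a second reversal picks the same vertices' cycle and undoes the first. -/
lemma oddVertices_reverse_cycle {σ c : Equiv.Perm V} (hc : c ∈ σ.cycleFactorsFinset) :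
    oddVertices (σ * c⁻¹ * c⁻¹) = oddVertices σ := by
  obtain ⟨h1, h2, -⟩ := Equiv.Perm.reverse_cycle hc
  unfold oddVertices
  rw [h1]
  exact Finset.filter_congr fun v _ => by rw [h2]

lemma Finset.Nonempty.choose_congr {α : Type*} {s t : Finset α} (h : s = t) (hs : s.Nonempty)
    (ht : t.Nonempty) : hs.choose = ht.choose := by
  subst h
  rfl

/-- Reversing an odd cycle keeps the sign of the permutation and negates an odd number of
off-diagonal entries, so the terms cancel in pairs, over any commutative ring. -/
lemma sum_oddVertices_nonempty (M : Matrix V V R) (hM : ∀ v w, v ≠ w → M w v = - M v w) :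
    ∑ σ : Equiv.Perm V with (oddVertices σ).Nonempty,
      ((Equiv.Perm.sign σ : ℤ) : R) * ∏ v, M v (σ v) = 0 := by
  have key : ∀ σ : Equiv.Perm V, (h : (oddVertices σ).Nonempty) →
      ∃ c ∈ σ.cycleFactorsFinset, c = σ.cycleOf h.choose ∧ h.choose ∈ c.support ∧
        Odd c.support.card ∧ reverseOddCycle σ = σ * c⁻¹ * c⁻¹ ∧
        oddVertices (reverseOddCycle σ) = oddVertices σ := by
    intro σ h
    have hmem := Finset.mem_filter.1 h.choose_spec
    have hc := Equiv.Perm.cycleOf_mem_cycleFactorsFinset_iff.2 hmem.1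
    have hrev : reverseOddCycle σ = σ * (σ.cycleOf h.choose)⁻¹ * (σ.cycleOf h.choose)⁻¹ := by
      rw [reverseOddCycle, dif_pos h]
    refine ⟨_, hc, rfl, ?_, hmem.2, hrev, ?_⟩
    · rw [Equiv.Perm.mem_support, Equiv.Perm.cycleOf_apply_self, ← Equiv.Perm.mem_support]
      exact hmem.1
    · rw [hrev]
      exact oddVertices_reverse_cycle hc
  refine Finset.sum_involution (fun σ _ => reverseOddCycle σ) ?_ ?_ ?_ ?_
  · intro σ hσ
    obtain ⟨c, hc, -, -, hodd, hrev, -⟩ := key σ (Finset.mem_filter.1 hσ).2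
    obtain ⟨-, -, -, h4, h5⟩ := Equiv.Perm.reverse_cycle hc
    rw [hrev]
    have hsign : Equiv.Perm.sign (σ * c⁻¹ * c⁻¹) = Equiv.Perm.sign σ := by
      rw [Equiv.Perm.sign_mul, Equiv.Perm.sign_mul, Equiv.Perm.sign_inv, mul_assoc,
        Int.units_mul_self, mul_one]
    have hprod : ∏ v, M v ((σ * c⁻¹ * c⁻¹) v) = - ∏ v, M v (σ v) := by
      rw [← Finset.prod_mul_prod_compl c.support, ← Finset.prod_mul_prod_compl c.support]
      rw [Finset.prod_congr rfl fun v hv => by rw [h4 v hv],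
        Finset.prod_congr (rfl : c.supportᶜ = _) fun v hv => by rw [h5 v (Finset.mem_compl.1 hv)],
        ← neg_mul]
      congr 1
      have h6 : ∏ v ∈ c.support, M v (c⁻¹ v) = ∏ v ∈ c.support, M (c v) v :=
        (Finset.prod_equiv c (by simp) (by simp)).symm
      rw [h6, Finset.prod_congr rfl fun v hv => hM v (c v) (Equiv.Perm.mem_support.1 hv).symm,
        Finset.prod_neg, hodd.neg_one_pow, neg_one_mul]
      congr 1
      refine Finset.prod_congr rfl fun v hv => ?_
      rw [(Equiv.Perm.mem_cycleFactorsFinset_iff.1 hc).2 v hv]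
    rw [hsign, hprod]
    ring
  -- A permutation fixed by the reversal would have `c ^ 2 = 1`, hence a cycle of length two, which
  -- is not odd.
  · intro σ hσ _ heq
    obtain ⟨c, hc, -, -, hodd, hrev, -⟩ := key σ (Finset.mem_filter.1 hσ).2
    have hcyc := (Equiv.Perm.mem_cycleFactorsFinset_iff.1 hc).1
    rw [hrev, mul_assoc, mul_eq_left, ← mul_inv_rev, inv_eq_one, ← pow_two] at heq
    have h1 := orderOf_dvd_of_pow_eq_one heq
    rw [hcyc.orderOf] at h1
    have h2 := hcyc.two_le_card_support
    have h3 := Nat.le_of_dvd two_pos h1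
    have h4 : c.support.card = 2 := by omega
    rw [h4] at hodd
    exact absurd hodd (by decide)
  · intro σ hσ
    obtain ⟨c, -, -, -, -, -, hset⟩ := key σ (Finset.mem_filter.1 hσ).2
    simp only [Finset.mem_filter, Finset.mem_univ, true_and, hset]
    exact (Finset.mem_filter.1 hσ).2
  · intro σ hσ
    obtain ⟨c, hc, hcv, hvc, -, hrev, hset⟩ := key σ (Finset.mem_filter.1 hσ).2
    obtain ⟨c', -, hcv', -, -, hrev', -⟩ := key (reverseOddCycle σ) (by
      rw [hset]; exact (Finset.mem_filter.1 hσ).2)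
    have : c' = c⁻¹ := by
      rw [hcv', Finset.Nonempty.choose_congr hset _ (Finset.mem_filter.1 hσ).2, hrev]
      exact (Equiv.Perm.reverse_cycle hc).2.2.1 _ hvc
    rw [hrev', hrev, this]
    group

/-- A directed even loop as a cyclic permutation. -/
def evenLoopPerm (H : SimpleGraph V) : EvenLoop H ↪ Equiv.Perm V :=
  ⟨fun ℓ => ℓ.1, fun _ _ h => Subtype.ext h⟩

/-- The loops of a configuration. -/
def LoopConfiguration.loops {H : SimpleGraph V} (C : LoopConfiguration H) :
    Finset (EvenLoop H) := C.1

lemma exists_perm_of_configuration {H : SimpleGraph V} (C : LoopConfiguration H) :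
    ∃ σ : Equiv.Perm V, σ.cycleFactorsFinset = C.loops.map (evenLoopPerm H) := by
  classical
  have hdisj : ((C.loops.map (evenLoopPerm H) : Finset (Equiv.Perm V)) :
      Set (Equiv.Perm V)).Pairwise Equiv.Perm.Disjoint := by
    intro f hf g hg hne
    obtain ⟨ℓ, hℓ, rfl⟩ := Finset.mem_map.1 hf
    obtain ⟨ℓ', hℓ', rfl⟩ := Finset.mem_map.1 hg
    rw [Equiv.Perm.disjoint_iff_disjoint_support]
    exact C.2 ℓ hℓ ℓ' hℓ' fun h => hne (by rw [h])
  refine ⟨_, Equiv.Perm.cycleFactorsFinset_eq_finset.2 ⟨?_, hdisj, rfl⟩⟩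
  intro f hf
  obtain ⟨ℓ, -, rfl⟩ := Finset.mem_map.1 hf
  exact ℓ.2.1

lemma sign_eq_prod_cycleFactors (σ : Equiv.Perm V) :
    Equiv.Perm.sign σ = ∏ c ∈ σ.cycleFactorsFinset, Equiv.Perm.sign c := by
  conv_lhs => rw [← Equiv.Perm.cycleFactorsFinset_noncommProd σ, Finset.map_noncommProd]
  rw [Finset.noncommProd_eq_prod]
  rfl

lemma prod_eq_prod_cycleFactors (M : Matrix V V R) (σ : Equiv.Perm V) :
    ∏ v, M v (σ v) = (∏ c ∈ σ.cycleFactorsFinset, ∏ v ∈ c.support, M v (c v)) *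
      ∏ v ∈ σ.supportᶜ, M v v := by
  have hsupp : σ.support = σ.cycleFactorsFinset.biUnion fun c => c.support := by
    ext v
    rw [Finset.mem_biUnion, Equiv.Perm.mem_support_iff_mem_support_of_mem_cycleFactorsFinset]
  rw [← Finset.prod_mul_prod_compl σ.support]
  congr 1
  · rw [hsupp, Finset.prod_biUnion]
    · refine Finset.prod_congr rfl fun c hc => Finset.prod_congr rfl fun v hv => ?_
      rw [(Equiv.Perm.mem_cycleFactorsFinset_iff.1 hc).2 v hv]
    · intro c hc c' hc' hne
      exact (Equiv.Perm.cycleFactorsFinset_pairwise_disjoint σ hc hc' hne).disjoint_support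
  · refine Finset.prod_congr rfl fun v hv => ?_
    rw [Equiv.Perm.notMem_support.1 (Finset.mem_compl.1 hv)]

/-- The determinant of a generalised adjacency matrix as a sum over loop configurations. -/
theorem det_generalisedAdjacency (O : GraphOrientation H) (x : V → R) (a : Sym2 V → R) :
    (generalisedAdjacency O x a).det = partitionFunction H
      (fun ℓ => ((- ∏ v ∈ ℓ.support, O.sign v (ℓ.next v) : ℤ) : R) *
        ∏ v ∈ ℓ.support, a s(v, ℓ.next v)) x := by
  classical
  set M := generalisedAdjacency O x a with hM
  -- The determinant expands into entries `M (σ v) v`; after transposition they are `M v (σ v)`,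
  -- which follow the direction of the loops.
  rw [← Matrix.det_transpose, Matrix.det_apply']
  simp only [Matrix.transpose_apply]
  rw [← Finset.sum_filter_add_sum_filter_not Finset.univ fun σ : Equiv.Perm V =>
    (oddVertices σ).Nonempty, sum_oddVertices_nonempty M fun v w hne =>
      generalisedAdjacency_swap O x a hne, zero_add, partitionFunction]
  choose f hf using exists_perm_of_configuration (H := H)
  have hfinj : Function.Injective f := by
    intro C C' h
    have h1 := hf C
    rw [h, hf C'] at h1
    exact Subtype.ext (Finset.map_injective _ h1).symm
  symm
  refine Finset.sum_of_injOn f hfinj.injOn ?_ ?_ ?_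
  · intro C _
    rw [Finset.mem_coe, Finset.mem_filter]
    refine ⟨Finset.mem_univ _, ?_⟩
    rintro ⟨v, hv⟩
    obtain ⟨hv1, hv2⟩ := Finset.mem_filter.1 hv
    have h1 := Equiv.Perm.cycleOf_mem_cycleFactorsFinset_iff.2 hv1
    rw [hf, Finset.mem_map] at h1
    obtain ⟨ℓ, -, hℓ⟩ := h1
    rw [← hℓ] at hv2
    exact absurd ℓ.2.2.1 (Nat.not_even_iff_odd.2 hv2)
  -- A remaining permutation with a nonzero term moves vertices only along edges and has only even
  -- nontrivial cycles, so these cycles form a configuration.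
  · intro σ hσ hnot
    by_contra hne
    have hadj : ∀ v ∈ σ.support, H.Adj v (σ v) := by
      intro v hv
      by_contra hcon
      refine hne ?_
      have hz : M v (σ v) = 0 := generalisedAdjacency_of_not_adj O x a
        (Equiv.Perm.mem_support.1 hv).symm hcon
      rw [Finset.prod_eq_zero (Finset.mem_univ v) hz, mul_zero]
    have hodd := (Finset.mem_filter.1 hσ).2
    have hgood : ∀ c ∈ σ.cycleFactorsFinset,
        c.IsCycle ∧ Even c.support.card ∧ ∀ v ∈ c.support, H.Adj v (c v) := by
      intro c hc
      obtain ⟨hc1, hc2⟩ := Equiv.Perm.mem_cycleFactorsFinset_iff.1 hc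
      refine ⟨hc1, ?_, fun v hv => ?_⟩
      · obtain ⟨v, hv⟩ := hc1.nonempty_support
        by_contra hcon
        refine hodd ⟨v, Finset.mem_filter.2 ⟨Equiv.Perm.mem_cycleFactorsFinset_support_le hc hv, ?_⟩⟩
        rw [← Equiv.Perm.cycle_is_cycleOf hv hc]
        exact Nat.not_even_iff_odd.1 hcon
      · rw [hc2 v hv]
        exact hadj v (Equiv.Perm.mem_cycleFactorsFinset_support_le hc hv)
    let C₀ : Finset (EvenLoop H) := Finset.univ.filter fun ℓ => ℓ.1 ∈ σ.cycleFactorsFinset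
    let C : LoopConfiguration H := ⟨C₀, fun ℓ hℓ ℓ' hℓ' hne => by
      have h1 := (Finset.mem_filter.1 hℓ).2
      have h2 := (Finset.mem_filter.1 hℓ').2
      exact (Equiv.Perm.cycleFactorsFinset_pairwise_disjoint σ h1 h2
        fun h => hne (Subtype.ext h)).disjoint_support⟩
    refine hnot ⟨C, Finset.mem_coe.2 (Finset.mem_univ _), ?_⟩
    apply Equiv.Perm.cycleFactorsFinset_injective
    rw [hf]
    ext c
    rw [Finset.mem_map]
    constructor
    · rintro ⟨ℓ, hℓ, rfl⟩
      exact (Finset.mem_filter.1 hℓ).2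
    · intro hc
      exact ⟨⟨c, hgood c hc⟩, Finset.mem_filter.2 ⟨Finset.mem_univ _, hc⟩, rfl⟩
  · intro C _
    rw [prod_eq_prod_cycleFactors, sign_eq_prod_cycleFactors, hf, Finset.prod_map,
      Finset.prod_map, ← mul_assoc]
    push_cast
    rw [← Finset.prod_mul_distrib]
    congr 1
    · refine Finset.prod_congr rfl fun ℓ hℓ => ?_
      have h1 : ∏ v ∈ ℓ.1.support, M v (ℓ.1 v) =
          (∏ v ∈ ℓ.support, (O.sign v (ℓ.next v) : R)) * ∏ v ∈ ℓ.support, a s(v, ℓ.next v) := by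
        rw [← Finset.prod_mul_distrib]
        exact Finset.prod_congr rfl fun v hv =>
          generalisedAdjacency_of_adj O x a (ℓ.2.2.2 v hv)
      -- A cycle of even length is an odd permutation: this is the minus sign in front of the sign
      -- of a loop.
      have h2 : Equiv.Perm.sign ℓ.1 = -1 := by
        rw [ℓ.2.1.sign, ℓ.2.2.1.neg_one_pow]
      change _ = ((Equiv.Perm.sign ℓ.1 : ℤ) : R) * ∏ v ∈ ℓ.1.support, M v (ℓ.1 v)
      rw [h1, h2]
      push_cast
      ring
    · refine Finset.prod_congr ?_ fun v _ => (generalisedAdjacency_self O x a v).symm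
      ext v
      simp only [Finset.mem_filter, Finset.mem_univ, true_and, Finset.mem_compl]
      rw [Equiv.Perm.mem_support_iff_mem_support_of_mem_cycleFactorsFinset, hf]
      constructor
      · rintro h ⟨c, hc, hv⟩
        obtain ⟨ℓ, hℓ, rfl⟩ := Finset.mem_map.1 hc
        exact h ℓ hℓ hv
      · intro h ℓ hℓ hv
        exact h ⟨ℓ.1, Finset.mem_map.2 ⟨ℓ, hℓ, rfl⟩, hv⟩

end Determinant

end

/-! ### The signed partition function as a determinant -/

theorem mainTheorem1 {R : Type*} [CommRing R] {k : ℕ} {n : Fin k → ℕ}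
    (G : ∀ i, SimpleGraph (Fin (n i)))
    (D : ∀ i, PlaneDrawing (G i)) (hD : ∀ i, (D i).NoNestedComponents)
    (O : ∀ i, GraphOrientation (G i)) (hO : ∀ i, (D i).IsPfaffian (O i))
    (x : (∀ i, Fin (n i)) → R) (a : Sym2 (∀ i, Fin (n i)) → R) :
    (∀ (ℓ : EvenLoop (cartesianProduct G)) (i : Fin k), Nonempty (ProjectionDecomposition ℓ i)) ∧
    (∀ (ℓ : EvenLoop (cartesianProduct G)) (𝒟 𝒟' : ∀ i, ProjectionDecomposition ℓ i),
      loopSign D ℓ 𝒟 = loopSign D ℓ 𝒟') ∧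
    ∀ 𝒟 : ∀ (ℓ : EvenLoop (cartesianProduct G)) (i : Fin k), ProjectionDecomposition ℓ i,
      partitionFunction (cartesianProduct G) (fun ℓ => loopWeight D a ℓ (𝒟 ℓ)) x =
        (generalisedAdjacency (cartesianOrientation O) x a).det := by
  refine ⟨fun ℓ i => nonempty_projectionDecomposition ℓ i, fun ℓ 𝒟 𝒟' => ?_, fun 𝒟 => ?_⟩
  · rw [loopSign_eq hD hO, loopSign_eq hD hO]
  · rw [det_generalisedAdjacency]
    congr 1
    funext ℓ
    unfold loopWeight
    rw [loopSign_eq hD hO]
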